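/- Let $f\in\mathbb R[x,y]$ be a polynomial of degree $n\ge 3$, with homogeneous decomposition $f=\sum_{i=0}^n f_i$, and suppose that $f_n$ has no repeated factors. Put $F(u,v,\omega)=\sum_{i=0}^{n}\omega^{n-i}f_i(u,v)$, $A=-uF_{uu}-vF_{uv}$, $B=-uF_{uv}-vF_{vv}$, $S=u^2F_{uu}+2uvF_{uv}+v^2F_{vv}$. On the unit sphere $\mathbb S^2\subset\mathbb R^3$ with coordinates $(u,v,\omega)$ (the Poincaré sphere) consider the quadratic differential form $$Q=\omega^2\left(F_{uu}\,du^2+2F_{uv}\,du\,dv+F_{vv}\,dv^2\right)+2\omega\left(A\,du\,d\omega+B\,dv\,d\omega\right)+S\,d\omega^2,$$ which extends to the equator $\omega=0$ the second fundamental form $f_{xx}dx^2+2f_{xy}dx\,dy+f_{yy}dy^2$, pulled back by $x=u/\omega$, $y=v/\omega$ and multiplied by $\omega^{n+2}$. The extended fields of asymptotic lines $\mathbb Y_1,\mathbb Y_2$ are the two fields of null lines of $Q$ on $T\mathbb S^2$: $\mathbb Y_k(q)$ consists of the vectors $a\in T_q\mathbb S^2$ with $Q_q(a,a)=0$ and $(-1)^kQ_q(a,q\times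 a)\ge 0$. Equivalently, in positively oriented local coordinates in which $Q=\alpha\,dx^2+2\beta\,dx\,dy+\gamma\,dy^2$, $\mathbb Y_k$ is spanned by $\bigl(\gamma,\,-\beta+(-1)^k\sqrt{\beta^2-\alpha\gamma}\bigr)$ wherever this vector is nonzero and the radicand is nonnegative. A singular point at infinity of $\mathbb Y_k$ is a point of the equator at which $\mathbb Y_k$ contains two linearly independent directions. Let $k\in\{1,2\}$ and let $p$ be a singular point at infinity of $\mathbb Y_k$. Then: 1. $\mathbb Y_k$ is a continuous field of lines in a punctured neighbourhood of $p$, and its Poincaré index at $p$ is $\tfrac12$. 2. The local topological type of $\mathbb Y_k$ at $p$ is half node, half regular: there is a side $\sigma\in\{+1,-1\}$ of the equator and a homeomorphism from a neighbourhood of $p$ in $\mathbb S^2$ onto a neighbourhood of the origin in $\mathbb R^2$ that takes $p$ to the origin, the equator to the axis $\{b=0\}$, the side $\sigma\omega>0$ to $\{b>0\}$, the side $\sigma\omega<0$ to $\{b<0\}$, and the leaves of $\mathbb Y_k$ to the leaves of the model foliation of $\mathbb R^2\setminus\{0\}$ (coordinates $(a,b)$) by radial lines in $\{b>0\}$ (a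 node) and horizontal lines in $\{b\le 0\}$ (a nonsingular foliation). The other field $\mathbb Y_{3-k}$ has the same topological type at $p$ with the two sides exchanged: node on the side $\sigma\omega<0$ and nonsingular on the side $\sigma\omega>0$. -/

import Mathlib

open MvPolynomial Real

noncomputable section

/-- Euclidean 3-space with coordinates `(u, v, ω)`. -/
abbrev E3 : Type := EuclideanSpace ℝ (Fin 3)

/-- The Euclidean plane. -/
abbrev E2 : Type := EuclideanSpace ℝ (Fin 2)

/-- The Poincaré sphere: the unit sphere centred at the origin of 3-space. -/
abbrev PoincareSphere : Type := Metric.sphere (0 : E3) 1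

/-- The cross product on Euclidean 3-space. -/
def cross (x y : E3) : E3 := WithLp.toLp 2 (crossProduct x.ofLp y.ofLp)

/-- `F(u, v, ω) = ∑ ω ^ (n - i) f_i(u, v)`, where `n` is the degree of `f` and `f_i` its homogeneous
part of degree `i`. -/
def homogenized (f : MvPolynomial (Fin 2) ℝ) : MvPolynomial (Fin 3) ℝ :=
  ∑ i ∈ Finset.range (f.totalDegree + 1),
    X 2 ^ (f.totalDegree - i) * rename Fin.castSucc (homogeneousComponent i f)

/-- The symmetric matrix, at the point `(u, v, ω)`, of the quadratic differential form that extends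
the second fundamental form `f_xx dx² + 2 f_xy dx dy + f_yy dy²` (pulled back by `x = u / ω`,
`y = v / ω` and multiplied by `ω ^ (n + 2)`). -/
def formMatrix (f : MvPolynomial (Fin 2) ℝ) (q : E3) : Matrix (Fin 3) (Fin 3) ℝ :=
  let F := homogenized f
  let u := q 0
  let v := q 1
  let w := q 2
  let Fuu := eval q.ofLp (pderiv 0 (pderiv 0 F))
  let Fuv := eval q.ofLp (pderiv 0 (pderiv 1 F))
  let Fvv := eval q.ofLp (pderiv 1 (pderiv 1 F))
  let A := -u * Fuu - v * Fuv
  let B := -u * Fuv - v * Fvv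
  let S := u ^ 2 * Fuu + 2 * u * v * Fuv + v ^ 2 * Fvv
  !![w ^ 2 * Fuu, w ^ 2 * Fuv, w * A;
     w ^ 2 * Fuv, w ^ 2 * Fvv, w * B;
     w * A,       w * B,       S]

/-- The symmetric bilinear form at `q` whose quadratic form is the extended form. -/
def extendedForm (f : MvPolynomial (Fin 2) ℝ) (q a b : E3) : ℝ :=
  a.ofLp ⬝ᵥ (formMatrix f q).mulVec b.ofLp

/-- The two fields of lines on the sphere defined by the extended quadratic form `Q`; the sign
`ε = -1` gives `𝕐₁` and `ε = 1` gives `𝕐₂` (that is, `ε = (-1) ^ k`).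

At `q` the field consists of the tangent vectors `a` of the sphere with `Q a = 0` at which `ε Q` is
not decreasing when `a` is turned in the positive sense (in the direction of `q × a`). If `Q` is
indefinite on the tangent plane, the two null lines of `Q` are one for each sign `ε`; in a
positively oriented basis in which `Q = α x² + 2 β x y + γ y²`, they are spanned by
`(γ, -β + ε √(β² - α γ))` (when this is nonzero). If `Q` has rank one, both are the double null
line. If `Q = 0`, one gets the whole tangent plane, and if `Q` is definite, only zero (the field
is then not defined at `q`). -/
def asymptoticField (f : MvPolynomial (Fin 2) ℝ) (ε : ℤˣ) (q : E3) : Set E3 :=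
  {a | inner ℝ q a = 0 ∧ extendedForm f q a a = 0 ∧
    0 ≤ ((ε : ℤ) : ℝ) * extendedForm f q a (cross q a)}

/-- A singular point of the field of lines `L` at infinity: a point of the equator at which the
field has two different directions (so that it is defined there, but is not a line). -/
def IsSingularPointAtInfinity (L : E3 → Set E3) (p : PoincareSphere) : Prop :=
  (p : E3) 2 = 0 ∧ ∃ a ∈ L p, ∃ b ∈ L p, LinearIndependent ℝ ![a, b]

/-- The field of lines `L` in the plane is defined and continuous in a punctured disc about the
origin, and has Poincaré index `i` at the origin: in polar coordinates `(r, t)`, the field is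
spanned by `(cos θ, sin θ)` for a continuous angle `θ (r, t)` that increases by `2 π i` when the
circle of radius `r` is run through once in the positive sense. -/
def HasPlanarIndex (L : E2 → Set E2) (i : ℝ) : Prop :=
  ∃ r₀ > 0, ∃ θ : ℝ × ℝ → ℝ,
    ContinuousOn θ (Set.Ioo 0 r₀ ×ˢ Set.univ) ∧
    ∀ r ∈ Set.Ioo 0 r₀, ∀ t : ℝ,
      L !₂[r * cos t, r * sin t] = (Submodule.span ℝ {!₂[cos (θ (r, t)), sin (θ (r, t))]} : Set E2) ∧
      θ (r, t + 2 * π) = θ (r, t) + 2 * π * i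

/-- The inverse of the chart of the sphere at `p` that is the central projection to the tangent
plane `p + ⟨e₁, e₂⟩`. -/
def centralChart (p e₁ e₂ : E3) (x : E2) : E3 :=
  ‖p + x 0 • e₁ + x 1 • e₂‖⁻¹ • (p + x 0 • e₁ + x 1 • e₂)

/-- The field of lines `L` on the sphere has Poincaré index `i` at `p`: it has index `i` in the
central chart at `p`, for every positively oriented orthonormal basis of the tangent plane. -/
def HasPoincareIndex (L : E3 → Set E3) (p : PoincareSphere) (i : ℝ) : Prop :=
  ∀ e₁ e₂ : E3, Orthonormal ℝ ![e₁, e₂] → cross e₁ e₂ = p →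
    HasPlanarIndex
      (fun x => {ξ | fderiv ℝ (centralChart p e₁ e₂) x ξ ∈ L (centralChart p e₁ e₂ x)}) i

/-- `x` and `y` lie on one leaf in `U` of the foliation tangent to the field of lines `L`: they are
joined by a `C¹` curve in `U` that is tangent to `L`. -/
def SameLeaf {E : Type*} [NormedAddCommGroup E] [NormedSpace ℝ E] (L : E → Set E) (U : Set E)
    (x y : E) : Prop :=
  ∃ γ : ℝ → E, ContDiffOn ℝ 1 γ (Set.Icc 0 1) ∧ γ 0 = x ∧ γ 1 = y ∧
    ∀ t ∈ Set.Icc (0 : ℝ) 1, γ t ∈ U ∧ derivWithin γ (Set.Icc 0 1) t ∈ L (γ t)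

/-- The model: the radial lines (a node) in the open upper half-plane, the horizontal lines (a
nonsingular foliation) in the closed lower half-plane. -/
def nodeRegularModel (x : E2) : Set E2 :=
  if 0 < x 1 then (Submodule.span ℝ {x} : Set E2) else (Submodule.span ℝ {(!₂[1, 0] : E2)} : Set E2)

/-- Near the point `p` of the equator, the foliation of `L` has the topological type of the model,
with the node on the side `σ ω > 0` of the equator: a homeomorphism from a neighbourhood of
`p` onto a neighbourhood of the origin takes `p` to the origin, the equator to the horizontal axis,
the side `σ ω > 0` to the upper side, and leaves to leaves. -/
def HasNodeRegularType (L : E3 → Set E3) (p : PoincareSphere) (σ : ℤˣ) : Prop :=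
  ∃ h : OpenPartialHomeomorph PoincareSphere E2,
    p ∈ h.source ∧ h p = 0 ∧
    (∀ q ∈ h.source, SignType.sign ((h q) 1) = SignType.sign (((σ : ℤ) : ℝ) * (q : E3) 2)) ∧
    ∀ q ∈ h.source \ {p}, ∀ q' ∈ h.source \ {p},
      SameLeaf L ((↑) '' (h.source \ {p})) (q : E3) (q' : E3) ↔
        SameLeaf nodeRegularModel (h.target \ {0}) (h q) (h q')

end

/-! At a point `p` of the equator the form is `n (n - 1) f_n(p) dω²`. If `f_n(p) ≠ 0` its only null
direction is that of the equator, so a singular point at infinity is a zero of `f_n`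
(`eval_leading_eq_zero`). As `f_n` is squarefree the zero is simple: `f_n = ℓ g` with `ℓ` the linear
form vanishing at `p` and `g(p) ≠ 0` (`exists_simple_factor`).

In the central chart at `p`, with `y` along the equator and `z` of the sign of `s ω`, `s = ±1`, the
form is, up to a positive factor, `z² N dy² - 2 z B dy dz + G dz²`. By Euler's identity `B(0) = (n -
1) s g(p)`, and `G(y, 0)` vanishes at `y = 0` with derivative `n (n - 1) s g(p)`. Changing `s` turns
the chart by a half-turn and exchanges the two sides; `s` is chosen so that `b = ε B` and the
`y`-derivative of `γ = ε G` are positive at the origin. Writing `N` for `ε N` from here on and `R =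
√(b² - N γ)`, the form multiplied by `ε` factors as `(z dy - h (b + R) / (b + R) dz) (z N dy - (b +
R) dz)`, where `h = γ / (b + R)`. The null lines are spanned by `(h, z)` and by `(1, z N / (b +
R))`. The orientation condition selects the first for `z > 0` and the second for `z < 0`; on the
punctured axis both are horizontal. So the field is a node above the axis and regular below it, with
the axis as common boundary (`exists_nodeRegularField_centralChart`). Reversing both `ε` and `s`
leaves `ε s g(p)` unchanged, which gives the statement about the other field.

The topological type needs no linearization (`exists_straightening`). Above the axis the leaves
solve `dy/ds = h`, with the logarithm of the rescaled height as time. The radius `max |y| (A z)`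
increases strictly along each leaf and takes every small positive value, so a leaf can be carried to
a ray with the radius kept. Near a nonzero axis point the leaf label tends to `±∞`, so this map
extends continuously by the identity on the axis. Below, points are moved along leaves to the line
`y = 0` to find their new height. The two maps glue to a homeomorphism, and no tangent curve
avoiding the origin crosses the axis.

For the index, over the upper half-circle the field is never opposite to the radial vector, which
turns by `π`; over the lower one it stays at an acute angle to the horizontal. The total turn is
`π`, that is, index `1/2`. -/

noncomputable section

open Set Filter Topology

/-! ### Global flows of scalar time-dependent equations -/

/-- `Φ t₀ x` is the global solution of `y' = v t y` with `y t₀ = x`. -/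
structure IsGlobalFlow (v : ℝ → ℝ → ℝ) (Φ : ℝ → ℝ → ℝ → ℝ) : Prop where
  init : ∀ t₀ x, Φ t₀ x t₀ = x
  deriv : ∀ t₀ x t, HasDerivAt (Φ t₀ x) (v t (Φ t₀ x t)) t

/-- A bounded vector field on the line that is uniformly Lipschitz in space and continuous in time
has a global flow. -/
theorem exists_isGlobalFlow {v : ℝ → ℝ → ℝ} {C L : NNReal} (hb : ∀ t x, |v t x| ≤ C)
    (hl : ∀ t, LipschitzWith L (v t)) (hc : ∀ x, Continuous fun t => v t x) :
    ∃ Φ, IsGlobalFlow v Φ := by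
  have key : ∀ t₀ x : ℝ, ∃ y : ℝ → ℝ, y t₀ = x ∧ ∀ t, HasDerivAt y (v t (y t)) t := by
    intro t₀ x
    have hloc : ∀ T : NNReal, ∃ y : ℝ → ℝ, y t₀ = x ∧
        ∀ t ∈ Ioo (t₀ - T) (t₀ + T), HasDerivAt y (v t (y t)) t := by
      intro T
      have ht : t₀ ∈ Icc (t₀ - T) (t₀ + T) := by
        constructor <;> linarith [T.2, show (T : ℝ) = T.1 from rfl]
      -- The speed bound `C` confines a solution to distance `C * T` over time `T`, so
      -- Picard–Lindelöf works on the whole interval, for every `T`.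
      have hp : IsPicardLindelof v (⟨t₀, ht⟩ : Icc (t₀ - T) (t₀ + T)) x (C * T) 0 C L :=
        { lipschitzOnWith := fun t _ => (hl t).lipschitzOnWith
          continuousOn := fun x _ => (hc x).continuousOn
          norm_le := fun t _ x _ => hb t x
          mul_max_le := by simp }
      obtain ⟨y, hy0, hy⟩ := hp.exists_eq_forall_mem_Icc_hasDerivWithinAt₀
      exact ⟨y, hy0, fun t ht => (hy t (Ioo_subset_Icc_self ht)).hasDerivAt
        (Icc_mem_nhds ht.1 ht.2)⟩
    choose y hy0 hy using hloc
    -- The window of radius `|t - t₀| + 1` contains a unit neighbourhood of `t`; hence the glued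
    -- function coincides near `t` with one single local solution.
    let T : ℝ → NNReal := fun t => ⟨|t - t₀| + 1, by positivity⟩
    have hT : ∀ t, (T t : ℝ) = |t - t₀| + 1 := fun t => rfl
    have agree : ∀ S T : NNReal, ∀ t ∈ Ioo (t₀ - S) (t₀ + S), t ∈ Ioo (t₀ - T) (t₀ + T) →
        y S t = y T t := by
      intro S T t hS hT
      have hm : ∀ r : ℝ, r ∈ Ioo (t₀ - (min S T : NNReal)) (t₀ + (min S T : NNReal)) ↔
          r ∈ Ioo (t₀ - S) (t₀ + S) ∧ r ∈ Ioo (t₀ - T) (t₀ + T) := by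
        intro r
        simp only [mem_Ioo, NNReal.coe_min]
        rcases le_total (S : ℝ) T with h | h
        · rw [min_eq_left h]
          constructor
          · intro h'; refine ⟨h', ?_, ?_⟩ <;> linarith [h'.1, h'.2]
          · exact fun h' => h'.1
        · rw [min_eq_right h]
          constructor
          · intro h'; refine ⟨⟨?_, ?_⟩, h'⟩ <;> linarith [h'.1, h'.2]
          · exact fun h' => h'.2
      have ht := (hm t).2 ⟨hS, hT⟩
      refine ODE_solution_unique_of_mem_Ioo (v := v) (K := L) (s := fun _ => univ)
        (fun t _ => (hl t).lipschitzOnWith) (t₀ := t₀) ?_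
        (fun r hr => ⟨hy S r ((hm r).1 hr).1, trivial⟩)
        (fun r hr => ⟨hy T r ((hm r).1 hr).2, trivial⟩) (by rw [hy0, hy0]) ht
      constructor <;> linarith [ht.1, ht.2]
    have memT : ∀ t s : ℝ, |s - t| < 1 → s ∈ Ioo (t₀ - T t) (t₀ + T t) := by
      intro t s hs
      rw [hT, mem_Ioo]
      rw [abs_lt] at hs
      constructor <;> linarith [le_abs_self (t - t₀), neg_abs_le (t - t₀)]
    refine ⟨fun t => y (T t) t, by simp [hy0], fun t => ?_⟩
    refine (hy (T t) t (memT t t (by simp))).congr_of_eventuallyEq ?_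
    filter_upwards [Metric.ball_mem_nhds t one_pos] with s hs
    exact agree _ _ _ (memT s s (by simp)) (memT t s (by simpa [Real.dist_eq] using hs))
  choose Φ h0 h1 using key
  exact ⟨Φ, h0, h1⟩

namespace IsGlobalFlow

variable {v : ℝ → ℝ → ℝ} {Φ : ℝ → ℝ → ℝ → ℝ} {L C : NNReal}

theorem continuous (h : IsGlobalFlow v Φ) (t₀ x : ℝ) : Continuous (Φ t₀ x) :=
  continuous_iff_continuousAt.2 fun t => (h.deriv t₀ x t).continuousAt

theorem eq_of_hasDerivAt (h : IsGlobalFlow v Φ) (hl : ∀ t, LipschitzWith L (v t)) {y : ℝ → ℝ}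
    (hy : ∀ t, HasDerivAt y (v t (y t)) t) (t₀ : ℝ) : Φ t₀ (y t₀) = y :=
  ODE_solution_unique_univ (v := v) (K := L) (s := fun _ => univ) (t₀ := t₀)
    (fun t => (hl t).lipschitzOnWith) (fun t => ⟨h.deriv _ _ t, trivial⟩)
    (fun t => ⟨hy t, trivial⟩) (h.init _ _)

/-- Uniqueness of solutions. Through this identity the value of a solution at a fixed time becomes
an invariant of the leaf. -/
theorem flow_flow (h : IsGlobalFlow v Φ) (hl : ∀ t, LipschitzWith L (v t)) (t₀ t₁ x : ℝ) :
    Φ t₁ (Φ t₀ x t₁) = Φ t₀ x :=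
  h.eq_of_hasDerivAt hl (h.deriv t₀ x) t₁

theorem dist_le_of_le (h : IsGlobalFlow v Φ) (hl : ∀ t, LipschitzWith L (v t)) (t₀ x y t : ℝ)
    (ht : t₀ ≤ t) : |Φ t₀ x t - Φ t₀ y t| ≤ |x - y| * exp (L * (t - t₀)) := by
  refine dist_le_of_trajectories_ODE (v := v) (K := L) (a := t₀) (b := t) hl
    (h.continuous _ _).continuousOn (fun s _ => (h.deriv t₀ x s).hasDerivWithinAt)
    (h.continuous _ _).continuousOn (fun s _ => (h.deriv t₀ y s).hasDerivWithinAt) ?_ t ⟨ht, le_rfl⟩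
  rw [h.init, h.init, Real.dist_eq]

/-- The flow of the time-reversed field. -/
theorem reverse (h : IsGlobalFlow v Φ) :
    IsGlobalFlow (fun t x => -v (-t) x) (fun t₀ x t => Φ (-t₀) x (-t)) where
  init t₀ x := h.init _ _
  deriv t₀ x t := by
    have := (h.deriv (-t₀) x (-t)).comp t (hasDerivAt_neg t)
    rw [mul_neg_one] at this
    exact this

theorem dist_le (h : IsGlobalFlow v Φ) (hl : ∀ t, LipschitzWith L (v t)) (t₀ x y t : ℝ) :
    |Φ t₀ x t - Φ t₀ y t| ≤ |x - y| * exp (L * |t - t₀|) := by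
  rcases le_total t₀ t with ht | ht
  · rw [abs_of_nonneg (sub_nonneg.2 ht)]
    exact h.dist_le_of_le hl t₀ x y t ht
  · have := h.reverse.dist_le_of_le (L := L) (fun t => (hl (-t)).neg) (-t₀) x y (-t) (by linarith)
    simp only [neg_neg] at this
    rw [abs_of_nonpos (sub_nonpos.2 ht)]
    convert this using 3
    ring

theorem abs_sub_le (h : IsGlobalFlow v Φ) (hb : ∀ t x, |v t x| ≤ C) (t₀ x s t : ℝ) :
    |Φ t₀ x t - Φ t₀ x s| ≤ C * |t - s| := by
  have := convex_univ.norm_image_sub_le_of_norm_hasDerivWithin_le (f := Φ t₀ x) (C := C)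
    (fun r _ => (h.deriv t₀ x r).hasDerivWithinAt) (fun r _ => hb r _) (mem_univ s) (mem_univ t)
  simpa using this

/-- The value at a fixed time depends continuously on the initial time and the initial point. -/
theorem continuous_initial (h : IsGlobalFlow v Φ) (hl : ∀ t, LipschitzWith L (v t))
    (hb : ∀ t x, |v t x| ≤ C) (t : ℝ) : Continuous fun q : ℝ × ℝ => Φ q.1 q.2 t := by
  rw [continuous_iff_continuousAt]
  rintro ⟨s, x⟩
  have hbound : ∀ q : ℝ × ℝ, dist (Φ q.1 q.2 t) (Φ s x t) ≤
      (C * |s - q.1| + |q.2 - x|) * exp (L * |t - s|) := by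
    rintro ⟨r, y⟩
    -- Both solutions are compared at time `s`: the one issued from `(r, y)` is then within `C |s -
    -- r|` of `y`, and Grönwall carries the gap from `s` to `t`.
    rw [Real.dist_eq, ← h.flow_flow hl r s y]
    refine (h.dist_le hl _ _ _ _).trans ?_
    gcongr
    calc |Φ r y s - x| = |(Φ r y s - Φ r y r) + (y - x)| := by rw [h.init]; ring_nf
      _ ≤ |Φ r y s - Φ r y r| + |y - x| := abs_add_le _ _
      _ ≤ _ := by gcongr; exact h.abs_sub_le hb _ _ _ _
  refine tendsto_iff_dist_tendsto_zero.2 (squeeze_zero (fun _ => dist_nonneg) hbound ?_)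
  have : Continuous fun q : ℝ × ℝ => (C * |s - q.1| + |q.2 - x|) * exp (L * |t - s|) := by
    fun_prop
  simpa using this.tendsto (s, x)

/-- A curve in extended phase space tangent to the field, with arbitrary parametrization `τ` of
time, stays on one solution. -/
theorem eq_of_tangent (h : IsGlobalFlow v Φ) (hl : ∀ t, LipschitzWith L (v t)) {a b : ℝ}
    {τ τ' w : ℝ → ℝ} (hτ : ∀ t ∈ Icc a b, HasDerivWithinAt τ (τ' t) (Icc a b) t)
    (hτ' : ContinuousOn τ' (Icc a b))
    (hw : ∀ t ∈ Icc a b, HasDerivWithinAt w (v (τ t) (w t) * τ' t) (Icc a b) t) :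
    ∀ t ∈ Icc a b, w t = Φ (τ a) (w a) (τ t) := by
  obtain ⟨M, hM⟩ := isCompact_Icc.exists_bound_of_continuousOn hτ'
  -- The curve and the solution composed with `τ` satisfy the same equation `x' = v (τ t) x * τ' t`,
  -- Lipschitz in `x` even where `τ'` vanishes or changes sign. Curves may therefore stop or run
  -- backwards.
  refine ODE_solution_unique_of_mem_Icc_right (v := fun t x => v (τ t) x * τ' t)
    (K := L * M.toNNReal) (s := fun _ => univ) ?_ (fun t ht => (hw t ht).continuousWithinAt) ?_
    (fun _ _ => trivial) ?_ ?_ (fun _ _ => trivial) (h.init _ _).symm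
  · intro t ht
    refine LipschitzWith.lipschitzOnWith (LipschitzWith.of_dist_le_mul fun x y => ?_)
    rw [Real.dist_eq, ← sub_mul, abs_mul, NNReal.coe_mul]
    have h1 := (hl (τ t)).dist_le_mul x y
    have h2 := (hM t (Ico_subset_Icc_self ht)).trans (Real.le_coe_toNNReal M)
    rw [Real.dist_eq] at h1
    rw [Real.norm_eq_abs] at h2
    calc _ ≤ (L * dist x y) * M.toNNReal := by gcongr
      _ = _ := by ring
  · intro t ht
    exact (hw t (Ico_subset_Icc_self ht)).mono_of_mem_nhdsWithin
      (Icc_mem_nhdsGE_of_mem ht)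
  · exact fun t ht => ((h.deriv _ _ _).comp_hasDerivWithinAt t (hτ t ht)).continuousWithinAt
  · intro t ht
    exact ((h.deriv _ _ _).comp_hasDerivWithinAt t
      (hτ t (Ico_subset_Icc_self ht))).mono_of_mem_nhdsWithin (Icc_mem_nhdsGE_of_mem ht)

end IsGlobalFlow

/-! ### The node: radius, labels of leaves, straightening to rays -/

/-- A scalar equation `dy/ds = G y (exp s)` whose right-hand side points away from `y = 0`
outside the cone `|y| < exp s`, together with its global flow. -/
structure NodeFlow (G : ℝ → ℝ → ℝ) (Φ : ℝ → ℝ → ℝ → ℝ) (δ : ℝ) (C L : NNReal) : Prop where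
  δ_pos : 0 < δ
  flow : IsGlobalFlow (fun s y => G y (exp s)) Φ
  bound : ∀ y z, |G y z| ≤ C
  lip : ∀ z, LipschitzWith L (fun y => G y z)
  right : ∀ η > 0, ∃ μ > 0, ∀ y z, 0 ≤ z → z ≤ η → z ≤ δ → η ≤ y → μ ≤ G y z
  left : ∀ η > 0, ∃ μ > 0, ∀ y z, 0 ≤ z → z ≤ η → z ≤ δ → y ≤ -η → G y z ≤ -μ

namespace NodeFlow

variable {G : ℝ → ℝ → ℝ} {Φ : ℝ → ℝ → ℝ → ℝ} {δ : ℝ} {C L : NNReal}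

/-- The mirror image under `y ↦ -y`. -/
theorem reflect (h : NodeFlow G Φ δ C L) :
    NodeFlow (fun y z => -G (-y) z) (fun s y t => -Φ s (-y) t) δ C L where
  δ_pos := h.δ_pos
  flow :=
    { init := fun t₀ x => by rw [h.flow.init, neg_neg]
      deriv := fun t₀ x t => by
        have := (h.flow.deriv t₀ (-x) t).neg
        simp only [neg_neg]
        exact this }
  bound y z := by rw [abs_neg]; exact h.bound _ _
  lip z := by
    have := ((h.lip z).comp (LipschitzWith.id.neg)).neg
    rw [mul_one] at this
    exact this
  right η hη := by
    obtain ⟨μ, hμ, h'⟩ := h.left η hη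
    exact ⟨μ, hμ, fun y z h0 h1 h2 h3 => by linarith [h' (-y) z h0 h1 h2 (by linarith)]⟩
  left η hη := by
    obtain ⟨μ, hμ, h'⟩ := h.right η hη
    exact ⟨μ, hμ, fun y z h0 h1 h2 h3 => by linarith [h' (-y) z h0 h1 h2 (by linarith)]⟩

/-- To the right of the cone solutions grow at least linearly. -/
theorem growth {η μ : ℝ} (h : NodeFlow G Φ δ C L) (hμ : 0 < μ)
    (hG : ∀ y z, 0 ≤ z → z ≤ η → z ≤ δ → η ≤ y → μ ≤ G y z)
    {s₀ y₀ s₁ s₂ : ℝ} (hs : s₁ ≤ s₂) (hη : exp s₂ ≤ η) (hδ : exp s₂ ≤ δ)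
    (h₁ : η ≤ Φ s₀ y₀ s₁) : Φ s₀ y₀ s₁ + μ * (s₂ - s₁) ≤ Φ s₀ y₀ s₂ := by
  have hG' : ∀ t ∈ Icc s₁ s₂, η ≤ Φ s₀ y₀ t → μ ≤ G (Φ s₀ y₀ t) (exp t) := fun t ht h' =>
    hG _ _ (exp_pos t).le ((exp_le_exp.2 ht.2).trans hη) ((exp_le_exp.2 ht.2).trans hδ) h'
  -- Barrier argument: at the value `η` the derivative is at least `μ > 0`, so the solution cannot
  -- fall below `η`.
  have hbar : ∀ t ∈ Icc s₁ s₂, η ≤ Φ s₀ y₀ t := by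
    intro t ht
    have := image_le_of_deriv_right_lt_deriv_boundary (f := fun t => -Φ s₀ y₀ t)
      (f' := fun t => -G (Φ s₀ y₀ t) (exp t)) (a := s₁) (b := s₂)
      (h.flow.continuous _ _).neg.continuousOn
      (fun t _ => (h.flow.deriv _ _ t).neg.hasDerivWithinAt)
      (B := fun _ => -η) (B' := fun _ => 0) (by simpa using h₁)
      (fun t => hasDerivAt_const t _) (fun t ht' heq => by
        have := hG' t (Ico_subset_Icc_self ht') (by simpa using heq.le)
        linarith) ht
    simpa using this
  have := (convex_Icc s₁ s₂).mul_sub_le_image_sub_of_le_deriv (f := Φ s₀ y₀) (C := μ)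
    (h.flow.continuous _ _).continuousOn
    (fun t _ => (h.flow.deriv _ _ t).differentiableAt.differentiableWithinAt)
    (fun t ht => by
      rw [(h.flow.deriv _ _ t).deriv]
      rw [interior_Icc] at ht
      exact hG' t (Ioo_subset_Icc_self ht) (hbar t (Ioo_subset_Icc_self ht)))
    s₁ ⟨le_rfl, hs⟩ s₂ ⟨hs, le_rfl⟩ hs
  linarith

/-- The radius `max |y| z` is strictly increasing along solutions. -/
theorem radius_lt (h : NodeFlow G Φ δ C L) (s₀ y₀ : ℝ) {s₁ s₂ : ℝ} (hs : s₁ < s₂)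
    (hδ : exp s₂ ≤ δ) :
    max |Φ s₀ y₀ s₁| (exp s₁) < max |Φ s₀ y₀ s₂| (exp s₂) := by
  -- If `|y|` is at least `exp s₂` at the start, the solution is outside the cone during the whole
  -- interval and `|y|` itself grows. Otherwise the height `exp s₂` alone exceeds the old radius.
  have key : ∀ {G : ℝ → ℝ → ℝ} {Φ : ℝ → ℝ → ℝ → ℝ} (h : NodeFlow G Φ δ C L) (y₀ : ℝ),
      exp s₂ ≤ Φ s₀ y₀ s₁ → Φ s₀ y₀ s₁ < Φ s₀ y₀ s₂ := by
    intro G Φ h y₀ h1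
    obtain ⟨μ, hμ, hG⟩ := h.right _ ((exp_pos s₂).trans_le h1)
    have := h.growth hμ hG hs.le h1 hδ le_rfl
    nlinarith
  have he : exp s₁ < exp s₂ := exp_lt_exp.2 hs
  refine max_lt ?_ (he.trans_le (le_max_right _ _))
  rcases lt_or_ge |Φ s₀ y₀ s₁| (exp s₂) with h1 | h1
  · exact h1.trans_le (le_max_right _ _)
  · refine lt_max_of_lt_left ?_
    rcases abs_cases (Φ s₀ y₀ s₁) with ⟨h2, h3⟩ | ⟨h2, h3⟩
    · rw [h2] at h1 ⊢
      exact (key h y₀ h1).trans_le (le_abs_self _)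
    · rw [h2] at h1 ⊢
      have := key h.reflect (-y₀) (by simpa using h1)
      simp only [neg_neg] at this
      exact this.trans_le (neg_le_abs _)

theorem radius_le (h : NodeFlow G Φ δ C L) (s₀ y₀ : ℝ) {s₁ s₂ : ℝ} (hs : s₁ ≤ s₂)
    (hδ : exp s₂ ≤ δ) :
    max |Φ s₀ y₀ s₁| (exp s₁) ≤ max |Φ s₀ y₀ s₂| (exp s₂) := by
  rcases hs.eq_or_lt with rfl | hs
  · exact le_rfl
  · exact (h.radius_lt s₀ y₀ hs hδ).le

/-- Every solution attains every radius up to `δ`. -/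
theorem exists_radius_eq (h : NodeFlow G Φ δ C L) (k : ℝ) {ρ : ℝ} (hρ : 0 < ρ) (hρδ : ρ ≤ δ) :
    ∃ s, exp s ≤ δ ∧ max |Φ (log δ) k s| (exp s) = ρ := by
  obtain ⟨μ, hμ, hG⟩ := h.right ρ hρ
  obtain ⟨ν, hν, hG'⟩ := h.reflect.right ρ hρ
  set Y := Φ (log δ) k with hY
  -- Backwards in time the radius must drop to `ρ`: otherwise `|y| > ρ` at arbitrarily early times,
  -- and linear growth since then would exceed the value at `log ρ`.
  obtain ⟨s, hs, hsρ⟩ : ∃ s ≤ log ρ, max |Y s| (exp s) ≤ ρ := by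
    by_contra! hcon
    -- A time after which growth at rate `min μ ν` has surpassed `|Y (log ρ)|`.
    set N := |Y (log ρ)| / min μ ν + 1 with hN
    have hm : 0 < min μ ν := lt_min hμ hν
    have hN0 : 0 < N := by positivity
    have hbig : |Y (log ρ)| < min μ ν * N := by
      rw [hN, mul_add, mul_div_cancel₀ _ hm.ne', mul_one]
      linarith
    have h1 := hcon (log ρ - N) (by linarith)
    have h2 : exp (log ρ - N) ≤ ρ := by
      rw [← exp_log hρ]
      simpa using hN0.le
    have h3 : ρ < |Y (log ρ - N)| := by
      rcases lt_max_iff.1 h1 with h | h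
      · exact h
      · linarith
    rcases abs_cases (Y (log ρ - N)) with ⟨h4, h5⟩ | ⟨h4, h5⟩
    · have := h.growth (s₀ := log δ) (y₀ := k) hμ hG (s₁ := log ρ - N) (s₂ := log ρ)
        (by linarith) (by rw [exp_log hρ]) (by rwa [exp_log hρ]) (by rw [← hY]; linarith)
      rw [← hY] at this
      have h6 := le_abs_self (Y (log ρ))
      nlinarith [min_le_left μ ν]
    · have := h.reflect.growth (s₀ := log δ) (y₀ := -k) hν hG' (s₁ := log ρ - N) (s₂ := log ρ)
        (by linarith) (by rw [exp_log hρ]) (by rwa [exp_log hρ]) (by rw [neg_neg, ← hY]; linarith)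
      rw [neg_neg, ← hY] at this
      have h6 := neg_le_abs (Y (log ρ))
      nlinarith [min_le_right μ ν]
  have hle : log ρ ≤ log δ := log_le_log hρ hρδ
  have hc : ContinuousOn (fun s => max |Y s| (exp s)) (Icc s (log δ)) :=
    ((h.flow.continuous _ _).abs.max continuous_exp).continuousOn
  obtain ⟨t, ht, hte⟩ := intermediate_value_Icc (hs.trans hle) hc
    ⟨hsρ, hρδ.trans ((exp_log h.δ_pos).ge.trans (le_max_right _ _))⟩
  exact ⟨t, by rw [← exp_log h.δ_pos]; exact exp_le_exp.2 ht.2, hte⟩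

/-- The label of the solution through `(y, z)`: its value at `z = δ`. -/
def label (Φ : ℝ → ℝ → ℝ → ℝ) (δ : ℝ) (q : ℝ × ℝ) : ℝ := Φ (log q.2) q.1 (log δ)

theorem flow_label (h : NodeFlow G Φ δ C L) (y z : ℝ) :
    Φ (log δ) (label Φ δ (y, z)) = Φ (log z) y :=
  h.flow.flow_flow (fun s => h.lip (exp s)) _ _ _

theorem label_flow (h : NodeFlow G Φ δ C L) (k s : ℝ) :
    label Φ δ (Φ (log δ) k s, exp s) = k := by
  rw [label, log_exp, h.flow.flow_flow (fun s => h.lip (exp s)), h.flow.init]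

theorem continuousAt_label (h : NodeFlow G Φ δ C L) {q : ℝ × ℝ} (hq : 0 < q.2) :
    ContinuousAt (label Φ δ) q := by
  have h1 := h.flow.continuous_initial (fun s => h.lip (exp s)) (fun s y => h.bound y (exp s))
    (log δ)
  have h2 : ContinuousAt (fun q : ℝ × ℝ => (log q.2, q.1)) q :=
    (continuousAt_snd.log hq.ne').prodMk continuousAt_fst
  exact h1.continuousAt.comp h2

/-- From a point close to `(y₀, 0)` the height needs time `log η - log z` to reach `η`, which tends
to infinity, and `y` grows at rate at least `μ` meanwhile. The remaining time until height `δ` is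
fixed and changes `y` by a bounded amount. -/
theorem tendsto_label_right (h : NodeFlow G Φ δ C L) {y₀ : ℝ} (hy : 0 < y₀) :
    Tendsto (label Φ δ) (𝓝[{q | 0 < q.2}] (y₀, 0)) atTop := by
  set η := min (y₀ / 2) δ with hη
  have hη0 : 0 < η := lt_min (by linarith) h.δ_pos
  obtain ⟨μ, hμ, hG⟩ := h.right η hη0
  have hlow : ∀ᶠ q : ℝ × ℝ in 𝓝[{q | 0 < q.2}] (y₀, 0),
      (η - C * (log δ - log η)) + μ * (log η - log q.2) ≤ label Φ δ q := by
    have e1 : ∀ᶠ q : ℝ × ℝ in 𝓝[{q | 0 < q.2}] (y₀, 0), η < q.1 :=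
      mem_nhdsWithin_of_mem_nhds ((isOpen_lt continuous_const continuous_fst).mem_nhds
        ((min_le_left _ _).trans_lt (show y₀ / 2 < y₀ by linarith)))
    have e2 : ∀ᶠ q : ℝ × ℝ in 𝓝[{q | 0 < q.2}] (y₀, 0), q.2 < η :=
      mem_nhdsWithin_of_mem_nhds ((isOpen_lt continuous_snd continuous_const).mem_nhds hη0)
    filter_upwards [e1, e2, self_mem_nhdsWithin] with q h1 h2 h3
    have h4 := h.growth (s₀ := log q.2) (y₀ := q.1) hμ hG (log_le_log h3 h2.le)
      (by rw [exp_log hη0]) (by rw [exp_log hη0]; exact min_le_right _ _)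
      (by rw [h.flow.init]; exact h1.le)
    rw [h.flow.init] at h4
    have h5 := h.flow.abs_sub_le (fun s y => h.bound y (exp s)) (log q.2) q.1 (log η) (log δ)
    rw [abs_of_nonneg (sub_nonneg.2 (log_le_log hη0 (min_le_right _ _)))] at h5
    have h6 := (abs_le.1 h5).1
    change _ ≤ Φ (log q.2) q.1 (log δ)
    linarith
  refine tendsto_atTop_mono' _ hlow (tendsto_atTop_add_const_left _ _ ?_)
  refine Tendsto.const_mul_atTop hμ ?_
  simp only [sub_eq_add_neg]
  refine tendsto_atTop_add_const_left _ _ (tendsto_neg_atBot_atTop.comp ?_)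
  have : Tendsto (fun q : ℝ × ℝ => q.2) (𝓝[{q | 0 < q.2}] (y₀, 0)) (𝓝[>] 0) :=
    tendsto_nhdsWithin_of_tendsto_nhds_of_eventually_within _
      (continuous_snd.tendsto' _ _ rfl |>.mono_left nhdsWithin_le_nhds) self_mem_nhdsWithin
  exact tendsto_log_nhdsGT_zero.comp this

theorem label_reflect (Φ : ℝ → ℝ → ℝ → ℝ) (δ y z : ℝ) :
    label (fun s y t => -Φ s (-y) t) δ (-y, z) = -label Φ δ (y, z) := by
  simp [label]

theorem tendsto_label_left (h : NodeFlow G Φ δ C L) {y₀ : ℝ} (hy : y₀ < 0) :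
    Tendsto (label Φ δ) (𝓝[{q | 0 < q.2}] (y₀, 0)) atBot := by
  have h1 := h.reflect.tendsto_label_right (neg_pos.2 hy)
  have h2 : Tendsto (fun q : ℝ × ℝ => (-q.1, q.2)) (𝓝[{q | 0 < q.2}] (y₀, 0))
      (𝓝[{q | 0 < q.2}] (-y₀, 0)) :=
    tendsto_nhdsWithin_of_tendsto_nhds_of_eventually_within _
      (Continuous.tendsto' (by fun_prop) _ _ rfl |>.mono_left nhdsWithin_le_nhds)
      self_mem_nhdsWithin
  have h3 := tendsto_neg_atTop_atBot.comp (h1.comp h2)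
  refine h3.congr fun q => ?_
  simp only [Function.comp_apply]
  rw [label_reflect, neg_neg]

/-- The point of direction `(k, δ)` on the boundary of the unit square. -/
def squareDir (δ k : ℝ) : ℝ × ℝ := (k / max |k| δ, δ / max |k| δ)

theorem continuous_squareDir {δ : ℝ} (hδ : 0 < δ) : Continuous (squareDir δ) := by
  have : ∀ k, max |k| δ ≠ 0 := fun k => (hδ.trans_le (le_max_right _ _)).ne'
  unfold squareDir
  fun_prop (disch := assumption)

theorem tendsto_squareDir_atTop {δ : ℝ} (hδ : 0 < δ) :
    Tendsto (squareDir δ) atTop (𝓝 (1, 0)) := by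
  refine Tendsto.prodMk_nhds ?_ ?_
  · refine tendsto_const_nhds.congr' ?_
    filter_upwards [eventually_ge_atTop δ] with k hk
    rw [abs_of_pos (hδ.trans_le hk), max_eq_left hk, div_self (hδ.trans_le hk).ne']
  · refine tendsto_const_nhds.div_atTop (tendsto_atTop_mono (fun k => ?_) tendsto_id)
    exact (le_abs_self k).trans (le_max_left _ _)

theorem tendsto_squareDir_atBot {δ : ℝ} (hδ : 0 < δ) :
    Tendsto (squareDir δ) atBot (𝓝 (-1, 0)) := by
  have h1 := (tendsto_squareDir_atTop hδ).comp tendsto_neg_atBot_atTop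
  have h2 : Tendsto (fun q : ℝ × ℝ => (-q.1, q.2)) (𝓝 (1, 0)) (𝓝 (-1, 0)) :=
    Continuous.tendsto' (by fun_prop) _ _ rfl
  refine (h2.comp h1).congr fun k => ?_
  simp [squareDir, neg_div]

theorem max_squareDir {δ : ℝ} (hδ : 0 < δ) (k : ℝ) :
    max |(squareDir δ k).1| (squareDir δ k).2 = 1 := by
  have hm : 0 < max |k| δ := hδ.trans_le (le_max_right _ _)
  rw [squareDir]
  simp only
  rw [abs_div, abs_of_pos hm, max_div_div_right hm.le, div_self hm.ne']

theorem squareDir_snd_pos {δ : ℝ} (hδ : 0 < δ) (k : ℝ) : 0 < (squareDir δ k).2 :=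
  div_pos hδ (hδ.trans_le (le_max_right _ _))

theorem squareDir_fst {δ : ℝ} (hδ : 0 < δ) (k : ℝ) :
    (squareDir δ k).1 = k / δ * (squareDir δ k).2 := by
  have hm : 0 < max |k| δ := hδ.trans_le (le_max_right _ _)
  rw [squareDir]
  field_simp

/-- The straightening map of a node: it takes the leaf with label `k` to the ray through `(k, δ)`
and preserves the radius `max |y| z`. -/
def straighten (Φ : ℝ → ℝ → ℝ → ℝ) (δ : ℝ) (q : ℝ × ℝ) : ℝ × ℝ :=
  if 0 < q.2 then max |q.1| q.2 • squareDir δ (label Φ δ q) else (q.1, 0)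

theorem straighten_of_pos {q : ℝ × ℝ} (hq : 0 < q.2) :
    straighten Φ δ q = max |q.1| q.2 • squareDir δ (label Φ δ q) := if_pos hq

theorem straighten_snd_pos (hδ : 0 < δ) {q : ℝ × ℝ} (hq : 0 < q.2) :
    0 < (straighten Φ δ q).2 := by
  rw [straighten_of_pos hq]
  exact mul_pos (hq.trans_le (le_max_right _ _)) (squareDir_snd_pos hδ _)

theorem max_straighten (hδ : 0 < δ) {q : ℝ × ℝ} (hq : 0 < q.2) :
    max |(straighten Φ δ q).1| (straighten Φ δ q).2 = max |q.1| q.2 := by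
  have hm : 0 < max |q.1| q.2 := hq.trans_le (le_max_right _ _)
  rw [straighten_of_pos hq]
  simp only [Prod.smul_fst, Prod.smul_snd, smul_eq_mul]
  rw [abs_mul, abs_of_pos hm, ← mul_max_of_nonneg _ _ hm.le, max_squareDir hδ, mul_one]

theorem straighten_fst (hδ : 0 < δ) {q : ℝ × ℝ} (hq : 0 < q.2) :
    (straighten Φ δ q).1 = label Φ δ q / δ * (straighten Φ δ q).2 := by
  rw [straighten_of_pos hq]
  simp only [Prod.smul_fst, Prod.smul_snd, smul_eq_mul]
  rw [squareDir_fst hδ]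
  ring

/-- Two points have the same label iff their images lie on the same ray. -/
theorem label_eq_iff (hδ : 0 < δ) {q q' : ℝ × ℝ} (hq : 0 < q.2) (hq' : 0 < q'.2) :
    label Φ δ q = label Φ δ q' ↔
      (straighten Φ δ q).1 * (straighten Φ δ q').2 =
        (straighten Φ δ q').1 * (straighten Φ δ q).2 := by
  have h1 := straighten_snd_pos (Φ := Φ) hδ hq
  have h2 := straighten_snd_pos (Φ := Φ) hδ hq'
  rw [straighten_fst hδ hq, straighten_fst hδ hq']
  constructor
  · intro h; rw [h]; ring
  · intro h
    field_simp at h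
    exact h

/-- The image determines the label, hence the leaf, and also the radius, which is strictly monotone
along the leaf. -/
theorem straighten_injOn (h : NodeFlow G Φ δ C L) :
    InjOn (straighten Φ δ) {q | 0 < q.2 ∧ q.2 ≤ δ} := by
  rintro ⟨y, z⟩ ⟨hz, hzδ⟩ ⟨y', z'⟩ ⟨hz', hzδ'⟩ heq
  have hδ := h.δ_pos
  simp only at hz hz' hzδ hzδ'
  have hl : label Φ δ (y, z) = label Φ δ (y', z') :=
    (label_eq_iff hδ hz hz').2 (by rw [heq])
  have hr : max |y| z = max |y'| z' := by
    have h1 := max_straighten (Φ := Φ) hδ (q := (y, z)) hz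
    have h2 := max_straighten (Φ := Φ) hδ (q := (y', z')) hz'
    rw [heq] at h1
    exact h1.symm.trans h2
  have e1 : Φ (log δ) (label Φ δ (y, z)) (log z) = y := by rw [h.flow_label, h.flow.init]
  have e2 : Φ (log δ) (label Φ δ (y, z)) (log z') = y' := by rw [hl, h.flow_label, h.flow.init]
  have hlog : log z = log z' := by
    rcases lt_trichotomy (log z) (log z') with hlt | heq' | hlt
    · have := h.radius_lt (log δ) (label Φ δ (y, z)) hlt (by rwa [exp_log hz'])
      rw [e1, e2, exp_log hz, exp_log hz'] at this
      exact absurd hr this.ne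
    · exact heq'
    · have := h.radius_lt (log δ) (label Φ δ (y, z)) hlt (by rwa [exp_log hz])
      rw [e1, e2, exp_log hz, exp_log hz'] at this
      exact absurd hr this.ne'
  have hzz : z = z' := by rw [← exp_log hz, ← exp_log hz', hlog]
  rw [← e1, ← e2, hlog, hzz]

/-- The ray through `(a, b)` belongs to the label `a / b * δ`, and the leaf with that label attains
the radius of `(a, b)`. -/
theorem straighten_surj (h : NodeFlow G Φ δ C L) {a b : ℝ} (hb : 0 < b) (hab : max |a| b ≤ δ) :
    ∃ q : ℝ × ℝ, 0 < q.2 ∧ q.2 ≤ δ ∧ straighten Φ δ q = (a, b) := by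
  have hδ := h.δ_pos
  have hρ : 0 < max |a| b := hb.trans_le (le_max_right _ _)
  obtain ⟨s, hs, hsρ⟩ := h.exists_radius_eq (a / b * δ) hρ hab
  refine ⟨(Φ (log δ) (a / b * δ) s, exp s), exp_pos s, hs, ?_⟩
  rw [straighten_of_pos (exp_pos s), h.label_flow]
  simp only
  rw [hsρ]
  have hm : max |a / b * δ| δ = max |a| b * (δ / b) := by
    rw [abs_mul, abs_div, abs_of_pos hb, abs_of_pos hδ, max_mul_of_nonneg _ _ (by positivity)]
    congr 1 <;> field_simp
  ext
  · simp only [squareDir, Prod.smul_fst, smul_eq_mul, hm]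
    field_simp
  · simp only [squareDir, Prod.smul_snd, smul_eq_mul, hm]
    field_simp

/-- The delicate points are those of the axis. At `y₀ ≠ 0` the label tends to `±∞`, so the direction
tends to `(±1, 0)` while the radius tends to `|y₀|`; at the origin it suffices that the sup norm of
the image is the radius. -/
theorem continuousOn_straighten (h : NodeFlow G Φ δ C L) :
    ContinuousOn (straighten Φ δ) {q | 0 ≤ q.2} := by
  have hδ := h.δ_pos
  rintro ⟨y₀, z₀⟩ hz₀
  simp only [mem_ofPred_eq] at hz₀
  have hρc : Continuous fun q : ℝ × ℝ => max |q.1| q.2 := by fun_prop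
  rcases hz₀.lt_or_eq with hz | rfl
  · refine ContinuousAt.continuousWithinAt ?_
    have h1 : ContinuousAt (fun q : ℝ × ℝ => max |q.1| q.2 • squareDir δ (label Φ δ q)) (y₀, z₀) :=
      hρc.continuousAt.smul
        ((continuous_squareDir hδ).continuousAt.comp (h.continuousAt_label hz))
    refine h1.congr ?_
    filter_upwards [(isOpen_lt continuous_const continuous_snd).mem_nhds hz] with q hq
    exact (straighten_of_pos hq).symm
  · have hsplit : {q : ℝ × ℝ | 0 ≤ q.2} = {q | 0 < q.2} ∪ {q | q.2 = 0} := by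
      ext q
      simp only [mem_ofPred_eq, mem_union, le_iff_lt_or_eq, eq_comm]
    have hval : straighten Φ δ (y₀, 0) = (y₀, 0) := by simp [straighten]
    rw [hsplit]
    refine ContinuousWithinAt.union ?_ ?_
    · rw [ContinuousWithinAt, hval]
      have hρ : Tendsto (fun q : ℝ × ℝ => max |q.1| q.2) (𝓝[{q | 0 < q.2}] (y₀, 0)) (𝓝 |y₀|) :=
        (hρc.tendsto' _ _ (by simp)).mono_left nhdsWithin_le_nhds
      have hcongr : (fun q : ℝ × ℝ => max |q.1| q.2 • squareDir δ (label Φ δ q))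
          =ᶠ[𝓝[{q | 0 < q.2}] (y₀, 0)] straighten Φ δ := by
        filter_upwards [self_mem_nhdsWithin] with q hq
        exact (straighten_of_pos hq).symm
      rcases lt_trichotomy y₀ 0 with hy | rfl | hy
      · have := hρ.smul ((tendsto_squareDir_atBot hδ).comp (h.tendsto_label_left hy))
        rw [abs_of_neg hy] at this
        refine (this.congr' hcongr).trans_eq ?_
        simp
      · refine tendsto_zero_iff_norm_tendsto_zero.2 ?_
        rw [abs_zero] at hρ
        refine squeeze_zero' (Eventually.of_forall fun _ => norm_nonneg _) ?_ hρ
        filter_upwards [self_mem_nhdsWithin] with q hq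
        rw [Prod.norm_def, Real.norm_eq_abs, Real.norm_eq_abs,
          abs_of_pos (straighten_snd_pos hδ hq), max_straighten hδ hq]
      · have := hρ.smul ((tendsto_squareDir_atTop hδ).comp (h.tendsto_label_right hy))
        rw [abs_of_pos hy] at this
        refine (this.congr' hcongr).trans_eq ?_
        simp
    · have : ContinuousWithinAt (fun q : ℝ × ℝ => (q.1, (0 : ℝ))) {q | q.2 = 0} (y₀, 0) := by
        fun_prop
      refine this.congr (fun q hq => ?_) hval
      have hq' : q.2 = 0 := hq
      simp [straighten, hq']

end NodeFlow

/-! ### Tangent curves and the leaves of the model foliation -/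

/-- The plane curve `(y, z)` with velocity `(y', z')` is a `C¹` curve on `[a, b]` that stays in `U`
and is tangent to `L`. -/
structure IsTangentCurve (L : E2 → Set E2) (U : Set E2) (y z y' z' : ℝ → ℝ) (a b : ℝ) : Prop where
  cont_y : ContinuousOn y' (Icc a b)
  cont_z : ContinuousOn z' (Icc a b)
  deriv_y : ∀ t ∈ Icc a b, HasDerivWithinAt y (y' t) (Icc a b) t
  deriv_z : ∀ t ∈ Icc a b, HasDerivWithinAt z (z' t) (Icc a b) t
  mem : ∀ t ∈ Icc a b, !₂[y t, z t] ∈ U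
  tangent : ∀ t ∈ Icc a b, !₂[y' t, z' t] ∈ L !₂[y t, z t]

theorem hasDerivWithinAt_pair {y z : ℝ → ℝ} {y' z' t : ℝ} {s : Set ℝ}
    (hy : HasDerivWithinAt y y' s t) (hz : HasDerivWithinAt z z' s t) :
    HasDerivWithinAt (fun t => (!₂[y t, z t] : E2)) !₂[y', z'] s t := by
  have h : HasDerivWithinAt (fun t => ![y t, z t]) ![y', z'] s t := by
    rw [hasDerivWithinAt_pi]
    intro i
    fin_cases i
    · exact hy
    · exact hz
  exact (PiLp.continuousLinearEquiv 2 ℝ (fun _ : Fin 2 => ℝ)).symm.hasFDerivAt.comp_hasDerivWithinAt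
    t h

theorem eta_pair (x : E2) : !₂[x 0, x 1] = x := by
  ext i
  fin_cases i <;> rfl

theorem pair_eq_zero_iff {a b : ℝ} : (!₂[a, b] : E2) = 0 ↔ a = 0 ∧ b = 0 := by
  constructor
  · intro h
    exact ⟨congrArg (fun x : E2 => x 0) h, congrArg (fun x : E2 => x 1) h⟩
  · rintro ⟨rfl, rfl⟩
    ext i
    fin_cases i <;> rfl

theorem continuous_pair {X : Type*} [TopologicalSpace X] {y z : X → ℝ} (hy : Continuous y)
    (hz : Continuous z) : Continuous fun t => (!₂[y t, z t] : E2) := by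
  refine (PiLp.continuous_toLp 2 (fun _ : Fin 2 => ℝ)).comp (continuous_pi fun i => ?_)
  fin_cases i
  · exact hy
  · exact hz

theorem mem_span_pair_iff {a b c d : ℝ} :
    (!₂[a, b] : E2) ∈ (Submodule.span ℝ {(!₂[c, d] : E2)} : Set E2) ↔
      ∃ r : ℝ, a = r * c ∧ b = r * d := by
  rw [SetLike.mem_coe, Submodule.mem_span_singleton]
  refine exists_congr fun r => ?_
  constructor
  · intro h
    exact ⟨(congrArg (fun x : E2 => x 0) h).symm, (congrArg (fun x : E2 => x 1) h).symm⟩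
  · rintro ⟨rfl, rfl⟩
    ext i
    fin_cases i <;> rfl

theorem SameLeaf.exists_isTangentCurve {L : E2 → Set E2} {U : Set E2} {p q : E2}
    (h : SameLeaf L U p q) : ∃ y z y' z' : ℝ → ℝ, IsTangentCurve L U y z y' z' 0 1 ∧
      !₂[y 0, z 0] = p ∧ !₂[y 1, z 1] = q := by
  obtain ⟨γ, hγ, h0, h1, hU⟩ := h
  have hd : ∀ t ∈ Icc (0 : ℝ) 1, HasDerivWithinAt γ (derivWithin γ (Icc 0 1) t) (Icc 0 1) t :=
    fun t ht => (hγ.differentiableOn one_ne_zero t ht).hasDerivWithinAt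
  have hc : ContinuousOn (derivWithin γ (Icc 0 1)) (Icc 0 1) :=
    hγ.continuousOn_derivWithin (uniqueDiffOn_Icc one_pos) le_rfl
  have hproj : ∀ i : Fin 2, ∀ t ∈ Icc (0 : ℝ) 1,
      HasDerivWithinAt (fun t => γ t i) (derivWithin γ (Icc 0 1) t i) (Icc 0 1) t := fun i t ht =>
    (EuclideanSpace.proj (𝕜 := ℝ) i).hasFDerivAt.comp_hasDerivWithinAt t (hd t ht)
  have hcproj : ∀ i : Fin 2, ContinuousOn (fun t => derivWithin γ (Icc 0 1) t i) (Icc 0 1) :=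
    fun i => (EuclideanSpace.proj (𝕜 := ℝ) i).continuous.comp_continuousOn hc
  refine ⟨fun t => γ t 0, fun t => γ t 1, fun t => derivWithin γ (Icc 0 1) t 0,
    fun t => derivWithin γ (Icc 0 1) t 1,
    ⟨hcproj 0, hcproj 1, hproj 0, hproj 1, fun t ht => ?_, fun t ht => ?_⟩, ?_, ?_⟩
  · rw [eta_pair]; exact (hU t ht).1
  · rw [eta_pair, eta_pair]; exact (hU t ht).2
  · rw [eta_pair, h0]
  · rw [eta_pair, h1]

theorem sameLeaf_of_hasDerivAt {L : E2 → Set E2} {U : Set E2} {y z y' z' : ℝ → ℝ}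
    (hy : ∀ t, HasDerivAt y (y' t) t) (hz : ∀ t, HasDerivAt z (z' t) t)
    (hcy : Continuous y') (hcz : Continuous z')
    (h : ∀ t ∈ Icc (0 : ℝ) 1, !₂[y t, z t] ∈ U ∧ !₂[y' t, z' t] ∈ L !₂[y t, z t]) :
    SameLeaf L U !₂[y 0, z 0] !₂[y 1, z 1] := by
  have hd : ∀ t, HasDerivAt (fun t => (!₂[y t, z t] : E2)) !₂[y' t, z' t] t := fun t =>
    (hasDerivWithinAt_pair (hy t).hasDerivWithinAt (hz t).hasDerivWithinAt).hasDerivAt univ_mem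
  refine ⟨fun t => !₂[y t, z t], ?_, rfl, rfl, fun t ht => ⟨(h t ht).1, ?_⟩⟩
  · refine ContDiff.contDiffOn (contDiff_one_iff_deriv.2 ⟨fun t => (hd t).differentiableAt, ?_⟩)
    rw [show deriv (fun t => (!₂[y t, z t] : E2)) = fun t => !₂[y' t, z' t] from
      funext fun t => (hd t).deriv]
    exact continuous_pair hcy hcz
  · rw [(hd t).hasDerivWithinAt.derivWithin (uniqueDiffOn_Icc one_pos t ht)]
    exact (h t ht).2

namespace IsTangentCurve

variable {L : E2 → Set E2} {U : Set E2} {y z y' z' : ℝ → ℝ} {a b : ℝ}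

theorem mono (h : IsTangentCurve L U y z y' z' a b) {c d : ℝ} (hac : a ≤ c) (hdb : d ≤ b) :
    IsTangentCurve L U y z y' z' c d := by
  have hs : Icc c d ⊆ Icc a b := Icc_subset_Icc hac hdb
  exact ⟨h.cont_y.mono hs, h.cont_z.mono hs, fun t ht => (h.deriv_y t (hs ht)).mono hs,
    fun t ht => (h.deriv_z t (hs ht)).mono hs, fun t ht => h.mem t (hs ht),
    fun t ht => h.tangent t (hs ht)⟩

theorem continuousOn_y (h : IsTangentCurve L U y z y' z' a b) : ContinuousOn y (Icc a b) :=
  fun t ht => (h.deriv_y t ht).continuousWithinAt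

theorem continuousOn_z (h : IsTangentCurve L U y z y' z' a b) : ContinuousOn z (Icc a b) :=
  fun t ht => (h.deriv_z t ht).continuousWithinAt

/-- The curve run through backwards. -/
theorem reverse (h : IsTangentCurve L U y z y' z' a b)
    (hL : ∀ x ∈ U, ∀ ξ ∈ L x, -ξ ∈ L x) :
    IsTangentCurve L U (fun t => y (-t)) (fun t => z (-t)) (fun t => -y' (-t))
      (fun t => -z' (-t)) (-b) (-a) := by
  have hm : MapsTo (fun t : ℝ => -t) (Icc (-b) (-a)) (Icc a b) := fun t ht =>
    ⟨by linarith [ht.2], by linarith [ht.1]⟩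
  have hd : ∀ {f f' : ℝ → ℝ}, (∀ t ∈ Icc a b, HasDerivWithinAt f (f' t) (Icc a b) t) →
      ∀ t ∈ Icc (-b) (-a), HasDerivWithinAt (fun t => f (-t)) (-f' (-t)) (Icc (-b) (-a)) t := by
    intro f f' hf t ht
    have := (hf (-t) (hm ht)).comp t (hasDerivAt_neg t).hasDerivWithinAt hm
    rw [mul_neg_one] at this
    exact this
  refine ⟨(h.cont_y.comp continuousOn_neg hm).neg, (h.cont_z.comp continuousOn_neg hm).neg,
    hd h.deriv_y, hd h.deriv_z, fun t ht => h.mem _ (hm ht), fun t ht => ?_⟩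
  have := hL _ (h.mem _ (hm ht)) _ (h.tangent _ (hm ht))
  convert this using 1
  ext i
  fin_cases i <;> rfl

end IsTangentCurve

/-- A continuous function that is positive at `a` and cannot vanish for a first time stays
positive. -/
theorem pos_of_no_first_zero {z : ℝ → ℝ} {a b : ℝ} (hz : ContinuousOn z (Icc a b)) (ha : 0 < z a)
    (h : ∀ c ∈ Ioc a b, (∀ t ∈ Ico a c, 0 < z t) → z c = 0 → False) :
    ∀ t ∈ Icc a b, 0 < z t := by
  by_contra! hcon
  obtain ⟨t₁, ht₁, hzt⟩ := hcon
  set s := Icc a b ∩ z ⁻¹' Iic 0 with hs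
  have hsc : IsCompact s := by
    have : IsClosed s := hz.preimage_isClosed_of_isClosed isClosed_Icc isClosed_Iic
    exact isCompact_Icc.of_isClosed_subset this inter_subset_left
  obtain ⟨c, ⟨hc, hcz⟩, hmin⟩ := hsc.exists_isLeast ⟨t₁, ht₁, hzt⟩
  have hac : a < c := by
    refine lt_of_le_of_ne hc.1 ?_
    rintro rfl
    exact absurd ha (not_lt.2 hcz)
  have hpos : ∀ t ∈ Ico a c, 0 < z t := by
    intro t ht
    by_contra! hle
    exact absurd (hmin ⟨⟨ht.1, ht.2.le.trans hc.2⟩, hle⟩) (not_le.2 ht.2)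
  refine h c ⟨hac, hc.2⟩ hpos (le_antisymm hcz ?_)
  have hcl : c ∈ closure (Ico a c) := by
    rw [closure_Ico hac.ne]; exact ⟨hac.le, le_rfl⟩
  have hcw : ContinuousWithinAt z (Ico a c) c :=
    (hz c hc).mono fun t ht => ⟨ht.1, ht.2.le.trans hc.2⟩
  exact closure_minimal (image_subset_iff.2 fun t ht => (hpos t ht).le : z '' Ico a c ⊆ Ici 0)
    isClosed_Ici (hcw.mem_closure_image hcl)

/-- The leaves of the model foliation, in terms of coordinates. -/
def SameModelLeaf (q q' : ℝ × ℝ) : Prop :=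
  (0 < q.2 ∧ 0 < q'.2 ∧ q.1 * q'.2 = q'.1 * q.2) ∨ (q.2 < 0 ∧ q'.2 = q.2) ∨
    (q.2 = 0 ∧ q'.2 = 0 ∧ 0 < q.1 * q'.1)

/-- If no tangent curve can leave the upper or the lower half-plane, the sign of the second
coordinate is constant along tangent curves. -/
theorem IsTangentCurve.sign_cases {L : E2 → Set E2} {U : Set E2}
    (hL : ∀ x ∈ U, ∀ ξ ∈ L x, -ξ ∈ L x) (hU : (0 : E2) ∉ U)
    (hup : ∀ y z y' z' a b, a < b → IsTangentCurve L U y z y' z' a b → (∀ t ∈ Ico a b, 0 < z t) →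
      z b = 0 → False)
    (hlow : ∀ y z y' z' a b, a < b → IsTangentCurve L U y z y' z' a b →
      (∀ t ∈ Ico a b, z t < 0) → z b = 0 → False)
    {y z y' z' : ℝ → ℝ} {a b : ℝ} (hab : a ≤ b) (h : IsTangentCurve L U y z y' z' a b) :
    (∀ t ∈ Icc a b, 0 < z t) ∨ (∀ t ∈ Icc a b, z t < 0) ∨
      ((∀ t ∈ Icc a b, z t = 0) ∧ 0 < y a * y b) := by
  have fup : ∀ {y z y' z' a b}, IsTangentCurve L U y z y' z' a b → 0 < z a →
      ∀ t ∈ Icc a b, 0 < z t := fun {y z y' z' a b} h ha =>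
    pos_of_no_first_zero h.continuousOn_z ha fun c hc hpos hz =>
      hup y z y' z' a c hc.1 (h.mono le_rfl hc.2) hpos hz
  have flow : ∀ {y z y' z' a b}, IsTangentCurve L U y z y' z' a b → z a < 0 →
      ∀ t ∈ Icc a b, z t < 0 := fun {y z y' z' a b} h ha => by
    have := pos_of_no_first_zero h.continuousOn_z.neg (by simpa using ha) fun c hc hpos hz =>
      hlow y z y' z' a c hc.1 (h.mono le_rfl hc.2) (fun t ht => by simpa using hpos t ht)
        (by simpa using hz)
    exact fun t ht => by simpa using this t ht
  rcases lt_trichotomy (z a) 0 with ha | ha | ha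
  · exact Or.inr (Or.inl (flow h ha))
  · have hz : ∀ t ∈ Icc a b, z t = 0 := by
      intro t ht
      -- If `z t` were nonzero, the curve reversed from `t` to `a` would pass from an open
      -- half-plane to the axis.
      have hr := (h.mono le_rfl ht.2).reverse hL
      rcases lt_trichotomy (z t) 0 with hlt | heq | hgt
      · have := flow hr (by simpa using hlt) (-a) ⟨by linarith [ht.1], le_rfl⟩
        rw [neg_neg, ha] at this
        exact absurd this (lt_irrefl _)
      · exact heq
      · have := fup hr (by simpa using hgt) (-a) ⟨by linarith [ht.1], le_rfl⟩
        rw [neg_neg, ha] at this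
        exact absurd this (lt_irrefl _)
    have hne : ∀ t ∈ Icc a b, y t ≠ 0 := fun t ht h0 => by
      have := h.mem t ht
      rw [h0, hz t ht, pair_eq_zero_iff.2 ⟨rfl, rfl⟩] at this
      exact hU this
    refine Or.inr (Or.inr ⟨hz, ?_⟩)
    -- On the axis a change of sign of `y` would take the curve through the origin, which `U` omits.
    by_contra! hneg
    have h0 : (0 : ℝ) ∈ y '' Icc a b := by
      rcases le_total (y a) 0 with hya | hya
      · refine intermediate_value_Icc hab h.continuousOn_y ⟨hya, ?_⟩
        have := lt_of_le_of_ne hya (hne a ⟨le_rfl, hab⟩)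
        nlinarith
      · refine intermediate_value_Icc' hab h.continuousOn_y ⟨?_, hya⟩
        have := lt_of_le_of_ne hya (hne a ⟨le_rfl, hab⟩).symm
        nlinarith
    obtain ⟨t, ht, h0⟩ := h0
    exact hne t ht h0
  · exact Or.inl (fup h ha)

theorem nodeRegularModel_neg_mem (x : E2) : ∀ ξ ∈ nodeRegularModel x, -ξ ∈ nodeRegularModel x := by
  intro ξ hξ
  unfold nodeRegularModel at *
  split_ifs at * <;> exact Submodule.neg_mem _ hξ

theorem mem_nodeRegularModel_of_pos {a b c d : ℝ} (hb : 0 < b)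
    (h : !₂[c, d] ∈ nodeRegularModel !₂[a, b]) : c * b = a * d := by
  rw [nodeRegularModel, if_pos (by simpa using hb)] at h
  obtain ⟨r, rfl, rfl⟩ := mem_span_pair_iff.1 h
  ring

theorem mem_nodeRegularModel_of_nonpos {a b c d : ℝ} (hb : b ≤ 0)
    (h : !₂[c, d] ∈ nodeRegularModel !₂[a, b]) : d = 0 := by
  rw [nodeRegularModel, if_neg (by simpa using hb)] at h
  obtain ⟨r, -, rfl⟩ := mem_span_pair_iff.1 h
  ring

theorem IsTangentCurve.model_upper {U : Set E2} {y z y' z' : ℝ → ℝ} {a b : ℝ} (hab : a ≤ b)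
    (h : IsTangentCurve nodeRegularModel U y z y' z' a b) (hz : ∀ t ∈ Icc a b, 0 < z t) :
    y a * z b = y b * z a := by
  have ha : a ∈ Icc a b := ⟨le_rfl, hab⟩
  have hb : b ∈ Icc a b := ⟨hab, le_rfl⟩
  have := constant_of_has_deriv_right_zero (f := fun t => y t / z t) (a := a) (b := b)
    (h.continuousOn_y.div h.continuousOn_z fun t ht => (hz t ht).ne')
    (fun t ht => by
      have ht' := Ico_subset_Icc_self ht
      have hd := (h.deriv_y t ht').div (h.deriv_z t ht') (hz t ht').ne'
      rw [mem_nodeRegularModel_of_pos (hz t ht') (h.tangent t ht'), sub_self, zero_div] at hd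
      exact hd.mono_of_mem_nhdsWithin (Icc_mem_nhdsGE_of_mem ht)) b hb
  have h1 := (hz a ha).ne'
  have h2 := (hz b hb).ne'
  field_simp at this
  linarith

theorem IsTangentCurve.model_lower {U : Set E2} {y z y' z' : ℝ → ℝ} {a b : ℝ} (hab : a ≤ b)
    (h : IsTangentCurve nodeRegularModel U y z y' z' a b) (hz : ∀ t ∈ Icc a b, z t ≤ 0) :
    z b = z a :=
  constant_of_has_deriv_right_zero h.continuousOn_z (fun t ht => by
      have ht' := Ico_subset_Icc_self ht
      have hd := h.deriv_z t ht'
      rw [mem_nodeRegularModel_of_nonpos (hz t ht') (h.tangent t ht')] at hd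
      exact hd.mono_of_mem_nhdsWithin (Icc_mem_nhdsGE_of_mem ht)) b ⟨hab, le_rfl⟩

theorem sameModelLeaf_of_sameLeaf {U : Set E2} (hU : (0 : E2) ∉ U) {p q : E2}
    (h : SameLeaf nodeRegularModel U p q) : SameModelLeaf (p 0, p 1) (q 0, q 1) := by
  obtain ⟨y, z, y', z', hc, rfl, rfl⟩ := h.exists_isTangentCurve
  change SameModelLeaf (y 0, z 0) (y 1, z 1)
  have hI0 : (0 : ℝ) ∈ Icc (0 : ℝ) 1 := ⟨le_rfl, zero_le_one⟩
  have hI1 : (1 : ℝ) ∈ Icc (0 : ℝ) 1 := ⟨zero_le_one, le_rfl⟩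
  have hup : ∀ y z y' z' a b, a < b → IsTangentCurve nodeRegularModel U y z y' z' a b →
      (∀ t ∈ Ico a b, 0 < z t) → z b = 0 → False := by
    intro y z y' z' a b hab h hz hb
    -- Before time `b` the curve lies on the ray of its starting point. The relation persists in the
    -- limit and, with `z b = 0`, forces `y b = 0`: the curve would end at the excluded origin.
    have e : EqOn (fun t => y a * z t) (fun t => y t * z a) (Icc a b) := by
      refine EqOn.of_subset_closure (s := Ico a b) (fun t ht => ?_) (continuousOn_const.mul
        h.continuousOn_z) (h.continuousOn_y.mul continuousOn_const) Ico_subset_Icc_self ?_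
      · exact (h.mono le_rfl ht.2.le).model_upper ht.1 fun s hs => hz s ⟨hs.1, hs.2.trans_lt ht.2⟩
      · rw [closure_Ico hab.ne]
    have e' := e ⟨hab.le, le_rfl⟩
    have hza := hz a ⟨le_rfl, hab⟩
    simp only [hb, mul_zero] at e'
    have hyb : y b = 0 := by
      rcases mul_eq_zero.1 e'.symm with h | h
      · exact h
      · exact absurd h hza.ne'
    have := h.mem b ⟨hab.le, le_rfl⟩
    rw [hyb, hb, pair_eq_zero_iff.2 ⟨rfl, rfl⟩] at this
    exact hU this
  have hlow : ∀ y z y' z' a b, a < b → IsTangentCurve nodeRegularModel U y z y' z' a b →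
      (∀ t ∈ Ico a b, z t < 0) → z b = 0 → False := by
    intro y z y' z' a b hab h hz hb
    have := h.model_lower hab.le fun t ht => by
      rcases ht.2.eq_or_lt with rfl | hlt
      · exact hb.le
      · exact (hz t ⟨ht.1, hlt⟩).le
    rw [hb] at this
    exact absurd this (hz a ⟨le_rfl, hab⟩).ne'
  rcases IsTangentCurve.sign_cases (fun x _ => nodeRegularModel_neg_mem x) hU hup hlow
    zero_le_one hc with hz | hz | ⟨hz, hy⟩
  · exact Or.inl ⟨hz 0 hI0, hz 1 hI1, hc.model_upper zero_le_one hz⟩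
  · exact Or.inr (Or.inl ⟨hz 0 hI0, hc.model_lower zero_le_one fun t ht => (hz t ht).le⟩)
  · exact Or.inr (Or.inr ⟨hz 0 hI0, hz 1 hI1, hy⟩)

/-- In a convex set, the points of one leaf of the model are joined by a segment. -/
theorem sameLeaf_of_sameModelLeaf {T : Set E2} (hT : Convex ℝ T) {p q : E2} (hp : p ∈ T)
    (hq : q ∈ T) (h : SameModelLeaf (p 0, p 1) (q 0, q 1)) :
    SameLeaf nodeRegularModel (T \ {0}) p q := by
  have hd : ∀ (i : Fin 2) (t : ℝ),
      HasDerivAt (fun t => p i + t * (q i - p i)) (q i - p i) t := by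
    intro i t
    simpa using ((hasDerivAt_id t).mul_const (q i - p i)).const_add (p i)
  have key := sameLeaf_of_hasDerivAt (L := nodeRegularModel) (U := T \ {0}) (hd 0) (hd 1)
    continuous_const continuous_const ?_
  · convert key using 1
    · ext i; fin_cases i <;> simp
    · ext i; fin_cases i <;> simp
  intro t ht
  have hm : (!₂[p 0 + t * (q 0 - p 0), p 1 + t * (q 1 - p 1)] : E2) ∈ T := by
    have := hT hp hq (sub_nonneg.2 ht.2) ht.1 (by ring)
    convert this using 1
    ext i
    fin_cases i <;> simp <;> ring
  refine ⟨⟨hm, ?_⟩, ?_⟩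
  · rw [mem_singleton_iff, pair_eq_zero_iff]
    rintro ⟨h0, h1⟩
    rcases h with ⟨h2, h3, -⟩ | ⟨h2, h3⟩ | ⟨-, -, h2⟩
    · simp only at h2 h3
      rcases ht.1.eq_or_lt with rfl | ht0
      · linarith
      · nlinarith [mul_pos ht0 h3, mul_nonneg (sub_nonneg.2 ht.2) h2.le]
    · simp only at h2 h3
      rw [h3] at h1
      linarith
    · simp only at h2
      have h4 : (1 - t) * (p 0 * q 0) + t * (q 0 * q 0) = 0 := by linear_combination q 0 * h0
      have h5 : (1 - t) * (p 0 * p 0) + t * (p 0 * q 0) = 0 := by linear_combination p 0 * h0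
      rcases ht.1.eq_or_lt with rfl | ht0
      · nlinarith
      · nlinarith [mul_pos ht0 h2, mul_nonneg (sub_nonneg.2 ht.2) (mul_self_nonneg (p 0))]
  · rcases h with ⟨h2, h3, h4⟩ | ⟨h2, h3⟩ | ⟨h2, h3, -⟩
    · simp only at h2 h3 h4
      have hpos : 0 < p 1 + t * (q 1 - p 1) := by
        rcases ht.1.eq_or_lt with rfl | ht0
        · linarith
        · nlinarith [mul_pos ht0 h3, mul_nonneg (sub_nonneg.2 ht.2) h2.le]
      rw [nodeRegularModel, if_pos (by simpa using hpos), mem_span_pair_iff]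
      refine ⟨(q 1 - p 1) / (p 1 + t * (q 1 - p 1)), ?_, ?_⟩
      · rw [div_mul_eq_mul_div, eq_div_iff hpos.ne']
        linear_combination -h4
      · rw [div_mul_cancel₀ _ hpos.ne']
    all_goals
      simp only at h2 h3
      rw [nodeRegularModel, if_neg (by simp [h2, h3]; try linarith), mem_span_pair_iff]
      exact ⟨q 0 - p 0, by ring, by rw [h3]; linarith⟩

/-! ### Straightening a field that is a node above the axis and regular below -/

/-- A continuous injective map on a compact set is a homeomorphism between an open subset of the
compact set and its image, if that is open. -/
theorem exists_openPartialHomeomorph_of_isCompact {X Y : Type*} [TopologicalSpace X]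
    [TopologicalSpace Y] [T2Space Y] [Nonempty X] {H : X → Y} {C S : Set X} {T : Set Y}
    (hC : IsCompact C) (hc : ContinuousOn H C) (hi : InjOn H C) (hS : IsOpen S) (hT : IsOpen T)
    (hSC : S ⊆ C) (hST : H '' S = T) :
    ∃ e : OpenPartialHomeomorph X Y, e.source = S ∧ e.target = T ∧ ∀ x, e x = H x := by
  have hinv : ∀ x ∈ C, Function.invFunOn H C (H x) = x := fun x hx => hi.leftInvOn_invFunOn hx
  have hcinv : ContinuousOn (Function.invFunOn H C) (H '' C) := by
    have hemb : IsClosedEmbedding (C.domRestrict H) := by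
      have : CompactSpace C := isCompact_iff_compactSpace.1 hC
      exact hc.domRestrict.isClosedEmbedding hi.injective
    rw [continuousOn_iff_continuous_domRestrict]
    have hmem : ∀ u : H '' C, Function.invFunOn H C u ∈ C := by
      rintro ⟨_, x, hx, rfl⟩
      rw [hinv x hx]; exact hx
    have : Continuous fun u : H '' C => (⟨Function.invFunOn H C u, hmem u⟩ : C) := by
      rw [hemb.isInducing.continuous_iff]
      refine continuous_subtype_val.congr ?_
      rintro ⟨_, x, hx, rfl⟩
      change H x = H (Function.invFunOn H C (H x))
      rw [hinv x hx]
    exact continuous_subtype_val.comp this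
  refine ⟨{ toFun := H
            invFun := Function.invFunOn H C
            source := S
            target := T
            map_source' := fun x hx => hST ▸ mem_image_of_mem H hx
            map_target' := ?_
            left_inv' := fun x hx => hinv x (hSC hx)
            right_inv' := ?_
            open_source := hS
            open_target := hT
            continuousOn_toFun := hc.mono hSC
            continuousOn_invFun := hcinv.mono (hST ▸ image_mono hSC) }, rfl, rfl, fun x => rfl⟩
  · rw [← hST]
    rintro _ ⟨x, hx, rfl⟩
    rw [hinv x (hSC hx)]; exact hx
  · rw [← hST]
    rintro _ ⟨x, hx, rfl⟩
    rw [hinv x (hSC hx)]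

/-- The nearest point of `[-δ, δ]`. -/
def clamp (δ x : ℝ) : ℝ := max (-δ) (min δ x)

theorem abs_clamp_le {δ : ℝ} (hδ : 0 ≤ δ) (x : ℝ) : |clamp δ x| ≤ δ :=
  abs_le.2 ⟨le_max_left _ _, max_le (by linarith) (min_le_left _ _)⟩

theorem clamp_of_abs_le {δ x : ℝ} (h : |x| ≤ δ) : clamp δ x = x := by
  rw [abs_le] at h
  rw [clamp, min_eq_right h.2, max_eq_right h.1]

theorem lipschitz_clamp (δ : ℝ) : LipschitzWith 1 (clamp δ) :=
  (LipschitzWith.id.const_min δ).const_max (-δ)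

theorem continuous_clamp (δ : ℝ) : Continuous (clamp δ) := (lipschitz_clamp δ).continuous

/-- The field of lines `L` is spanned by `(h, z)` on the upper side and by `(1, z g)` on the closed
lower side of the axis `z = 0`, and `h` points away from `y = 0` outside the cone `|y| < A z`. -/
structure NodeRegularField (L : E2 → Set E2) (h g : ℝ × ℝ → ℝ) (δ A : ℝ) (K : NNReal) :
    Prop where
  δ_pos : 0 < δ
  one_le : 1 ≤ A
  lip_h : LipschitzOnWith K h (Icc (-δ) δ ×ˢ Icc (-δ) δ)
  lip_g : LipschitzOnWith K g (Icc (-δ) δ ×ˢ Icc (-δ) δ)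
  outward : ∀ y z, |y| ≤ δ → |z| ≤ δ → 0 ≤ z → A * z ≤ |y| → y ≠ 0 → 0 < y * h (y, z)
  upper : ∀ y z, |y| ≤ δ → |z| ≤ δ → 0 < z →
    L !₂[y, z] = (Submodule.span ℝ {(!₂[h (y, z), z] : E2)} : Set E2)
  lower : ∀ y z, |y| ≤ δ → |z| ≤ δ → z ≤ 0 → (y, z) ≠ 0 →
    L !₂[y, z] = (Submodule.span ℝ {(!₂[1, z * g (y, z)] : E2)} : Set E2)

namespace NodeRegularField

/-- The right-hand side `dy/ds` on the upper side, where `exp s = A z`. -/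
def nodeSlope (h : ℝ × ℝ → ℝ) (δ A y z : ℝ) : ℝ := h (clamp δ y, clamp δ (z / A))

/-- The right-hand side `dz/dy` on the lower side. -/
def regularSlope (g : ℝ × ℝ → ℝ) (δ y z : ℝ) : ℝ := clamp δ z * g (clamp δ y, clamp δ z)

variable {L : E2 → Set E2} {h g : ℝ × ℝ → ℝ} {δ A : ℝ} {K : NNReal}

theorem clamp_mem (hδ : 0 ≤ δ) (y z : ℝ) :
    (clamp δ y, clamp δ z) ∈ Icc (-δ) δ ×ˢ Icc (-δ) δ :=
  ⟨abs_le.1 (abs_clamp_le hδ y), abs_le.1 (abs_clamp_le hδ z)⟩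

/-- Clamping to the box makes the slope bounded and globally Lipschitz in `y` without altering it
inside. In the rescaled height `A z` the cone `A z ≤ |y|` becomes `z ≤ |y|`, as required by
`NodeFlow`. -/
theorem exists_nodeFlow (H : NodeRegularField L h g δ A K) :
    ∃ Φ C M, NodeFlow (nodeSlope h δ A) Φ δ C M := by
  have hδ := H.δ_pos
  have hA : 0 < A := one_pos.trans_le H.one_le
  obtain ⟨C, hC⟩ := (isCompact_Icc.prod isCompact_Icc).exists_bound_of_continuousOn
    H.lip_h.continuousOn
  have hbound : ∀ y z, |nodeSlope h δ A y z| ≤ C.toNNReal := fun y z =>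
    (hC _ (clamp_mem hδ.le _ _)).trans (Real.le_coe_toNNReal C)
  have hlip : ∀ z, LipschitzWith K (fun y => nodeSlope h δ A y z) := by
    intro z
    refine LipschitzWith.of_dist_le_mul fun y y' => ?_
    refine (H.lip_h.dist_le_mul _ (clamp_mem hδ.le _ _) _ (clamp_mem hδ.le _ _)).trans ?_
    gcongr
    rw [Prod.dist_eq]
    simp only [dist_self]
    refine max_le ?_ dist_nonneg
    simpa using (lipschitz_clamp δ).dist_le_mul y y'
  have hcont : Continuous fun q : ℝ × ℝ => nodeSlope h δ A q.1 q.2 := by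
    refine H.lip_h.continuousOn.comp_continuous (f := fun q : ℝ × ℝ => (clamp δ q.1, clamp δ (q.2 / A)))
      ?_ fun q => clamp_mem hδ.le _ _
    exact ((continuous_clamp δ).comp continuous_fst).prodMk
      ((continuous_clamp δ).comp (continuous_snd.div_const A))
  obtain ⟨Φ, hΦ⟩ := exists_isGlobalFlow (v := fun s y => nodeSlope h δ A y (exp s))
    (fun s y => hbound y (exp s)) (fun s => hlip (exp s))
    (fun y => hcont.comp (continuous_const.prodMk continuous_exp))
  have hmin : ∀ η > 0, 0 < min η δ := fun η hη => lt_min hη hδ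
  have hz : ∀ {z : ℝ}, 0 ≤ z → z ≤ δ → z / A ≤ z ∧ |z / A| ≤ δ := by
    intro z h0 h1
    have : z / A ≤ z := div_le_self h0 H.one_le
    exact ⟨this, by rw [abs_of_nonneg (div_nonneg h0 hA.le)]; linarith⟩
  refine ⟨Φ, C.toNNReal, K, hδ, hΦ, hbound, hlip, ?_, ?_⟩
  · intro η hη
    -- On this compact rectangle `z ≤ min η δ ≤ y`, so `outward` makes the slope positive and its
    -- minimum is a uniform `μ`. Larger `y` are clamped into the rectangle.
    obtain ⟨q, ⟨hq1, hq2⟩, hq⟩ := (isCompact_Icc.prod isCompact_Icc).exists_isMinOn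
      (s := Icc (min η δ) δ ×ˢ Icc 0 (min η δ))
      ⟨(δ, 0), ⟨min_le_right _ _, le_rfl⟩, ⟨le_rfl, (hmin η hη).le⟩⟩ hcont.continuousOn
    have hq1' := (hmin η hη).trans_le hq1.1
    refine ⟨nodeSlope h δ A q.1 q.2, ?_, fun y z h0 h1 h2 h3 => ?_⟩
    · have hzq := hz hq2.1 (hq2.2.trans (min_le_right _ _))
      have hqa : |q.1| ≤ δ := by rw [abs_of_pos hq1']; exact hq1.2
      have := H.outward q.1 (q.2 / A) hqa hzq.2 (div_nonneg hq2.1 hA.le)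
        (by rw [mul_div_cancel₀ _ hA.ne', abs_of_pos hq1']; exact hq2.2.trans hq1.1) hq1'.ne'
      rw [nodeSlope, clamp_of_abs_le hqa, clamp_of_abs_le hzq.2]
      exact pos_of_mul_pos_right this hq1'.le
    · have hmem : (clamp δ y, z) ∈ Icc (min η δ) δ ×ˢ Icc 0 (min η δ) := by
        refine ⟨⟨?_, (abs_le.1 (abs_clamp_le hδ.le y)).2⟩, h0, le_min h1 h2⟩
        exact le_max_of_le_right (le_min (min_le_right _ _) ((min_le_left _ _).trans h3))
      have := hq hmem
      simpa only [mem_ofPred_eq, nodeSlope, clamp_of_abs_le (abs_clamp_le hδ.le y)] using this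
  · intro η hη
    obtain ⟨q, ⟨hq1, hq2⟩, hq⟩ := (isCompact_Icc.prod isCompact_Icc).exists_isMaxOn
      (s := Icc (-δ) (-min η δ) ×ˢ Icc 0 (min η δ))
      ⟨(-δ, 0), ⟨le_rfl, neg_le_neg (min_le_right _ _)⟩, ⟨le_rfl, (hmin η hη).le⟩⟩
      hcont.continuousOn
    have hq1' : q.1 < 0 := by linarith [hmin η hη, hq1.2]
    refine ⟨-nodeSlope h δ A q.1 q.2, ?_, fun y z h0 h1 h2 h3 => ?_⟩
    · have hzq := hz hq2.1 (hq2.2.trans (min_le_right _ _))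
      have hqa : |q.1| ≤ δ := by rw [abs_of_neg hq1']; linarith [hq1.1]
      have := H.outward q.1 (q.2 / A) hqa hzq.2 (div_nonneg hq2.1 hA.le)
        (by rw [mul_div_cancel₀ _ hA.ne', abs_of_neg hq1']; linarith [hq1.2, hq2.2]) hq1'.ne
      rw [nodeSlope, clamp_of_abs_le hqa, clamp_of_abs_le hzq.2]
      nlinarith
    · have hmem : (clamp δ y, z) ∈ Icc (-δ) (-min η δ) ×ˢ Icc 0 (min η δ) := by
        refine ⟨⟨(abs_le.1 (abs_clamp_le hδ.le y)).1, ?_⟩, h0, le_min h1 h2⟩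
        refine max_le (neg_le_neg (min_le_right _ _)) ((min_le_right _ _).trans ?_)
        linarith [min_le_left η δ]
      have := hq hmem
      simpa only [mem_ofPred_eq, nodeSlope, clamp_of_abs_le (abs_clamp_le hδ.le y), neg_neg]
        using this

theorem exists_regularFlow (H : NodeRegularField L h g δ A K) :
    ∃ Ψ, ∃ C M : NNReal, IsGlobalFlow (regularSlope g δ) Ψ ∧
      (∀ y z, |regularSlope g δ y z| ≤ C) ∧ (∀ y, LipschitzWith M (regularSlope g δ y)) := by
  have hδ := H.δ_pos
  obtain ⟨B, hB⟩ := (isCompact_Icc.prod isCompact_Icc).exists_bound_of_continuousOn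
    H.lip_g.continuousOn
  have hB' : ∀ y z, |g (clamp δ y, clamp δ z)| ≤ B.toNNReal := fun y z =>
    (hB _ (clamp_mem hδ.le _ _)).trans (Real.le_coe_toNNReal B)
  have hδ' : (δ.toNNReal : ℝ) = δ := Real.coe_toNNReal _ hδ.le
  have hbound : ∀ y z, |regularSlope g δ y z| ≤ (δ.toNNReal * B.toNNReal : NNReal) := by
    intro y z
    rw [regularSlope, abs_mul, NNReal.coe_mul, hδ']
    gcongr
    · exact abs_clamp_le hδ.le z
    · exact hB' y z
  have hlip : ∀ y, LipschitzWith (δ.toNNReal * K + B.toNNReal) (regularSlope g δ y) := by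
    intro y
    refine LipschitzWith.of_dist_le_mul fun z z' => ?_
    have h1 : |g (clamp δ y, clamp δ z) - g (clamp δ y, clamp δ z')| ≤ K * |z - z'| := by
      refine (H.lip_g.dist_le_mul _ (clamp_mem hδ.le _ _) _ (clamp_mem hδ.le _ _)).trans ?_
      gcongr
      rw [Prod.dist_eq]
      simp only [dist_self]
      refine max_le (abs_nonneg _) ?_
      simpa [Real.dist_eq] using (lipschitz_clamp δ).dist_le_mul z z'
    have h2 : |clamp δ z - clamp δ z'| ≤ |z - z'| := by
      simpa [Real.dist_eq] using (lipschitz_clamp δ).dist_le_mul z z'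
    rw [Real.dist_eq, Real.dist_eq, NNReal.coe_add, NNReal.coe_mul, hδ', regularSlope, regularSlope]
    calc _ = |clamp δ z * (g (clamp δ y, clamp δ z) - g (clamp δ y, clamp δ z')) +
          (clamp δ z - clamp δ z') * g (clamp δ y, clamp δ z')| := by ring_nf
      _ ≤ |clamp δ z| * |g (clamp δ y, clamp δ z) - g (clamp δ y, clamp δ z')| +
          |clamp δ z - clamp δ z'| * |g (clamp δ y, clamp δ z')| := by
        rw [← abs_mul, ← abs_mul]; exact abs_add_le _ _
      _ ≤ δ * (K * |z - z'|) + |z - z'| * B.toNNReal := by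
        gcongr
        · exact abs_clamp_le hδ.le z
        · exact hB' y z'
      _ = _ := by ring
  have hcont : ∀ z, Continuous fun y => regularSlope g δ y z := by
    intro z
    refine continuous_const.mul (H.lip_g.continuousOn.comp_continuous
      (f := fun y : ℝ => (clamp δ y, clamp δ z)) ?_ fun q => clamp_mem hδ.le _ _)
    exact (continuous_clamp δ).prodMk continuous_const
  obtain ⟨Ψ, hΨ⟩ := exists_isGlobalFlow hbound hlip hcont
  exact ⟨Ψ, _, _, hΨ, hbound, hlip⟩

variable {Φ Ψ : ℝ → ℝ → ℝ → ℝ} {C M C' M' : NNReal}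

theorem regularFlow_zero (hδ : 0 ≤ δ) (hΨ : IsGlobalFlow (regularSlope g δ) Ψ)
    (hl : ∀ y, LipschitzWith M' (regularSlope g δ y)) (t₀ t : ℝ) : Ψ t₀ 0 t = 0 := by
  have := hΨ.eq_of_hasDerivAt hl (y := fun _ => 0) (fun t => by
    rw [regularSlope, clamp_of_abs_le (by simpa using hδ), zero_mul]
    exact hasDerivAt_const t 0) t₀
  exact congrFun this t

/-- The factor `z` of the slope makes zero a solution; a solution that reached it would coincide
with it. -/
theorem regularFlow_neg (hδ : 0 ≤ δ) (hΨ : IsGlobalFlow (regularSlope g δ) Ψ)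
    (hl : ∀ y, LipschitzWith M' (regularSlope g δ y)) (t₀ t : ℝ) {k : ℝ} (hk : k < 0) :
    Ψ t₀ k t < 0 := by
  by_contra! hcon
  have h0 : (0 : ℝ) ∈ range (Ψ t₀ k) :=
    mem_range_of_exists_le_of_exists_ge (hΨ.continuous t₀ k) ⟨t₀, by rw [hΨ.init]; exact hk.le⟩
      ⟨t, hcon⟩
  obtain ⟨s, hs⟩ := h0
  have := hΨ.flow_flow hl t₀ s k
  rw [hs] at this
  have h1 := congrFun this t₀
  rw [regularFlow_zero hδ hΨ hl, hΨ.init] at h1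
  exact hk.ne h1.symm

theorem regularFlow_nonpos (hδ : 0 ≤ δ) (hΨ : IsGlobalFlow (regularSlope g δ) Ψ)
    (hl : ∀ y, LipschitzWith M' (regularSlope g δ y)) (t₀ t : ℝ) {k : ℝ} (hk : k ≤ 0) :
    Ψ t₀ k t ≤ 0 := by
  rcases hk.eq_or_lt with rfl | hk
  · exact (regularFlow_zero hδ hΨ hl t₀ t).le
  · exact (regularFlow_neg hδ hΨ hl t₀ t hk).le

/-- Tangency to `(h, z)` means `z dy = h dz`; with `log (A z)` as time this is the node equation,
for any parametrization of the curve. -/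
theorem label_eq_of_tangent (H : NodeRegularField L h g δ A K)
    (hΦ : NodeFlow (nodeSlope h δ A) Φ δ C M) {U : Set E2}
    (hU : ∀ x ∈ U, |x 0| ≤ δ ∧ |x 1| ≤ δ) {y z y' z' : ℝ → ℝ} {a b : ℝ} (hab : a ≤ b)
    (hc : IsTangentCurve L U y z y' z' a b) (hz : ∀ t ∈ Icc a b, 0 < z t) :
    NodeFlow.label Φ δ (y b, A * z b) = NodeFlow.label Φ δ (y a, A * z a) := by
  have hA : 0 < A := one_pos.trans_le H.one_le
  have := hΦ.flow.eq_of_tangent (fun s => hΦ.lip (exp s)) (τ := fun t => log (A * z t))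
    (τ' := fun t => z' t / z t) (w := y) (a := a) (b := b)
    (fun t ht => by
      have h1 := ((hc.deriv_z t ht).const_mul A).log (mul_pos hA (hz t ht)).ne'
      rwa [mul_div_mul_left _ _ hA.ne'] at h1)
    (hc.cont_z.div hc.continuousOn_z fun t ht => (hz t ht).ne')
    (fun t ht => by
      have hbox : |y t| ≤ δ ∧ |z t| ≤ δ := hU _ (hc.mem t ht)
      have h1 := hc.tangent t ht
      rw [H.upper _ _ hbox.1 hbox.2 (hz t ht), mem_span_pair_iff] at h1
      obtain ⟨r, hr1, hr2⟩ := h1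
      have h2 := hc.deriv_y t ht
      rw [hr1] at h2
      convert h2 using 1
      have hz' := (hz t ht).ne'
      rw [exp_log (mul_pos hA (hz t ht)), nodeSlope, mul_div_cancel_left₀ _ hA.ne',
        clamp_of_abs_le (x := y t) hbox.1, clamp_of_abs_le (x := z t) hbox.2, hr2]
      field_simp) b ⟨hab, le_rfl⟩
  rw [NodeFlow.label, NodeFlow.label]
  simp only at this ⊢
  conv_lhs => rw [this]
  rw [hΦ.flow.flow_flow fun s => hΦ.lip (exp s)]

/-- Here `y` is the time: tangency to `(1, z g)` means `dz = z g dy`, so the height at which the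
leaf meets `y = 0` is constant along the curve. -/
theorem drop_eq_of_tangent (H : NodeRegularField L h g δ A K)
    (hΨ : IsGlobalFlow (regularSlope g δ) Ψ) (hl : ∀ y, LipschitzWith M' (regularSlope g δ y))
    {U : Set E2} (hU : ∀ x ∈ U, |x 0| ≤ δ ∧ |x 1| ≤ δ) (hU0 : (0 : E2) ∉ U)
    {y z y' z' : ℝ → ℝ} {a b : ℝ} (hab : a ≤ b)
    (hc : IsTangentCurve L U y z y' z' a b) (hz : ∀ t ∈ Icc a b, z t ≤ 0) :
    Ψ (y b) (z b) 0 = Ψ (y a) (z a) 0 := by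
  have := hΨ.eq_of_tangent hl (τ := y) (τ' := y') (w := z) (a := a) (b := b) hc.deriv_y hc.cont_y
    (fun t ht => by
      have hbox : |y t| ≤ δ ∧ |z t| ≤ δ := hU _ (hc.mem t ht)
      have h1 := hc.tangent t ht
      rw [H.lower _ _ hbox.1 hbox.2 (hz t ht) ?_, mem_span_pair_iff] at h1
      · obtain ⟨r, hr1, hr2⟩ := h1
        have h2 := hc.deriv_z t ht
        rw [hr2] at h2
        convert h2 using 1
        rw [regularSlope, clamp_of_abs_le (x := y t) hbox.1, clamp_of_abs_le (x := z t) hbox.2, hr1]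
        ring
      · intro h0
        rw [Prod.mk_eq_zero] at h0
        exact hU0 (pair_eq_zero_iff.2 h0 ▸ hc.mem t ht)) b ⟨hab, le_rfl⟩
  conv_lhs => rw [this]
  rw [hΨ.flow_flow hl]

/-- The map that straightens the foliation: `NodeFlow.straighten` above the axis, the flow to the
line `y = 0` below it. -/
def flatten (Φ Ψ : ℝ → ℝ → ℝ → ℝ) (δ A : ℝ) (q : ℝ × ℝ) : ℝ × ℝ :=
  if 0 < q.2 then NodeFlow.straighten Φ δ (q.1, A * q.2) else (q.1, Ψ q.1 q.2 0)

theorem flatten_of_pos {q : ℝ × ℝ} (hq : 0 < q.2) :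
    flatten Φ Ψ δ A q = NodeFlow.straighten Φ δ (q.1, A * q.2) := if_pos hq

theorem flatten_of_nonpos {q : ℝ × ℝ} (hq : q.2 ≤ 0) :
    flatten Φ Ψ δ A q = (q.1, Ψ q.1 q.2 0) := if_neg (not_lt.2 hq)

theorem continuous_flatten (H : NodeRegularField L h g δ A K)
    (hΦ : NodeFlow (nodeSlope h δ A) Φ δ C M) (hΨ : IsGlobalFlow (regularSlope g δ) Ψ)
    (hb : ∀ y z, |regularSlope g δ y z| ≤ C') (hl : ∀ y, LipschitzWith M' (regularSlope g δ y)) :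
    Continuous (flatten Φ Ψ δ A) := by
  have hA : 0 < A := one_pos.trans_le H.one_le
  have h1 : ContinuousOn (flatten Φ Ψ δ A) {q | 0 ≤ q.2} := by
    have : ContinuousOn (fun q : ℝ × ℝ => NodeFlow.straighten Φ δ (q.1, A * q.2)) {q | 0 ≤ q.2} :=
      hΦ.continuousOn_straighten.comp (f := fun q : ℝ × ℝ => (q.1, A * q.2))
        (by fun_prop) fun q hq => mul_nonneg hA.le hq
    refine this.congr fun q hq => ?_
    rcases (show 0 ≤ q.2 from hq).lt_or_eq with h0 | h0
    · exact flatten_of_pos h0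
    · change _ = NodeFlow.straighten Φ δ (q.1, A * q.2)
      rw [flatten_of_nonpos h0.ge, NodeFlow.straighten, if_neg (by simp [← h0]), ← h0,
        regularFlow_zero H.δ_pos.le hΨ hl]
  have h2 : ContinuousOn (flatten Φ Ψ δ A) {q | q.2 ≤ 0} := by
    have : Continuous fun q : ℝ × ℝ => (q.1, Ψ q.1 q.2 0) :=
      continuous_fst.prodMk (hΨ.continuous_initial hl hb 0)
    exact this.continuousOn.congr fun q hq => flatten_of_nonpos hq
  rw [← continuousOn_univ]
  have hun : (univ : Set (ℝ × ℝ)) = {q | 0 ≤ q.2} ∪ {q | q.2 ≤ 0} := by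
    ext q
    simpa using le_total 0 q.2
  rw [hun]
  exact h1.union_of_isClosed h2 (isClosed_le continuous_const continuous_snd)
    (isClosed_le continuous_snd continuous_const)

theorem sign_flatten (H : NodeRegularField L h g δ A K) (hΨ : IsGlobalFlow (regularSlope g δ) Ψ)
    (hl : ∀ y, LipschitzWith M' (regularSlope g δ y)) (q : ℝ × ℝ) :
    SignType.sign (flatten Φ Ψ δ A q).2 = SignType.sign q.2 := by
  have hA : 0 < A := one_pos.trans_le H.one_le
  rcases lt_trichotomy q.2 0 with hq | hq | hq
  · rw [flatten_of_nonpos hq.le, sign_neg hq, sign_neg (regularFlow_neg H.δ_pos.le hΨ hl _ _ hq)]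
  · rw [flatten_of_nonpos hq.le, hq, regularFlow_zero H.δ_pos.le hΨ hl]
  · rw [flatten_of_pos hq, sign_pos hq, sign_pos]
    exact NodeFlow.straighten_snd_pos H.δ_pos (mul_pos hA hq)

theorem flatten_injOn (H : NodeRegularField L h g δ A K)
    (hΦ : NodeFlow (nodeSlope h δ A) Φ δ C M) (hΨ : IsGlobalFlow (regularSlope g δ) Ψ)
    (hl : ∀ y, LipschitzWith M' (regularSlope g δ y)) :
    InjOn (flatten Φ Ψ δ A) {q | A * q.2 ≤ δ} := by
  have hA : 0 < A := one_pos.trans_le H.one_le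
  intro q hq q' hq' heq
  have hs : SignType.sign q.2 = SignType.sign q'.2 := by
    rw [← H.sign_flatten hΨ hl (Φ := Φ), heq, H.sign_flatten hΨ hl]
  rcases lt_or_ge 0 q.2 with h0 | h0
  · have h0' : 0 < q'.2 := by rwa [sign_pos h0, eq_comm, sign_eq_one_iff] at hs
    rw [flatten_of_pos h0, flatten_of_pos h0'] at heq
    have := hΦ.straighten_injOn
      (⟨mul_pos hA h0, hq⟩ : (q.1, A * q.2) ∈ {q : ℝ × ℝ | 0 < q.2 ∧ q.2 ≤ δ})
      (⟨mul_pos hA h0', hq'⟩ : (q'.1, A * q'.2) ∈ {q : ℝ × ℝ | 0 < q.2 ∧ q.2 ≤ δ}) heq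
    rw [Prod.mk.injEq] at this
    exact Prod.ext this.1 (mul_left_cancel₀ hA.ne' this.2)
  · have h0' : q'.2 ≤ 0 := by
      by_contra! hcon
      rw [sign_pos hcon, sign_eq_one_iff] at hs
      linarith
    rw [flatten_of_nonpos h0, flatten_of_nonpos h0', Prod.mk.injEq] at heq
    have h1 := hΨ.flow_flow hl q.1 0 q.2
    rw [heq.2, heq.1, hΨ.flow_flow hl] at h1
    have h2 := congrFun h1 q'.1
    rw [hΨ.init, hΨ.init] at h2
    exact Prod.ext heq.1 h2.symm

/-- The points of a tangent curve are mapped to one leaf of the model. -/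
theorem sameModelLeaf_of_sameLeaf (H : NodeRegularField L h g δ A K)
    (hΦ : NodeFlow (nodeSlope h δ A) Φ δ C M) (hΨ : IsGlobalFlow (regularSlope g δ) Ψ)
    (hb : ∀ y z, |regularSlope g δ y z| ≤ C') (hl : ∀ y, LipschitzWith M' (regularSlope g δ y))
    {U : Set E2} (hU : ∀ x ∈ U, |x 0| ≤ δ ∧ |x 1| ≤ δ) (hU0 : (0 : E2) ∉ U) {p q : E2}
    (hpq : SameLeaf L U p q) :
    SameModelLeaf (flatten Φ Ψ δ A (p 0, p 1)) (flatten Φ Ψ δ A (q 0, q 1)) := by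
  have hA : 0 < A := one_pos.trans_le H.one_le
  have hδ := H.δ_pos
  have hI0 : (0 : ℝ) ∈ Icc (0 : ℝ) 1 := ⟨le_rfl, zero_le_one⟩
  have hI1 : (1 : ℝ) ∈ Icc (0 : ℝ) 1 := ⟨zero_le_one, le_rfl⟩
  have hneg : ∀ x ∈ U, ∀ ξ ∈ L x, -ξ ∈ L x := by
    intro x hx ξ hξ
    have hbox := hU x hx
    rw [← eta_pair x] at hξ ⊢
    rcases lt_or_ge 0 (x 1) with h0 | h0
    · rw [H.upper _ _ hbox.1 hbox.2 h0] at hξ ⊢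
      exact Submodule.neg_mem _ hξ
    · have hne : (x 0, x 1) ≠ 0 := by
        intro h1
        rw [Prod.mk_eq_zero] at h1
        rw [← eta_pair x, pair_eq_zero_iff.2 h1] at hx
        exact hU0 hx
      rw [H.lower _ _ hbox.1 hbox.2 h0 hne] at hξ ⊢
      exact Submodule.neg_mem _ hξ
  have hup : ∀ y z y' z' a b, a < b → IsTangentCurve L U y z y' z' a b →
      (∀ t ∈ Ico a b, 0 < z t) → z b = 0 → False := by
    intro y z y' z' a b hab hc hz hzb
    set c := (NodeFlow.squareDir δ (NodeFlow.label Φ δ (y a, A * z a))).2 with hcdef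
    have hcpos : 0 < c := NodeFlow.squareDir_snd_pos hδ _
    have hcont : ContinuousOn (fun t => (flatten Φ Ψ δ A (y t, z t)).2) (Icc a b) :=
      (continuous_snd.comp (H.continuous_flatten hΦ hΨ hb hl)).comp_continuousOn
        (hc.continuousOn_y.prodMk hc.continuousOn_z)
    -- The label is constant before time `b`, so the image height is the radius times the fixed `c >
    -- 0`. By continuity this holds at `b`, where the image height is zero; hence `y b = 0`, which
    -- is the excluded origin.
    have e : EqOn (fun t => (flatten Φ Ψ δ A (y t, z t)).2) (fun t => max |y t| (A * z t) * c)
        (Icc a b) := by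
      refine EqOn.of_subset_closure (s := Ico a b) (fun t ht => ?_) hcont
        ((continuous_max.comp_continuousOn (hc.continuousOn_y.abs.prodMk
          (continuousOn_const.mul hc.continuousOn_z))).mul continuousOn_const) Ico_subset_Icc_self ?_
      · have h1 := H.label_eq_of_tangent hΦ hU ht.1 (hc.mono le_rfl ht.2.le)
          fun s hs => hz s ⟨hs.1, hs.2.trans_lt ht.2⟩
        have h2 : 0 < A * z t := mul_pos hA (hz t ht)
        rw [flatten_of_pos (hz t ht), NodeFlow.straighten_of_pos h2, h1]
        rfl
      · rw [closure_Ico hab.ne]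
    have e' := e ⟨hab.le, le_rfl⟩
    simp only [hzb] at e'
    rw [flatten_of_nonpos le_rfl, regularFlow_zero hδ.le hΨ hl, mul_zero,
      max_eq_left (abs_nonneg _), eq_comm, mul_eq_zero, abs_eq_zero] at e'
    have hyb : y b = 0 := e'.resolve_right hcpos.ne'
    have := hc.mem b ⟨hab.le, le_rfl⟩
    rw [hyb, hzb, pair_eq_zero_iff.2 ⟨rfl, rfl⟩] at this
    exact hU0 this
  have hlow : ∀ y z y' z' a b, a < b → IsTangentCurve L U y z y' z' a b →
      (∀ t ∈ Ico a b, z t < 0) → z b = 0 → False := by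
    intro y z y' z' a b hab hc hz hzb
    have h1 := H.drop_eq_of_tangent hΨ hl hU hU0 hab.le hc fun t ht => by
      rcases ht.2.eq_or_lt with rfl | hlt
      · exact hzb.le
      · exact (hz t ⟨ht.1, hlt⟩).le
    rw [hzb, regularFlow_zero hδ.le hΨ hl] at h1
    exact absurd h1 (regularFlow_neg hδ.le hΨ hl _ _ (hz a ⟨le_rfl, hab⟩)).ne'
  obtain ⟨y, z, y', z', hc, rfl, rfl⟩ := hpq.exists_isTangentCurve
  change SameModelLeaf (flatten Φ Ψ δ A (y 0, z 0)) (flatten Φ Ψ δ A (y 1, z 1))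
  rcases IsTangentCurve.sign_cases hneg hU0 hup hlow zero_le_one hc with hz | hz | ⟨hz, hy⟩
  · have h0 := mul_pos hA (hz 0 hI0)
    have h1 := mul_pos hA (hz 1 hI1)
    rw [flatten_of_pos (hz 0 hI0), flatten_of_pos (hz 1 hI1)]
    exact Or.inl ⟨NodeFlow.straighten_snd_pos hδ h0, NodeFlow.straighten_snd_pos hδ h1,
      (NodeFlow.label_eq_iff hδ h0 h1).1 (H.label_eq_of_tangent hΦ hU zero_le_one hc hz).symm⟩
  · rw [flatten_of_nonpos (hz 0 hI0).le, flatten_of_nonpos (hz 1 hI1).le]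
    exact Or.inr (Or.inl ⟨regularFlow_neg hδ.le hΨ hl _ _ (hz 0 hI0),
      H.drop_eq_of_tangent hΨ hl hU hU0 zero_le_one hc fun t ht => (hz t ht).le⟩)
  · rw [hz 0 hI0, hz 1 hI1, flatten_of_nonpos le_rfl, flatten_of_nonpos le_rfl,
      regularFlow_zero hδ.le hΨ hl, regularFlow_zero hδ.le hΨ hl]
    exact Or.inr (Or.inr ⟨rfl, rfl, hy⟩)

theorem hasDerivAt_segment (a b t : ℝ) : HasDerivAt (fun t => a + t * (b - a)) (b - a) t := by
  simpa using ((hasDerivAt_id t).mul_const (b - a)).const_add a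

theorem segment_le_max {a b t : ℝ} (ht : t ∈ Icc (0 : ℝ) 1) : a + t * (b - a) ≤ max a b := by
  nlinarith [ht.1, ht.2, le_max_left a b, le_max_right a b]

theorem abs_segment_lt {a b t δ : ℝ} (ht : t ∈ Icc (0 : ℝ) 1) (ha : |a| < δ) (hb : |b| < δ) :
    |a + t * (b - a)| < δ := by
  have h1 := segment_le_max (a := a) (b := b) ht
  have h2 := segment_le_max (a := -a) (b := -b) ht
  rw [abs_lt] at *
  have h3 : max a b < δ := max_lt ha.2 hb.2
  have h4 : max (-a) (-b) < δ := max_lt (by linarith) (by linarith)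
  constructor <;> linarith

/-- The two points are joined by the arc of their common leaf, with logarithmic height interpolated
linearly. Since the radius increases with height, the arc stays in the box that contains its upper
end. -/
theorem sameLeaf_upper (H : NodeRegularField L h g δ A K)
    (hΦ : NodeFlow (nodeSlope h δ A) Φ δ C M) {U : Set E2}
    (hU : ∀ y z, |y| < δ → 0 < z → A * z < δ → !₂[y, z] ∈ U) {y₁ z₁ y₂ z₂ : ℝ}
    (hy₁ : |y₁| < δ) (hz₁ : 0 < z₁) (hz₁' : A * z₁ < δ)
    (hy₂ : |y₂| < δ) (hz₂ : 0 < z₂) (hz₂' : A * z₂ < δ)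
    (hlab : NodeFlow.label Φ δ (y₁, A * z₁) = NodeFlow.label Φ δ (y₂, A * z₂)) :
    SameLeaf L U !₂[y₁, z₁] !₂[y₂, z₂] := by
  have hδ := H.δ_pos
  have hA : 0 < A := one_pos.trans_le H.one_le
  have hA₁ := mul_pos hA hz₁
  have hA₂ := mul_pos hA hz₂
  set s₁ := log (A * z₁) with hs₁
  set s₂ := log (A * z₂) with hs₂
  set k := NodeFlow.label Φ δ (y₁, A * z₁) with hk
  set Y := Φ (log δ) k with hY
  have hY₁ : Y s₁ = y₁ := by rw [hY, hk, hΦ.flow_label, hΦ.flow.init]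
  have hY₂ : Y s₂ = y₂ := by rw [hY, hlab, hΦ.flow_label, hΦ.flow.init]
  have he₁ : exp s₁ = A * z₁ := exp_log hA₁
  have he₂ : exp s₂ = A * z₂ := exp_log hA₂
  have hYd : ∀ s, HasDerivAt Y (nodeSlope h δ A (Y s) (exp s)) s := hΦ.flow.deriv _ _
  have hYc : Continuous Y := hΦ.flow.continuous _ _
  let σ : ℝ → ℝ := fun t => s₁ + t * (s₂ - s₁)
  have hσ : ∀ t, HasDerivAt σ (s₂ - s₁) t := hasDerivAt_segment s₁ s₂
  have hσc : Continuous σ := by fun_prop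
  have hcont : Continuous fun q : ℝ × ℝ => nodeSlope h δ A q.1 q.2 := by
    refine H.lip_h.continuousOn.comp_continuous (f := fun q : ℝ × ℝ => (clamp δ q.1, clamp δ (q.2 / A)))
      ?_ fun q => clamp_mem hδ.le _ _
    exact ((continuous_clamp δ).comp continuous_fst).prodMk
      ((continuous_clamp δ).comp (continuous_snd.div_const A))
  have key := sameLeaf_of_hasDerivAt (L := L) (U := U) (y := fun t => Y (σ t))
    (z := fun t => exp (σ t) / A)
    (y' := fun t => nodeSlope h δ A (Y (σ t)) (exp (σ t)) * (s₂ - s₁))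
    (z' := fun t => exp (σ t) * (s₂ - s₁) / A)
    (fun t => (hYd (σ t)).comp t (hσ t)) (fun t => ((hσ t).exp).div_const A)
    ((hcont.comp ((hYc.comp hσc).prodMk (continuous_exp.comp hσc))).mul continuous_const)
    (by fun_prop) ?_
  · have e0 : σ 0 = s₁ := by simp [σ]
    have e1 : σ 1 = s₂ := by simp [σ]
    simp only [e0, e1, hY₁, hY₂, he₁, he₂, mul_div_cancel_left₀ _ hA.ne'] at key
    exact key
  · intro t ht
    have hmax : max |Y (σ t)| (exp (σ t)) < δ := by
      have hσle : σ t ≤ max s₁ s₂ := segment_le_max ht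
      rcases max_choice s₁ s₂ with h1 | h1
      · rw [h1] at hσle
        refine (hΦ.radius_le (log δ) k hσle (by rw [he₁]; exact hz₁'.le)).trans_lt ?_
        rw [← hY, hY₁, he₁]
        exact max_lt hy₁ hz₁'
      · rw [h1] at hσle
        refine (hΦ.radius_le (log δ) k hσle (by rw [he₂]; exact hz₂'.le)).trans_lt ?_
        rw [← hY, hY₂, he₂]
        exact max_lt hy₂ hz₂'
    have h1 : |Y (σ t)| < δ := (le_max_left _ _).trans_lt hmax
    have h2 : exp (σ t) < δ := (le_max_right _ _).trans_lt hmax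
    have hpos : 0 < exp (σ t) / A := div_pos (exp_pos _) hA
    have h3 : |exp (σ t) / A| ≤ δ := by
      rw [abs_of_pos hpos]
      exact (div_le_self (exp_pos _).le H.one_le).trans h2.le
    refine ⟨hU _ _ h1 hpos (by rwa [mul_div_cancel₀ _ hA.ne']), ?_⟩
    rw [H.upper _ _ h1.le h3 hpos, mem_span_pair_iff]
    refine ⟨s₂ - s₁, ?_, by ring⟩
    rw [nodeSlope, clamp_of_abs_le h1.le, clamp_of_abs_le h3]
    ring

theorem sameLeaf_lower (H : NodeRegularField L h g δ A K)
    (hΨ : IsGlobalFlow (regularSlope g δ) Ψ) (hl : ∀ y, LipschitzWith M' (regularSlope g δ y))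
    {U : Set E2} {k : ℝ} (hk : k < 0) (hkΨ : ∀ y, |y| < δ → -δ < Ψ 0 k y)
    (hU : ∀ y, |y| < δ → !₂[y, Ψ 0 k y] ∈ U) {y₁ y₂ : ℝ} (hy₁ : |y₁| < δ) (hy₂ : |y₂| < δ) :
    SameLeaf L U !₂[y₁, Ψ 0 k y₁] !₂[y₂, Ψ 0 k y₂] := by
  have hδ := H.δ_pos
  have hcont : Continuous fun q : ℝ × ℝ => regularSlope g δ q.1 q.2 := by
    refine ((continuous_clamp δ).comp continuous_snd).mul (H.lip_g.continuousOn.comp_continuous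
      (f := fun q : ℝ × ℝ => (clamp δ q.1, clamp δ q.2)) ?_ fun q => clamp_mem hδ.le _ _)
    exact ((continuous_clamp δ).comp continuous_fst).prodMk
      ((continuous_clamp δ).comp continuous_snd)
  let σ : ℝ → ℝ := fun t => y₁ + t * (y₂ - y₁)
  have hσ : ∀ t, HasDerivAt σ (y₂ - y₁) t := hasDerivAt_segment y₁ y₂
  have hσc : Continuous σ := by fun_prop
  have key := sameLeaf_of_hasDerivAt (L := L) (U := U) (y := σ) (z := fun t => Ψ 0 k (σ t))
    (y' := fun _ => y₂ - y₁)
    (z' := fun t => regularSlope g δ (σ t) (Ψ 0 k (σ t)) * (y₂ - y₁))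
    hσ (fun t => (hΨ.deriv 0 k (σ t)).comp t (hσ t)) continuous_const
    ((hcont.comp (hσc.prodMk ((hΨ.continuous 0 k).comp hσc))).mul continuous_const) ?_
  · have e0 : σ 0 = y₁ := by simp [σ]
    have e1 : σ 1 = y₂ := by simp [σ]
    simp only [e0, e1] at key
    exact key
  · intro t ht
    have h1 : |σ t| < δ := abs_segment_lt ht hy₁ hy₂
    have hneg := regularFlow_neg hδ.le hΨ hl 0 (σ t) hk
    have h2 : |Ψ 0 k (σ t)| ≤ δ := by
      rw [abs_of_neg hneg]
      linarith [hkΨ _ h1]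
    refine ⟨hU _ h1, ?_⟩
    rw [H.lower _ _ h1.le h2 hneg.le (fun h0 => hneg.ne (Prod.mk_eq_zero.1 h0).2),
      mem_span_pair_iff]
    refine ⟨y₂ - y₁, by ring, ?_⟩
    rw [regularSlope, clamp_of_abs_le h1.le, clamp_of_abs_le h2]
    ring

theorem sameLeaf_axis (H : NodeRegularField L h g δ A K) {U : Set E2}
    (hU : ∀ y, |y| < δ → y ≠ 0 → !₂[y, 0] ∈ U) {y₁ y₂ : ℝ} (hy₁ : |y₁| < δ) (hy₂ : |y₂| < δ)
    (hy : 0 < y₁ * y₂) : SameLeaf L U !₂[y₁, 0] !₂[y₂, 0] := by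
  have hδ := H.δ_pos
  have key := sameLeaf_of_hasDerivAt (L := L) (U := U) (z := fun _ => 0)
    (hasDerivAt_segment y₁ y₂) (fun t => hasDerivAt_const t 0) continuous_const continuous_const ?_
  · simpa using key
  · intro t ht
    have h1 : |y₁ + t * (y₂ - y₁)| < δ := abs_segment_lt ht hy₁ hy₂
    have hne : y₁ + t * (y₂ - y₁) ≠ 0 := by
      intro h0
      have h4 : (1 - t) * (y₁ * y₂) + t * (y₂ * y₂) = 0 := by linear_combination y₂ * h0
      have h5 : (1 - t) * (y₁ * y₁) + t * (y₁ * y₂) = 0 := by linear_combination y₁ * h0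
      rcases ht.1.eq_or_lt with rfl | ht0
      · nlinarith
      · nlinarith [mul_pos ht0 hy, mul_nonneg (sub_nonneg.2 ht.2) (mul_self_nonneg y₁)]
    refine ⟨hU _ h1 hne, ?_⟩
    rw [H.lower _ _ h1.le (by simpa using hδ.le) le_rfl (fun h0 => hne (Prod.mk_eq_zero.1 h0).1),
      mem_span_pair_iff]
    exact ⟨y₂ - y₁, by ring, by ring⟩

/-- The foliation is locally homeomorphic to the model. -/
theorem exists_straightening (H : NodeRegularField L h g δ A K) :
    ∃ e : OpenPartialHomeomorph E2 E2, 0 ∈ e.source ∧ e 0 = 0 ∧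
      (∀ x ∈ e.source, SignType.sign (e x 1) = SignType.sign (x 1)) ∧
      ∀ x ∈ e.source \ {0}, ∀ x' ∈ e.source \ {0},
        SameLeaf L (e.source \ {0}) x x' ↔
          SameLeaf nodeRegularModel (e.target \ {0}) (e x) (e x') := by
  have hδ := H.δ_pos
  have hA : 0 < A := one_pos.trans_le H.one_le
  obtain ⟨Φ, C, M, hΦ⟩ := H.exists_nodeFlow
  obtain ⟨Ψ, C', M', hΨ, hb, hl⟩ := H.exists_regularFlow
  -- By Grönwall against the zero solution, a leaf that crosses `y = 0` above `-δ'` stays above `-δ`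
  -- while `|y| < δ`.
  set δ' := δ * exp (-(M' * δ)) with hδ'
  have hδ'0 : 0 < δ' := by positivity
  have hdrop : ∀ k, -δ' < k → k ≤ 0 → ∀ y, |y| < δ → -δ < Ψ 0 k y := by
    intro k hk hk0 y hy
    have h1 := hΨ.dist_le hl 0 k 0 y
    rw [regularFlow_zero hδ.le hΨ hl, sub_zero, sub_zero, sub_zero, abs_of_nonpos hk0] at h1
    have h2 : -k * exp (M' * |y|) < δ := by
      calc -k * exp (M' * |y|) ≤ -k * exp (M' * δ) := by
            gcongr
            linarith
        _ < δ' * exp (M' * δ) := by gcongr; linarith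
        _ = δ := by rw [hδ', mul_assoc, ← exp_add]; simp
    linarith [neg_abs_le (Ψ 0 k y)]
  let F : E2 → E2 := fun x =>
    !₂[(flatten Φ Ψ δ A (x 0, x 1)).1, (flatten Φ Ψ δ A (x 0, x 1)).2]
  have hcoord : ∀ i : Fin 2, Continuous fun x : E2 => x i := fun i =>
    (EuclideanSpace.proj (𝕜 := ℝ) i).continuous
  have hFc : Continuous F := by
    have := (H.continuous_flatten hΦ hΨ hb hl).comp ((hcoord 0).prodMk (hcoord 1))
    exact continuous_pair (continuous_fst.comp this) (continuous_snd.comp this)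
  have hF : ∀ x : E2, (F x 0, F x 1) = flatten Φ Ψ δ A (x 0, x 1) := fun x => rfl
  -- `S` is the part of the compact set `D` that is mapped onto the open rectangle `T`. The minimum
  -- with zero makes the last condition automatic above the axis, where only the box matters.
  let S : Set E2 := {x | |x 0| < δ ∧ A * x 1 < δ ∧ -δ < x 1 ∧ -δ' < Ψ (x 0) (min (x 1) 0) 0}
  let T : Set E2 := {x | |x 0| < δ ∧ -δ' < x 1 ∧ x 1 < δ}
  let D : Set E2 := {x | |x 0| ≤ δ ∧ A * x 1 ≤ δ ∧ -δ ≤ x 1}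
  have hDbox : ∀ x ∈ D, |x 0| ≤ δ ∧ |x 1| ≤ δ := by
    rintro x ⟨h1, h2, h3⟩
    refine ⟨h1, abs_le.2 ⟨h3, ?_⟩⟩
    rcases le_total (x 1) 0 with h0 | h0
    · linarith
    · nlinarith [H.one_le]
  have hDc : IsCompact D := by
    refine Metric.isCompact_of_isClosed_isBounded ?_ ?_
    · exact (isClosed_le (hcoord 0).abs continuous_const).inter
        ((isClosed_le (continuous_const.mul (hcoord 1)) continuous_const).inter
          (isClosed_le continuous_const (hcoord 1)))
    · refine isBounded_iff_forall_norm_le.2 ⟨δ + δ, fun x hx => ?_⟩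
      have := hDbox x hx
      rw [EuclideanSpace.norm_eq, Fin.sum_univ_two, Real.norm_eq_abs, Real.norm_eq_abs]
      refine Real.sqrt_le_iff.2 ⟨by linarith, ?_⟩
      nlinarith [abs_nonneg (x 0), abs_nonneg (x 1)]
  have hSD : S ⊆ D := fun x hx => ⟨hx.1.le, hx.2.1.le, hx.2.2.1.le⟩
  have hSo : IsOpen S := by
    rw [show S = {x | |x 0| < δ} ∩ ({x | A * x 1 < δ} ∩ ({x | -δ < x 1} ∩
      {x | -δ' < Ψ (x 0) (min (x 1) 0) 0})) from rfl]
    refine (isOpen_lt (hcoord 0).abs continuous_const).inter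
      ((isOpen_lt (continuous_const.mul (hcoord 1)) continuous_const).inter
        ((isOpen_lt continuous_const (hcoord 1)).inter (isOpen_lt continuous_const ?_)))
    exact (hΨ.continuous_initial hl hb 0).comp
      ((hcoord 0).prodMk ((hcoord 1).min continuous_const))
  have hTo : IsOpen T := (isOpen_lt (hcoord 0).abs continuous_const).inter
    ((isOpen_lt continuous_const (hcoord 1)).inter (isOpen_lt (hcoord 1) continuous_const))
  have hinj : InjOn F D := by
    intro x hx x' hx' heq
    have h1 : flatten Φ Ψ δ A (x 0, x 1) = flatten Φ Ψ δ A (x' 0, x' 1) := by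
      rw [← hF, ← hF, heq]
    have h2 := H.flatten_injOn hΦ hΨ hl (show (x 0, x 1) ∈ {q : ℝ × ℝ | A * q.2 ≤ δ} from hx.2.1)
      (show (x' 0, x' 1) ∈ {q : ℝ × ℝ | A * q.2 ≤ δ} from hx'.2.1) h1
    rw [Prod.mk.injEq] at h2
    rw [← eta_pair x, ← eta_pair x', h2.1, h2.2]
  have hST : F '' S = T := by
    ext w
    constructor
    · rintro ⟨x, ⟨h1, h2, h3, h4⟩, rfl⟩
      change |(flatten Φ Ψ δ A (x 0, x 1)).1| < δ ∧ -δ' < (flatten Φ Ψ δ A (x 0, x 1)).2 ∧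
        (flatten Φ Ψ δ A (x 0, x 1)).2 < δ
      rcases lt_or_ge 0 (x 1) with h0 | h0
      · have hA1 : 0 < A * x 1 := mul_pos hA h0
        rw [flatten_of_pos h0]
        have h5 := NodeFlow.max_straighten (Φ := Φ) hδ (q := (x 0, A * x 1)) hA1
        have h6 : max |x 0| (A * x 1) < δ := max_lt h1 h2
        rw [← h5] at h6
        have h7 := NodeFlow.straighten_snd_pos (Φ := Φ) hδ (q := (x 0, A * x 1)) hA1
        exact ⟨(le_max_left _ _).trans_lt h6, by linarith, (le_max_right _ _).trans_lt h6⟩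
      · rw [flatten_of_nonpos h0]
        rw [min_eq_left h0] at h4
        exact ⟨h1, h4, (regularFlow_nonpos hδ.le hΨ hl _ _ h0).trans_lt hδ⟩
    · rintro ⟨h1, h2, h3⟩
      rcases lt_or_ge 0 (w 1) with h0 | h0
      · obtain ⟨q, hq0, hqδ, hq⟩ := hΦ.straighten_surj h0 (max_lt h1 h3).le
        have hm := NodeFlow.max_straighten (Φ := Φ) hδ hq0
        rw [hq] at hm
        have hm' : max |q.1| q.2 < δ := by rw [← hm]; exact max_lt h1 h3
        have hq0' : 0 < q.2 / A := div_pos hq0 hA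
        refine ⟨!₂[q.1, q.2 / A], ⟨(le_max_left _ _).trans_lt hm', ?_, ?_, ?_⟩, ?_⟩
        · change A * (q.2 / A) < δ
          rw [mul_div_cancel₀ _ hA.ne']
          exact (le_max_right _ _).trans_lt hm'
        · change -δ < q.2 / A
          linarith
        · change -δ' < Ψ q.1 (min (q.2 / A) 0) 0
          rw [min_eq_right hq0'.le, regularFlow_zero hδ.le hΨ hl]
          linarith
        · rw [← eta_pair w]
          change (!₂[(flatten Φ Ψ δ A (q.1, q.2 / A)).1, (flatten Φ Ψ δ A (q.1, q.2 / A)).2] : E2) = _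
          rw [flatten_of_pos hq0']
          simp only
          rw [mul_div_cancel₀ _ hA.ne', hq]
      · have hn := regularFlow_nonpos hδ.le hΨ hl 0 (w 0) h0
        have hback : Ψ (w 0) (Ψ 0 (w 1) (w 0)) 0 = w 1 := by rw [hΨ.flow_flow hl, hΨ.init]
        refine ⟨!₂[w 0, Ψ 0 (w 1) (w 0)], ⟨h1, ?_, hdrop _ h2 h0 _ h1, ?_⟩, ?_⟩
        · change A * Ψ 0 (w 1) (w 0) < δ
          nlinarith
        · change -δ' < Ψ (w 0) (min (Ψ 0 (w 1) (w 0)) 0) 0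
          rw [min_eq_left hn, hback]
          exact h2
        · rw [← eta_pair w]
          change (!₂[(flatten Φ Ψ δ A (w 0, Ψ 0 (w 1) (w 0))).1,
            (flatten Φ Ψ δ A (w 0, Ψ 0 (w 1) (w 0))).2] : E2) = _
          rw [flatten_of_nonpos hn]
          simp only
          rw [hback]
  have hTc : Convex ℝ T := by
    have hlin : ∀ i : Fin 2, IsLinearMap ℝ fun x : E2 => x i := fun i =>
      (EuclideanSpace.proj (𝕜 := ℝ) i).toLinearMap.isLinear
    have hT' : T = {x : E2 | x 0 < δ} ∩ {x | -δ < x 0} ∩ ({x | -δ' < x 1} ∩ {x | x 1 < δ}) := by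
      ext x
      simp only [T, mem_ofPred_eq, mem_inter_iff, abs_lt]
      tauto
    rw [hT']
    exact ((convex_halfSpace_lt (hlin 0) _).inter (convex_halfSpace_gt (hlin 0) _)).inter
      ((convex_halfSpace_gt (hlin 1) _).inter (convex_halfSpace_lt (hlin 1) _))
  obtain ⟨e, hes, het, heF⟩ :=
    exists_openPartialHomeomorph_of_isCompact hDc hFc.continuousOn hinj hSo hTo hSD hST
  have hcoe : ∀ x, (e x 0, e x 1) = flatten Φ Ψ δ A (x 0, x 1) := fun x => by rw [heF, hF]
  have hsgn : ∀ x, SignType.sign (e x 1) = SignType.sign (x 1) := fun x => by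
    rw [← H.sign_flatten hΨ hl (Φ := Φ) (x 0, x 1), ← hcoe]
  have hS0 : (0 : E2) ∈ S := by
    change |(0 : ℝ)| < δ ∧ A * 0 < δ ∧ -δ < 0 ∧ -δ' < Ψ 0 (min 0 0) 0
    rw [min_self, hΨ.init]
    simp [hδ, hδ'0]
  refine ⟨e, hes.symm ▸ hS0, ?_, fun x _ => hsgn x, ?_⟩
  · have h1 := hcoe 0
    rw [flatten_of_nonpos (by simp), Prod.mk.injEq] at h1
    rw [← eta_pair (e 0), h1.1, h1.2]
    simp only [PiLp.zero_apply]
    rw [hΨ.init, pair_eq_zero_iff]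
    exact ⟨rfl, rfl⟩
  rw [hes, het]
  intro x hx x' hx'
  have hxT : ∀ x ∈ S, e x ∈ T := fun x hx => by
    rw [← hST, heF]; exact mem_image_of_mem F hx
  constructor
  · intro hleaf
    refine sameLeaf_of_sameModelLeaf hTc (hxT x hx.1) (hxT x' hx'.1) ?_
    rw [hcoe, hcoe]
    exact H.sameModelLeaf_of_sameLeaf hΦ hΨ hb hl (fun x hx => hDbox x (hSD hx.1))
      (fun h0 => h0.2 rfl) hleaf
  · intro hleaf
    have hmod := _root_.sameModelLeaf_of_sameLeaf (fun h0 => h0.2 rfl) hleaf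
    obtain ⟨⟨hx1, hx2, hx3, hx4⟩, hx0⟩ := hx
    obtain ⟨⟨hx1', hx2', hx3', hx4'⟩, hx0'⟩ := hx'
    have hs := hsgn x
    have hs' := hsgn x'
    rw [← eta_pair x, ← eta_pair x']
    rcases hmod with ⟨h1, h2, h3⟩ | ⟨h1, h2⟩ | ⟨h1, h2, h3⟩
    · simp only at h1 h2
      rw [sign_pos h1, eq_comm, sign_eq_one_iff] at hs
      rw [sign_pos h2, eq_comm, sign_eq_one_iff] at hs'
      rw [hcoe, hcoe, flatten_of_pos hs, flatten_of_pos hs'] at h3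
      refine H.sameLeaf_upper hΦ ?_ hx1 hs hx2 hx1' hs' hx2'
        ((NodeFlow.label_eq_iff hδ (mul_pos hA hs) (mul_pos hA hs')).2 h3)
      intro y z hy hz hz'
      refine ⟨⟨hy, hz', by change -δ < z; linarith, ?_⟩, fun h0 => ?_⟩
      · change -δ' < Ψ y (min z 0) 0
        rw [min_eq_right hz.le, regularFlow_zero hδ.le hΨ hl]
        linarith
      · exact hz.ne' (pair_eq_zero_iff.1 h0).2
    · simp only at h1 h2
      have h2' : e x' 1 < 0 := h2 ▸ h1
      rw [sign_neg h1, eq_comm, sign_eq_neg_one_iff] at hs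
      rw [sign_neg h2', eq_comm, sign_eq_neg_one_iff] at hs'
      have hc := hcoe x
      have hc' := hcoe x'
      rw [flatten_of_nonpos hs.le, Prod.mk.injEq] at hc
      rw [flatten_of_nonpos hs'.le, Prod.mk.injEq] at hc'
      simp only at hc hc'
      rw [min_eq_left hs.le, ← hc.2] at hx4
      have e1 : Ψ 0 (e x 1) (x 0) = x 1 := by rw [hc.2, hΨ.flow_flow hl, hΨ.init]
      have e2 : Ψ 0 (e x 1) (x' 0) = x' 1 := by rw [← h2, hc'.2, hΨ.flow_flow hl, hΨ.init]
      have key := H.sameLeaf_lower hΨ hl (U := S \ {0}) h1 (hdrop _ hx4 h1.le) ?_ hx1 hx1'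
      · rwa [e1, e2] at key
      · intro y hy
        have hn := regularFlow_neg hδ.le hΨ hl 0 y h1
        refine ⟨⟨hy, ?_, hdrop _ hx4 h1.le y hy, ?_⟩, fun h0 => ?_⟩
        · change A * Ψ 0 (e x 1) y < δ
          nlinarith
        · change -δ' < Ψ y (min (Ψ 0 (e x 1) y) 0) 0
          rw [min_eq_left hn.le, hΨ.flow_flow hl, hΨ.init]
          exact hx4
        · exact hn.ne (pair_eq_zero_iff.1 h0).2
    · simp only at h1 h2 h3
      rw [h1, _root_.sign_zero, eq_comm, _root_.sign_eq_zero_iff] at hs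
      rw [h2, _root_.sign_zero, eq_comm, _root_.sign_eq_zero_iff] at hs'
      have hc := hcoe x
      have hc' := hcoe x'
      rw [flatten_of_nonpos hs.le, Prod.mk.injEq] at hc
      rw [flatten_of_nonpos hs'.le, Prod.mk.injEq] at hc'
      rw [hc.1, hc'.1] at h3
      rw [hs, hs']
      refine H.sameLeaf_axis ?_ hx1 hx1' h3
      intro y hy hy0
      refine ⟨⟨hy, ?_, ?_, ?_⟩, fun h0 => hy0 (pair_eq_zero_iff.1 h0).1⟩
      · change A * 0 < δ
        simpa using hδ
      · change -δ < 0
        linarith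
      · change -δ' < Ψ y (min 0 0) 0
        rw [min_self, regularFlow_zero hδ.le hΨ hl]
        linarith

end NodeRegularField

/-! ### The Poincaré index -/

/-- A continuous function that is the identity on `[0, π]`, constant on `[π, 2π]` and increases by
`π` over each period. -/
def halfTurn (t : ℝ) : ℝ := t / 2 + arccos (cos t) / 2

theorem continuous_halfTurn : Continuous halfTurn := by
  unfold halfTurn
  exact (continuous_id.div_const 2).add ((continuous_arccos.comp continuous_cos).div_const 2)

theorem halfTurn_add_two_pi (t : ℝ) : halfTurn (t + 2 * π) = halfTurn t + π := by
  rw [halfTurn, halfTurn, cos_add_two_pi]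
  ring

theorem exists_halfTurn_eq_of_sin_pos {t : ℝ} (ht : 0 < sin t) :
    ∃ k : ℤ, halfTurn t = t + k * π := by
  set k : ℤ := ⌊t / (2 * π)⌋ with hk
  have h2 : 0 < 2 * π := by positivity
  have hl : 0 ≤ t - k * (2 * π) := by
    have := Int.floor_le (t / (2 * π))
    rw [← hk, le_div_iff₀ h2] at this
    linarith
  have hu : t - k * (2 * π) < 2 * π := by
    have := Int.lt_floor_add_one (t / (2 * π))
    rw [← hk, div_lt_iff₀ h2] at this
    linarith
  have hπ : t - k * (2 * π) ≤ π := by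
    by_contra! hcon
    have := sin_neg_of_neg_of_neg_pi_lt (x := t - k * (2 * π) - 2 * π) (by linarith) (by linarith)
    rw [sin_sub_two_pi, sin_sub_int_mul_two_pi] at this
    linarith
  refine ⟨-k, ?_⟩
  rw [halfTurn, ← cos_sub_int_mul_two_pi t k, arccos_cos hl hπ]
  push_cast
  ring

theorem exists_halfTurn_eq_of_sin_nonpos {t : ℝ} (ht : sin t ≤ 0) :
    ∃ k : ℤ, halfTurn t = k * π := by
  set k : ℤ := ⌊t / (2 * π)⌋ with hk
  have h2 : 0 < 2 * π := by positivity
  have hl : 0 ≤ t - k * (2 * π) := by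
    have := Int.floor_le (t / (2 * π))
    rw [← hk, le_div_iff₀ h2] at this
    linarith
  have hu : t - k * (2 * π) < 2 * π := by
    have := Int.lt_floor_add_one (t / (2 * π))
    rw [← hk, div_lt_iff₀ h2] at this
    linarith
  rcases lt_or_ge (t - k * (2 * π)) π with hπ | hπ
  · have h0 : t - k * (2 * π) = 0 := by
      by_contra hne
      have := sin_pos_of_pos_of_lt_pi (lt_of_le_of_ne hl (Ne.symm hne)) hπ
      rw [sin_sub_int_mul_two_pi] at this
      linarith
    refine ⟨k, ?_⟩
    rw [halfTurn, ← cos_sub_int_mul_two_pi t k, h0, cos_zero, arccos_one]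
    linarith
  · refine ⟨k + 1, ?_⟩
    rw [halfTurn, ← cos_sub_int_mul_two_pi t k, ← cos_two_pi_sub (t - k * (2 * π)),
      arccos_cos (by linarith) (by linarith)]
    push_cast
    ring

theorem span_smul_pair {c a b : ℝ} (hc : c ≠ 0) :
    (Submodule.span ℝ {(!₂[c * a, c * b] : E2)} : Set E2) = Submodule.span ℝ {(!₂[a, b] : E2)} := by
  have : (!₂[c * a, c * b] : E2) = c • !₂[a, b] := by
    ext i
    fin_cases i <;> rfl
  rw [this, Submodule.span_singleton_smul_eq (isUnit_iff_ne_zero.2 hc)]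

theorem continuousOn_of_halves {f : ℝ × ℝ → ℝ} {P : Set (ℝ × ℝ)}
    (h1 : ContinuousOn f (P ∩ {q | 0 ≤ q.2})) (h2 : ContinuousOn f (P ∩ {q | q.2 ≤ 0})) :
    ContinuousOn f P := by
  have c1 : IsClosed {q : ℝ × ℝ | 0 ≤ q.2} := isClosed_le continuous_const continuous_snd
  have c2 : IsClosed {q : ℝ × ℝ | q.2 ≤ 0} := isClosed_le continuous_snd continuous_const
  have key : ∀ Z : Set (ℝ × ℝ), IsClosed Z → ContinuousOn f (P ∩ Z) → ∀ q ∈ P,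
      ContinuousWithinAt f (P ∩ Z) q := by
    intro Z hZ h q hq
    by_cases hqZ : q ∈ Z
    · exact h q ⟨hq, hqZ⟩
    · exact continuousWithinAt_of_notMem_closure fun hc =>
        hqZ (closure_minimal inter_subset_right hZ hc)
  intro q hq
  have := (key _ c1 h1 q hq).union (key _ c2 h2 q hq)
  refine this.mono fun x hx => ?_
  rcases le_total 0 x.2 with h | h
  · exact Or.inl ⟨hx, h⟩
  · exact Or.inr ⟨hx, h⟩

namespace NodeRegularField

variable {L : E2 → Set E2} {h g : ℝ × ℝ → ℝ} {δ A : ℝ} {K : NNReal}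

/-- The angle of the field relative to the radial direction on the upper side, and relative to the
axis on the lower side. -/
def relAngle (h g : ℝ × ℝ → ℝ) (q : ℝ × ℝ) : ℝ :=
  if 0 < q.2 then Complex.arg (⟨h q, q.2⟩ * ⟨q.1, -q.2⟩) else arctan (q.2 * g q)

/-- The complex number is `h + i z` times the conjugate of `y + i z`. For `z > 0` the two vectors
have the same positive second component, so they are never opposite and the product avoids the cut
of `arg`. On the punctured axis `y h > 0`, so the argument is zero and agrees with `arctan 0`. -/
theorem continuousOn_relAngle (H : NodeRegularField L h g δ A K) :
    ContinuousOn (relAngle h g) {q | q ≠ 0 ∧ |q.1| ≤ δ ∧ |q.2| ≤ δ} := by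
  have hsub : {q : ℝ × ℝ | q ≠ 0 ∧ |q.1| ≤ δ ∧ |q.2| ≤ δ} ⊆ Icc (-δ) δ ×ˢ Icc (-δ) δ :=
    fun q hq => ⟨abs_le.1 hq.2.1, abs_le.1 hq.2.2⟩
  have hh := H.lip_h.continuousOn.mono hsub
  have hg := H.lip_g.continuousOn.mono hsub
  refine continuousOn_of_halves ?_ ?_
  · have h1 : ContinuousOn (fun q : ℝ × ℝ => Complex.arg (⟨h q, q.2⟩ * ⟨q.1, -q.2⟩))
        ({q | q ≠ 0 ∧ |q.1| ≤ δ ∧ |q.2| ≤ δ} ∩ {q | 0 ≤ q.2}) := by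
      have hc : ContinuousOn (fun q : ℝ × ℝ => ((h q : ℂ) + q.2 * Complex.I) *
          (q.1 - q.2 * Complex.I)) {q | q ≠ 0 ∧ |q.1| ≤ δ ∧ |q.2| ≤ δ} := by
        have := Complex.continuous_ofReal.comp_continuousOn hh
        refine ContinuousOn.mul (ContinuousOn.add this ?_) ?_
        · fun_prop
        · fun_prop
      have he : ∀ q : ℝ × ℝ, (⟨h q, q.2⟩ * ⟨q.1, -q.2⟩ : ℂ) = ((h q : ℂ) + q.2 * Complex.I) *
          (q.1 - q.2 * Complex.I) := by
        intro q
        congr 1 <;> apply Complex.ext <;> simp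
      intro q hq
      refine ContinuousAt.comp_continuousWithinAt (g := Complex.arg)
        (f := fun q : ℝ × ℝ => (⟨h q, q.2⟩ * ⟨q.1, -q.2⟩ : ℂ)) ?_ ?_
      · refine Complex.continuousAt_arg ?_
        obtain ⟨⟨hq0, hq1, hq2⟩, hq3⟩ := hq
        rw [Complex.mem_slitPlane_iff]
        simp only [Complex.mul_re, Complex.mul_im]
        rcases (show 0 ≤ q.2 from hq3).eq_or_lt with h0 | h0
        · left
          have hne : q.1 ≠ 0 := fun h1 => hq0 (Prod.ext h1 h0.symm)
          have := H.outward q.1 q.2 hq1 hq2 hq3 (by rw [← h0]; simp) hne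
          rw [← h0] at this ⊢
          have e : h q = h (q.1, 0) := by rw [h0]
          rw [e]
          linarith
        · by_cases hy : q.1 = h q
          · left
            rw [hy]
            nlinarith [mul_self_nonneg (h q), mul_pos h0 h0]
          · right
            intro hcon
            have : q.2 * (q.1 - h q) = 0 := by linarith
            rcases mul_eq_zero.1 this with h1 | h1
            · exact h0.ne' h1
            · exact hy (by linarith)
      · simp_rw [he]
        exact (hc q hq.1).mono inter_subset_left
    refine h1.congr fun q hq => ?_
    rcases (show 0 ≤ q.2 from hq.2).eq_or_lt with h0 | h0
    · have hne : q.1 ≠ 0 := fun h1 => hq.1.1 (Prod.ext h1 h0.symm)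
      have hpos : 0 < q.1 * h q :=
        H.outward q.1 q.2 hq.1.2.1 hq.1.2.2 hq.2 (by rw [← h0]; simp) hne
      change _ = Complex.arg (⟨h q, q.2⟩ * ⟨q.1, -q.2⟩)
      rw [relAngle, if_neg (by rw [← h0]; simp)]
      have e : (⟨h q, q.2⟩ * ⟨q.1, -q.2⟩ : ℂ) = ((q.1 * h q : ℝ) : ℂ) := by
        apply Complex.ext <;> simp [← h0, mul_comm]
      rw [e, Complex.arg_ofReal_of_nonneg hpos.le, ← h0, zero_mul, arctan_zero]
    · rw [relAngle, if_pos h0]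
  · have h2 : ContinuousOn (fun q : ℝ × ℝ => arctan (q.2 * g q))
        {q | q ≠ 0 ∧ |q.1| ≤ δ ∧ |q.2| ≤ δ} :=
      continuous_arctan.comp_continuousOn (continuousOn_snd.mul hg)
    refine (h2.mono inter_subset_left).congr fun q hq => ?_
    rw [relAngle, if_neg (not_lt.2 hq.2)]

/-- The radial vector has angle `t` and the field makes the angle `relAngle` with it, so their sum
is the angle of `(h, z)`. The multiple of `π` by which `halfTurn t` differs from `t` only changes
the sign of the spanning vector. -/
theorem span_upper (H : NodeRegularField L h g δ A K) {r t : ℝ} (hr : 0 < r) (hrδ : r ≤ δ)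
    (ht : 0 < sin t) :
    L !₂[r * cos t, r * sin t] = (Submodule.span ℝ
      {(!₂[cos (halfTurn t + relAngle h g (r * cos t, r * sin t)),
        sin (halfTurn t + relAngle h g (r * cos t, r * sin t))] : E2)} : Set E2) := by
  obtain ⟨k, hk⟩ := exists_halfTurn_eq_of_sin_pos ht
  have hz : 0 < r * sin t := mul_pos hr ht
  have hc : |r * cos t| ≤ δ := by
    rw [abs_mul, abs_of_pos hr]; nlinarith [abs_cos_le_one t]
  have hs : |r * sin t| ≤ δ := by
    rw [abs_mul, abs_of_pos hr]; nlinarith [abs_sin_le_one t]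
  rw [H.upper _ _ hc hs hz, relAngle, if_pos hz, hk]
  simp only
  set a := h (r * cos t, r * sin t)
  set w : ℂ := ⟨a, r * sin t⟩ with hw
  set u : ℂ := ⟨r * cos t, -(r * sin t)⟩ with hu
  set D := Complex.arg (w * u)
  have hw0 : w ≠ 0 := fun h0 => hz.ne' (congrArg Complex.im h0)
  have hwn : 0 < ‖w‖ := norm_pos_iff.2 hw0
  have hun : ‖u‖ = r := by
    have : u = r * Complex.exp ((-t : ℝ) * Complex.I) := by
      rw [Complex.exp_mul_I, ← Complex.ofReal_cos, ← Complex.ofReal_sin, hu]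
      apply Complex.ext
      · simp only [Complex.mul_re, Complex.add_re, Complex.mul_im, Complex.add_im,
          Complex.ofReal_re, Complex.ofReal_im, Complex.I_re, Complex.I_im, cos_neg]
        ring
      · simp only [Complex.mul_re, Complex.add_re, Complex.mul_im, Complex.add_im,
          Complex.ofReal_re, Complex.ofReal_im, Complex.I_re, Complex.I_im, sin_neg]
        ring
    rw [this, norm_mul, Complex.norm_exp_ofReal_mul_I, mul_one, Complex.norm_real,
      Real.norm_of_nonneg hr.le]
  have hre : ‖w‖ * cos D = a * cos t + r * sin t * sin t := by
    have h1 := Complex.norm_mul_cos_arg (w * u)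
    rw [norm_mul, hun, Complex.mul_re] at h1
    simp only [hw, hu] at h1
    have : r * (‖w‖ * cos D) = r * (a * cos t + r * sin t * sin t) := by linarith
    exact mul_left_cancel₀ hr.ne' this
  have him : ‖w‖ * sin D = -(a * sin t) + r * sin t * cos t := by
    have h1 := Complex.norm_mul_sin_arg (w * u)
    rw [norm_mul, hun, Complex.mul_im] at h1
    simp only [hw, hu] at h1
    have : r * (‖w‖ * sin D) = r * (-(a * sin t) + r * sin t * cos t) := by linarith
    exact mul_left_cancel₀ hr.ne' this
  have ha : a = ‖w‖ * (-1) ^ k * cos (t + k * π + D) := by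
    have hk2 : ((-1 : ℝ) ^ k) * (-1) ^ k = 1 := by
      rw [← mul_zpow]; simp
    rw [show t + k * π + D = (t + D) + k * π by ring, cos_add_int_mul_pi, cos_add]
    linear_combination (-(cos t)) * hre + sin t * him -
      (‖w‖ * (cos t * cos D - sin t * sin D)) * hk2 - a * (sin_sq_add_cos_sq t)
  have hb : r * sin t = ‖w‖ * (-1) ^ k * sin (t + k * π + D) := by
    have hk2 : ((-1 : ℝ) ^ k) * (-1) ^ k = 1 := by
      rw [← mul_zpow]; simp
    rw [show t + k * π + D = (t + D) + k * π by ring, sin_add_int_mul_pi, sin_add]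
    linear_combination (-(sin t)) * hre - cos t * him -
      (‖w‖ * (sin t * cos D + cos t * sin D)) * hk2 - r * sin t * (sin_sq_add_cos_sq t)
  conv_lhs => rw [ha, hb]
  exact span_smul_pair (mul_ne_zero hwn.ne' (zpow_ne_zero _ (by norm_num)))

theorem span_lower (H : NodeRegularField L h g δ A K) {r t : ℝ} (hr : 0 < r) (hrδ : r ≤ δ)
    (ht : sin t ≤ 0) :
    L !₂[r * cos t, r * sin t] = (Submodule.span ℝ
      {(!₂[cos (halfTurn t + relAngle h g (r * cos t, r * sin t)),
        sin (halfTurn t + relAngle h g (r * cos t, r * sin t))] : E2)} : Set E2) := by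
  obtain ⟨k, hk⟩ := exists_halfTurn_eq_of_sin_nonpos ht
  have hz : r * sin t ≤ 0 := by nlinarith
  have hc : |r * cos t| ≤ δ := by
    rw [abs_mul, abs_of_pos hr]; nlinarith [abs_cos_le_one t]
  have hs : |r * sin t| ≤ δ := by
    rw [abs_mul, abs_of_pos hr]; nlinarith [abs_sin_le_one t]
  have hne : (r * cos t, r * sin t) ≠ 0 := by
    intro h0
    rw [Prod.mk_eq_zero, mul_eq_zero, mul_eq_zero] at h0
    have := sin_sq_add_cos_sq t
    rw [h0.1.resolve_left hr.ne', h0.2.resolve_left hr.ne'] at this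
    norm_num at this
  rw [H.lower _ _ hc hs hz hne, relAngle, if_neg (not_lt.2 hz), hk]
  simp only
  set x := r * sin t * g (r * cos t, r * sin t)
  have hpos := cos_arctan_pos x
  have h1 : cos (k * π + arctan x) = ((-1) ^ k * cos (arctan x)) * 1 := by
    rw [add_comm, cos_add_int_mul_pi, mul_one]
  have h2 : sin (k * π + arctan x) = ((-1) ^ k * cos (arctan x)) * x := by
    rw [add_comm, sin_add_int_mul_pi, sin_arctan, cos_arctan]
    ring
  rw [h1, h2]
  exact (span_smul_pair (mul_ne_zero (zpow_ne_zero _ (by norm_num)) hpos.ne')).symm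

/-- The relative angle depends only on the point, hence is periodic; the whole increase `π` over a
turn comes from `halfTurn`. -/
theorem hasPlanarIndex (H : NodeRegularField L h g δ A K) : HasPlanarIndex L (1 / 2) := by
  refine ⟨δ, H.δ_pos, fun q => halfTurn q.2 + relAngle h g (q.1 * cos q.2, q.1 * sin q.2),
    ?_, fun r hr t => ⟨?_, ?_⟩⟩
  · refine (continuous_halfTurn.comp continuous_snd).continuousOn.add
      (H.continuousOn_relAngle.comp (f := fun q : ℝ × ℝ => (q.1 * cos q.2, q.1 * sin q.2))
        (by fun_prop) ?_)
    rintro ⟨r, t⟩ ⟨⟨hr, hrδ⟩, -⟩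
    simp only at hr hrδ
    refine ⟨?_, ?_, ?_⟩
    · intro h0
      rw [Prod.mk_eq_zero, mul_eq_zero, mul_eq_zero] at h0
      have := sin_sq_add_cos_sq t
      rw [h0.1.resolve_left hr.ne', h0.2.resolve_left hr.ne'] at this
      norm_num at this
    · simp only [abs_mul, abs_of_pos hr]; nlinarith [abs_cos_le_one t]
    · simp only [abs_mul, abs_of_pos hr]; nlinarith [abs_sin_le_one t]
  · rcases lt_or_ge 0 (sin t) with h0 | h0
    · exact H.span_upper hr.1 hr.2.le h0
    · exact H.span_lower hr.1 hr.2.le h0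
  · simp only [halfTurn_add_two_pi, cos_add_two_pi, sin_add_two_pi]
    ring

end NodeRegularField

/-- The rotation of the plane with cosine `c` and sine `s`. -/
def planeRotation (c s : ℝ) (x : E2) : E2 := !₂[c * x 0 - s * x 1, s * x 0 + c * x 1]

/-- A rotation by `φ` shifts the polar angle by `φ` and the angle of the field by `-φ`; neither
affects the increase over a turn. -/
theorem HasPlanarIndex.rotate {L : E2 → Set E2} {i : ℝ} (hL : HasPlanarIndex L i) {c s : ℝ}
    (hcs : c ^ 2 + s ^ 2 = 1) :
    HasPlanarIndex (fun x => {ξ | planeRotation c s ξ ∈ L (planeRotation c s x)}) i := by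
  obtain ⟨φ, rfl, rfl⟩ : ∃ φ : ℝ, c = cos φ ∧ s = sin φ := by
    have hn : ‖(⟨c, s⟩ : ℂ)‖ = 1 := by
      rw [Complex.norm_def, Complex.normSq_mk, Real.sqrt_eq_one]; linarith
    refine ⟨Complex.arg ⟨c, s⟩, ?_, ?_⟩
    · have := Complex.norm_mul_cos_arg ⟨c, s⟩
      rw [hn, one_mul] at this
      exact this.symm
    · have := Complex.norm_mul_sin_arg ⟨c, s⟩
      rw [hn, one_mul] at this
      exact this.symm
  obtain ⟨r₀, hr₀, θ, hθ, h⟩ := hL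
  refine ⟨r₀, hr₀, fun q => θ (q.1, q.2 + φ) - φ, ?_, fun r hr t => ⟨?_, ?_⟩⟩
  · refine ContinuousOn.sub (hθ.comp (f := fun q : ℝ × ℝ => (q.1, q.2 + φ)) (by fun_prop) ?_)
      continuousOn_const
    exact fun q hq => ⟨hq.1, trivial⟩
  · have hrot : ∀ ρ τ : ℝ, planeRotation (cos φ) (sin φ) !₂[ρ * cos τ, ρ * sin τ] =
        !₂[ρ * cos (τ + φ), ρ * sin (τ + φ)] := by
      intro ρ τ
      rw [cos_add, sin_add]
      ext i
      fin_cases i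
      · change cos φ * (ρ * cos τ) - sin φ * (ρ * sin τ) = ρ * (cos τ * cos φ - sin τ * sin φ)
        ring
      · change sin φ * (ρ * cos τ) + cos φ * (ρ * sin τ) = ρ * (sin τ * cos φ + cos τ * sin φ)
        ring
    change {ξ | planeRotation (cos φ) (sin φ) ξ ∈
      L (planeRotation (cos φ) (sin φ) !₂[r * cos t, r * sin t])} =
      (Submodule.span ℝ {(!₂[cos (θ (r, t + φ) - φ), sin (θ (r, t + φ) - φ)] : E2)} : Set E2)
    rw [hrot, (h r hr (t + φ)).1]
    set ψ := θ (r, t + φ)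
    ext ξ
    rw [← eta_pair ξ]
    rw [mem_span_pair_iff]
    change (!₂[cos φ * ξ 0 - sin φ * ξ 1, sin φ * ξ 0 + cos φ * ξ 1] : E2) ∈
      (Submodule.span ℝ {(!₂[cos ψ, sin ψ] : E2)} : Set E2) ↔ _
    rw [mem_span_pair_iff]
    refine exists_congr fun m => ?_
    rw [cos_sub, sin_sub]
    have hφ := sin_sq_add_cos_sq φ
    constructor
    · rintro ⟨h1, h2⟩
      constructor
      · linear_combination cos φ * h1 + sin φ * h2 - ξ 0 * hφ
      · linear_combination -sin φ * h1 + cos φ * h2 - ξ 1 * hφ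
    · rintro ⟨h1, h2⟩
      constructor
      · linear_combination cos φ * h1 - sin φ * h2 + m * cos ψ * hφ
      · linear_combination sin φ * h1 + cos φ * h2 + m * sin ψ * hφ
  · have := (h r hr (t + φ)).2
    simp only
    rw [show t + 2 * π + φ = t + φ + 2 * π by ring, this]
    ring

/-! ### Null lines of the form and its local normal form -/

/-- The null vectors `ξ` of the form `Q = z² N dy² - 2 z b dy dz + γ dz²` at which `Q` does not
decrease when `ξ` is turned in the positive sense. -/
def formLines (N b γ z : ℝ) : Set E2 :=
  {ξ | z ^ 2 * N * ξ 0 ^ 2 - 2 * (z * b) * (ξ 0 * ξ 1) + γ * ξ 1 ^ 2 = 0 ∧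
    0 ≤ -(z ^ 2 * N * (ξ 0 * ξ 1)) - z * b * (ξ 0 ^ 2 - ξ 1 ^ 2) + γ * (ξ 0 * ξ 1)}

section formLines

variable {N b γ R z : ℝ}

/-- The usual factorization, normalized by dividing by `b + R`, which is positive, and not by `N` or
`γ`, which may vanish at the singular point. -/
theorem form_factor (hR : R ^ 2 = b ^ 2 - N * γ) (hbR : 0 < b + R) (d e : ℝ) :
    z ^ 2 * N * d ^ 2 - 2 * (z * b) * (d * e) + γ * e ^ 2 =
      (z * d - γ / (b + R) * e) * (z * N * d - (b + R) * e) := by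
  field_simp
  linear_combination (z * d * e) * hR

/-- On the null line of `(h, z)` the turning expression is `R z` times a nonnegative quantity, on
the other null line it is `-R z` times one. The sign of `z` therefore decides which line is
selected. -/
theorem formLines_of_pos (hR : R ^ 2 = b ^ 2 - N * γ) (hR0 : 0 < R) (hbR : 0 < b + R) (hz : 0 < z) :
    formLines N b γ z = (Submodule.span ℝ {(!₂[γ / (b + R), z] : E2)} : Set E2) := by
  set h := γ / (b + R) with hh
  have hγ : γ = h * (b + R) := by rw [hh, div_mul_cancel₀ _ hbR.ne']
  have hNh : N * h = b - R := by
    have : (b + R) * (N * h) = (b + R) * (b - R) := by rw [hγ] at hR; linarith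
    exact mul_left_cancel₀ hbR.ne' this
  ext ξ
  rw [← eta_pair ξ, mem_span_pair_iff]
  set d := ξ 0
  set e := ξ 1
  change (z ^ 2 * N * d ^ 2 - 2 * (z * b) * (d * e) + γ * e ^ 2 = 0 ∧
    0 ≤ -(z ^ 2 * N * (d * e)) - z * b * (d ^ 2 - e ^ 2) + γ * (d * e)) ↔ _
  rw [form_factor hR hbR, ← hh]
  constructor
  · rintro ⟨h1, h2⟩
    rcases mul_eq_zero.1 h1 with h3 | h3
    · refine ⟨e / z, ?_, ?_⟩
      · field_simp
        linarith
      · field_simp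
    · have he : e = z * N * d / (b + R) := by
        rw [eq_div_iff hbR.ne']; linarith
      set m := d / (b + R) with hm
      have hd : d = m * (b + R) := by rw [hm, div_mul_cancel₀ _ hbR.ne']
      have he' : e = m * (z * N) := by rw [he, hm]; ring
      have h4 : -(z ^ 2 * N * (d * e)) - z * b * (d ^ 2 - e ^ 2) + γ * (d * e) =
          -(R * z * m ^ 2 * (z ^ 2 * N ^ 2 + (b + R) ^ 2)) := by
        rw [hd, he', hγ]
        linear_combination (z * m ^ 2 * (b + R) ^ 2) * hNh
      rw [h4] at h2
      have h5 : 0 < z ^ 2 * N ^ 2 + (b + R) ^ 2 := by positivity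
      have h6 : m ^ 2 = 0 := by
        by_contra hne
        have h7 : 0 < m ^ 2 := lt_of_le_of_ne (sq_nonneg m) (Ne.symm hne)
        have : 0 < R * z * m ^ 2 * (z ^ 2 * N ^ 2 + (b + R) ^ 2) := by positivity
        linarith
      have h8 : m = 0 := by simpa using h6
      exact ⟨0, by rw [hd, h8]; ring, by rw [he', h8]; ring⟩
  · rintro ⟨m, hd, he⟩
    refine ⟨by rw [hd, he]; ring, ?_⟩
    have h4 : -(z ^ 2 * N * (d * e)) - z * b * (d ^ 2 - e ^ 2) + γ * (d * e) =
        R * z * m ^ 2 * (z ^ 2 + h ^ 2) := by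
      rw [hd, he, hγ]
      linear_combination (-(z ^ 3 * m ^ 2)) * hNh
    rw [h4]
    positivity

theorem formLines_of_nonpos (hR : R ^ 2 = b ^ 2 - N * γ) (hR0 : 0 < R) (hbR : 0 < b + R)
    (hz : z ≤ 0) (hγ0 : z = 0 → γ ≠ 0) :
    formLines N b γ z = (Submodule.span ℝ {(!₂[1, z * (N / (b + R))] : E2)} : Set E2) := by
  set h := γ / (b + R) with hh
  have hγ : γ = h * (b + R) := by rw [hh, div_mul_cancel₀ _ hbR.ne']
  have hNh : N * h = b - R := by
    have : (b + R) * (N * h) = (b + R) * (b - R) := by rw [hγ] at hR; linarith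
    exact mul_left_cancel₀ hbR.ne' this
  ext ξ
  rw [← eta_pair ξ, mem_span_pair_iff]
  set d := ξ 0
  set e := ξ 1
  change (z ^ 2 * N * d ^ 2 - 2 * (z * b) * (d * e) + γ * e ^ 2 = 0 ∧
    0 ≤ -(z ^ 2 * N * (d * e)) - z * b * (d ^ 2 - e ^ 2) + γ * (d * e)) ↔ _
  rw [form_factor hR hbR, ← hh]
  constructor
  · rintro ⟨h1, h2⟩
    have hgoal : e * (b + R) = z * N * d → ∃ r, d = r * 1 ∧ e = r * (z * (N / (b + R))) := by
      intro h3
      refine ⟨d, by ring, ?_⟩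
      field_simp
      linarith
    rcases mul_eq_zero.1 h1 with h3 | h3
    -- On the axis this factor reduces to `-h e` with `h ≠ 0`: the two null lines coincide there and
    -- are horizontal.
    · rcases hz.eq_or_lt with rfl | hz
      · have hh0 : h ≠ 0 := fun h0 => hγ0 rfl (by rw [hγ, h0, zero_mul])
        have he : e = 0 := by
          have : h * e = 0 := by linarith
          exact (mul_eq_zero.1 this).resolve_left hh0
        exact hgoal (by rw [he]; ring)
      · set m := e / z with hm
        have he : e = m * z := by rw [hm, div_mul_cancel₀ _ hz.ne]
        have hd : d = m * h := by
          have : z * d = z * (m * h) := by rw [he] at h3; linarith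
          exact mul_left_cancel₀ hz.ne this
        have h4 : -(z ^ 2 * N * (d * e)) - z * b * (d ^ 2 - e ^ 2) + γ * (d * e) =
            R * z * m ^ 2 * (z ^ 2 + h ^ 2) := by
          rw [hd, he, hγ]
          linear_combination (-(z ^ 3 * m ^ 2)) * hNh
        rw [h4] at h2
        have h6 : m ^ 2 = 0 := by
          by_contra hne
          have h7 : 0 < m ^ 2 := lt_of_le_of_ne (sq_nonneg m) (Ne.symm hne)
          have h8 : 0 < z ^ 2 + h ^ 2 := by nlinarith [sq_nonneg h]
          have : 0 < R * (-z) * m ^ 2 * (z ^ 2 + h ^ 2) :=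
            mul_pos (mul_pos (mul_pos hR0 (by linarith)) h7) h8
          linarith
        have h8 : m = 0 := by simpa using h6
        exact hgoal (by rw [hd, he, h8]; ring)
    · exact hgoal (by linarith)
  · rintro ⟨m, hd, he⟩
    have he' : e * (b + R) = m * (z * N) := by
      rw [he]; field_simp
    refine ⟨by rw [show z * N * d - (b + R) * e = 0 by rw [hd]; linarith, mul_zero], ?_⟩
    have h4 : (b + R) ^ 2 * (-(z ^ 2 * N * (d * e)) - z * b * (d ^ 2 - e ^ 2) + γ * (d * e)) =
        -(R * z * m ^ 2 * (z ^ 2 * N ^ 2 + (b + R) ^ 2)) := by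
      have e1 : e = m * (z * N) / (b + R) := by rw [eq_div_iff hbR.ne', he']
      rw [hd, e1, hγ]
      field_simp
      linear_combination (z * m ^ 2 * (b + R) ^ 2) * hNh
    have h5 : 0 ≤ -(R * z * m ^ 2 * (z ^ 2 * N ^ 2 + (b + R) ^ 2)) := by
      have : 0 ≤ R * (-z) * m ^ 2 * (z ^ 2 * N ^ 2 + (b + R) ^ 2) := by
        have : 0 ≤ -z := by linarith
        positivity
      linarith
    rw [← h4] at h5
    exact nonneg_of_mul_nonneg_right h5 (by positivity)

end formLines

/-- As `b + R` is positive at the origin, both quotients `γ / (b + R)` and `N / (b + R)` are `C¹`,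
hence Lipschitz, near it, and the sign of the first is that of `γ`. -/
theorem exists_nodeRegularField {N b γ : ℝ × ℝ → ℝ} (hN : ContDiff ℝ 1 N) (hb : ContDiff ℝ 1 b)
    (hγ : ContDiff ℝ 1 γ) (hb0 : 0 < b 0) (hγ0 : γ 0 = 0) {κ : ℝ} (hκ : 0 < κ)
    (hγ' : HasDerivAt (fun y => γ (y, 0)) κ 0) {L : E2 → Set E2}
    (hL : ∀ x, L x = formLines (N (x 0, x 1)) (b (x 0, x 1)) (γ (x 0, x 1)) (x 1)) :
    ∃ h g δ A K, NodeRegularField L h g δ A K := by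
  let disc : ℝ × ℝ → ℝ := fun q => b q ^ 2 - N q * γ q
  let R : ℝ × ℝ → ℝ := fun q => √(disc q)
  have hdisc : ContDiff ℝ 1 disc := (hb.pow 2).sub (hN.mul hγ)
  have hdisc0 : disc 0 = b 0 ^ 2 := by simp [disc, hγ0]
  have hdpos : 0 < disc 0 := by rw [hdisc0]; positivity
  have hRc : ContDiffAt ℝ 1 R 0 := hdisc.contDiffAt.sqrt hdpos.ne'
  have hbRpos : 0 < b 0 + R 0 := add_pos_of_pos_of_nonneg hb0 (Real.sqrt_nonneg _)
  have hbRc : ContDiffAt ℝ 1 (fun q => b q + R q) 0 := hb.contDiffAt.add hRc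
  have hhc : ContDiffAt ℝ 1 (fun q => γ q / (b q + R q)) 0 := hγ.contDiffAt.div hbRc hbRpos.ne'
  have hgc : ContDiffAt ℝ 1 (fun q => N q / (b q + R q)) 0 := hN.contDiffAt.div hbRc hbRpos.ne'
  obtain ⟨K₁, t₁, ht₁, hl₁⟩ := hhc.exists_lipschitzOnWith
  obtain ⟨K₂, t₂, ht₂, hl₂⟩ := hgc.exists_lipschitzOnWith
  have hfd := (hγ.differentiable one_ne_zero 0).hasFDerivAt
  set γ' := fderiv ℝ γ 0 with hγ'def
  have hγ1 : γ' (1, 0) = κ := by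
    have hline : HasDerivAt (fun y : ℝ => (y, (0 : ℝ))) (1, 0) 0 :=
      (hasDerivAt_id (0 : ℝ)).prodMk (hasDerivAt_const (0 : ℝ) (0 : ℝ))
    exact (HasFDerivAt.comp_hasDerivAt (x := (0 : ℝ)) (l := γ) (f := fun y : ℝ => (y, (0 : ℝ)))
      hfd hline).unique hγ'
  set m := γ' (0, 1) with hm
  have hlin : ∀ y z : ℝ, γ' (y, z) = κ * y + m * z := by
    intro y z
    have : ((y, z) : ℝ × ℝ) = y • (1, 0) + z • (0, 1) := by ext <;> simp
    rw [this, map_add, map_smul, map_smul, hγ1, smul_eq_mul, smul_eq_mul]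
    ring
  have hsmall : ∀ᶠ q : ℝ × ℝ in 𝓝 0, ‖γ q - γ 0 - γ' (q - 0)‖ ≤ κ / 4 * ‖q - 0‖ :=
    hfd.isLittleO.def (by positivity)
  have hev : ∀ᶠ q : ℝ × ℝ in 𝓝 0, 0 < disc q ∧ 0 < b q + R q ∧ q ∈ t₁ ∧ q ∈ t₂ ∧
      ‖γ q - γ 0 - γ' (q - 0)‖ ≤ κ / 4 * ‖q - 0‖ :=
    (hdisc.continuous.continuousAt.eventually (lt_mem_nhds hdpos)).and
      ((hbRc.continuousAt.eventually (lt_mem_nhds hbRpos)).and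
        (Filter.Eventually.and ht₁ (Filter.Eventually.and ht₂ hsmall)))
  obtain ⟨r, hr, hball⟩ := Metric.eventually_nhds_iff_ball.1 hev
  set δ := r / 2 with hδ
  have hδ0 : 0 < δ := by positivity
  have hbox : ∀ y z : ℝ, |y| ≤ δ → |z| ≤ δ → ((y, z) : ℝ × ℝ) ∈ Metric.ball (0 : ℝ × ℝ) r := by
    intro y z hy hz
    rw [mem_ball_zero_iff, Prod.norm_def, Real.norm_eq_abs, Real.norm_eq_abs]
    exact max_lt (by simp only; linarith) (by simp only; linarith)
  -- In the cone `A z ≤ |y|` this gives `|m z| ≤ κ / 4 * |y|`. The Taylor remainder is at most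
  -- another `κ / 4 * |y|`, so `γ` is within `κ / 2 * |y|` of `κ y` and has the sign of `y`.
  set A := max 1 (4 * |m| / κ) with hA
  have hA1 : 1 ≤ A := le_max_left _ _
  have hAm : 4 * |m| ≤ A * κ := by
    rw [← div_le_iff₀ hκ]; exact le_max_right _ _
  have hγsign : ∀ y z, |y| ≤ δ → |z| ≤ δ → 0 ≤ z → A * z ≤ |y| → y ≠ 0 → 0 < y * γ (y, z) := by
    intro y z hy hz hz0 hAz hy0
    have h1 := (hball _ (hbox y z hy hz)).2.2.2.2
    have hzy : z ≤ |y| := by nlinarith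
    rw [hγ0, sub_zero, sub_zero, hlin, Prod.norm_def, Real.norm_eq_abs, Real.norm_eq_abs,
      Real.norm_eq_abs, abs_of_nonneg hz0, max_eq_left hzy] at h1
    have h2 : |m * z| ≤ κ / 4 * |y| := by
      rw [abs_mul, abs_of_nonneg hz0]
      nlinarith [abs_nonneg m]
    have hypos : 0 < |y| := abs_pos.2 hy0
    have h3 : |γ (y, z) - κ * y| ≤ κ / 2 * |y| := by
      calc |γ (y, z) - κ * y| = |(γ (y, z) - (κ * y + m * z)) + m * z| := by ring_nf
        _ ≤ _ := abs_add_le _ _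
        _ ≤ κ / 4 * |y| + κ / 4 * |y| := add_le_add h1 h2
        _ = _ := by ring
    rw [abs_le] at h3
    rcases abs_cases y with ⟨h4, h5⟩ | ⟨h4, h5⟩
    · rw [h4] at h3 hypos
      refine mul_pos hypos ?_
      nlinarith
    · rw [h4] at h3 hypos
      refine mul_pos_of_neg_of_neg h5 ?_
      nlinarith
  have hK : ∀ {K' : NNReal} {f : ℝ × ℝ → ℝ} {t : Set (ℝ × ℝ)}, LipschitzOnWith K' f t →
      K' ≤ max K₁ K₂ → (∀ q ∈ Metric.ball (0 : ℝ × ℝ) r, q ∈ t) →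
      LipschitzOnWith (max K₁ K₂) f (Icc (-δ) δ ×ˢ Icc (-δ) δ) := fun hl hle ht =>
    (hl.weaken hle).mono fun q hq => ht q (hbox _ _ (abs_le.2 hq.1) (abs_le.2 hq.2))
  have hRsq : ∀ y z, |y| ≤ δ → |z| ≤ δ →
      R (y, z) ^ 2 = b (y, z) ^ 2 - N (y, z) * γ (y, z) ∧ 0 < R (y, z) ∧ 0 < b (y, z) + R (y, z) :=
    fun y z hy hz =>
      have h1 := hball _ (hbox y z hy hz)
      ⟨Real.sq_sqrt h1.1.le, Real.sqrt_pos.2 h1.1, h1.2.1⟩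
  refine ⟨fun q => γ q / (b q + R q), fun q => N q / (b q + R q), δ, A, max K₁ K₂,
    hδ0, hA1, hK hl₁ (le_max_left _ _) fun q hq => (hball q hq).2.2.1,
    hK hl₂ (le_max_right _ _) fun q hq => (hball q hq).2.2.2.1, ?_, ?_, ?_⟩
  · intro y z hy hz hz0 hAz hy0
    rw [← mul_div_assoc]
    exact div_pos (hγsign y z hy hz hz0 hAz hy0) (hRsq y z hy hz).2.2
  · intro y z hy hz hz0
    obtain ⟨h1, h2, h3⟩ := hRsq y z hy hz
    rw [hL]
    exact formLines_of_pos h1 h2 h3 hz0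
  · intro y z hy hz hz0 hne
    obtain ⟨h1, h2, h3⟩ := hRsq y z hy hz
    rw [hL]
    refine formLines_of_nonpos h1 h2 h3 hz0 fun hz' => ?_
    have hz'' : z = 0 := hz'
    subst hz''
    have hy0 : y ≠ 0 := fun h0 => hne (by rw [h0]; rfl)
    exact (mul_ne_zero_iff.1 (hγsign y 0 hy hz le_rfl (by simp) hy0).ne').2

/-! ### Homogeneous polynomials and simple zeros of binary forms -/

theorem aeval_mul_of_isHomogeneous {σ A : Type*} [Fintype σ] [CommRing A] [Algebra ℝ A]
    {φ : MvPolynomial σ ℝ} {n : ℕ} (h : φ.IsHomogeneous n) (c : σ → ℝ) (s : A) :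
    aeval (fun i => algebraMap ℝ A (c i) * s) φ = algebraMap ℝ A (eval c φ) * s ^ n := by
  rw [aeval_def, eval₂_eq', eval_eq', map_sum, Finset.sum_mul]
  refine Finset.sum_congr rfl fun d hd => ?_
  have hdeg : ∑ i, d i = n := by
    have := h (mem_support_iff.1 hd)
    rwa [Finsupp.weight_apply, Finsupp.sum_fintype _ _ (by intro; apply zero_smul),
      Finset.sum_congr rfl (fun i _ => by rw [Pi.one_apply, smul_eq_mul, mul_one])] at this
  simp only [mul_pow, Finset.prod_mul_distrib, map_mul, map_prod, map_pow]
  rw [Finset.prod_pow_eq_pow_sum, hdeg, mul_assoc]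

theorem eval_mul_of_isHomogeneous {σ : Type*} [Fintype σ] {φ : MvPolynomial σ ℝ} {n : ℕ}
    (h : φ.IsHomogeneous n) (c : σ → ℝ) (s : ℝ) :
    eval (fun i => s * c i) φ = s ^ n * eval c φ := by
  have := aeval_mul_of_isHomogeneous h c s
  rw [Algebra.algebraMap_self, RingHom.id_apply, mul_comm] at this
  rw [← this, ← coe_aeval_eq_eval]
  simp [mul_comm]

theorem homogenized_isHomogeneous (f : MvPolynomial (Fin 2) ℝ) :
    (homogenized f).IsHomogeneous f.totalDegree := by
  refine IsHomogeneous.sum _ _ _ fun i hi => ?_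
  have h1 := (isHomogeneous_X_pow (R := ℝ) (2 : Fin 3) (f.totalDegree - i)).mul
    ((homogeneousComponent_isHomogeneous i f).rename_isHomogeneous (f := Fin.castSucc))
  rwa [Nat.sub_add_cancel (Nat.lt_succ_iff.1 (Finset.mem_range.1 hi))] at h1

/-- On the equator the second derivatives of the homogenization are those of the top-degree part. -/
theorem eval_pderiv_homogenized (f : MvPolynomial (Fin 2) ℝ) (i j : Fin 2) {q : Fin 3 → ℝ}
    (hq : q 2 = 0) :
    eval q (pderiv i.castSucc (pderiv j.castSucc (homogenized f))) =
      eval (q ∘ Fin.castSucc) (pderiv i (pderiv j (homogeneousComponent f.totalDegree f))) := by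
  have hX : ∀ (k : Fin 2) (m : ℕ) (G : MvPolynomial (Fin 2) ℝ),
      pderiv k.castSucc ((X 2 : MvPolynomial (Fin 3) ℝ) ^ m * rename Fin.castSucc G) =
        X 2 ^ m * rename Fin.castSucc (pderiv k G) := by
    intro k m G
    have h0 : pderiv k.castSucc (X 2 : MvPolynomial (Fin 3) ℝ) = 0 :=
      pderiv_X_of_ne (by fin_cases k <;> decide)
    rw [pderiv_mul, pderiv_pow, h0, mul_zero, zero_mul, zero_add,
      pderiv_rename (Fin.castSucc_injective 2)]
  rw [homogenized, map_sum, map_sum, map_sum, Finset.sum_range_succ, Finset.sum_eq_zero, zero_add]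
  · rw [hX, hX, Nat.sub_self, pow_zero, one_mul, eval_rename]
  · intro m hm
    rw [hX, hX, map_mul, map_pow, eval_X, hq,
      zero_pow (Nat.sub_ne_zero_of_lt (Finset.mem_range.1 hm)), zero_mul]

section binary

variable {φ : MvPolynomial (Fin 2) ℝ} {n : ℕ}

/-- Euler's identity for binary forms. -/
theorem MvPolynomial.IsHomogeneous.euler (h : φ.IsHomogeneous n) (q : Fin 2 → ℝ) :
    q 0 * eval q (pderiv 0 φ) + q 1 * eval q (pderiv 1 φ) = n * eval q φ := by
  have := congrArg (eval q) h.sum_X_mul_pderiv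
  simpa [Fin.sum_univ_two] using this

theorem pderiv_comm_eval (φ : MvPolynomial (Fin 2) ℝ) (q : Fin 2 → ℝ) :
    eval q (pderiv 1 (pderiv 0 φ)) = eval q (pderiv 0 (pderiv 1 φ)) := by
  have h : ⁅(pderiv 1 : Derivation ℝ (MvPolynomial (Fin 2) ℝ) (MvPolynomial (Fin 2) ℝ)),
      (pderiv 0 : Derivation ℝ (MvPolynomial (Fin 2) ℝ) (MvPolynomial (Fin 2) ℝ))⁆ = 0 := by
    refine derivation_ext fun i => ?_
    rw [Derivation.commutator_apply]
    fin_cases i <;> simp [pderiv_X]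
  have := congrArg (fun D : Derivation ℝ (MvPolynomial (Fin 2) ℝ) (MvPolynomial (Fin 2) ℝ) => D φ) h
  simp only [Derivation.commutator_apply, Derivation.zero_apply] at this
  rw [sub_eq_zero.1 this]

/-- A linear form vanishing at `p`. -/
def linForm (p : Fin 2 → ℝ) : MvPolynomial (Fin 2) ℝ := C (p 0) * X 1 - C (p 1) * X 0

/-- A binary form vanishing at `p` is divisible by the linear form vanishing at `p`. -/
theorem linForm_dvd_of_isHomogeneous (h : φ.IsHomogeneous n) {p : Fin 2 → ℝ}
    (hp : p 0 ^ 2 + p 1 ^ 2 = 1) (h0 : eval p φ = 0) : linForm p ∣ φ := by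
  rw [← Ideal.mem_span_singleton, ← Ideal.Quotient.eq_zero_iff_mem]
  set J := Ideal.span {linForm p}
  let ψ := Ideal.Quotient.mkₐ ℝ J
  -- Modulo the linear form each variable `X i` equals `p i * S`, because `p` is a unit vector. By
  -- homogeneity in the quotient ring, `φ` becomes `φ(p) S ^ n`, which is zero.
  let S : MvPolynomial (Fin 2) ℝ := C (p 0) * X 0 + C (p 1) * X 1
  have hCp : (C (p 0) ^ 2 + C (p 1) ^ 2 : MvPolynomial (Fin 2) ℝ) = 1 := by
    rw [← C_pow, ← C_pow, ← C_add, hp, C_1]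
  have hX : ∀ i, ψ (X i) = algebraMap ℝ _ (p i) * ψ S := by
    intro i
    have hC : algebraMap ℝ (MvPolynomial (Fin 2) ℝ ⧸ J) (p i) = ψ (C (p i)) := rfl
    rw [hC, ← map_mul, ← sub_eq_zero, ← map_sub]
    refine Ideal.Quotient.eq_zero_iff_mem.2 (Ideal.mem_span_singleton.2 ?_)
    fin_cases i
    · refine ⟨-C (p 1), ?_⟩
      simp only [S, linForm, Fin.zero_eta]
      linear_combination (-X 0 : MvPolynomial (Fin 2) ℝ) * hCp
    · refine ⟨C (p 0), ?_⟩
      simp only [S, linForm, Fin.mk_one]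
      linear_combination (-X 1 : MvPolynomial (Fin 2) ℝ) * hCp
  have h1 : ψ φ = aeval (fun i => ψ (X i)) φ := by
    exact congrArg (fun χ => χ φ) (aeval_unique ψ)
  change ψ φ = 0
  rw [h1, show (fun i => ψ (X i)) = fun i => algebraMap ℝ _ (p i) * ψ S from funext hX,
    aeval_mul_of_isHomogeneous h, h0, map_zero, zero_mul]

theorem eval_linForm (p q : Fin 2 → ℝ) : eval q (linForm p) = p 0 * q 1 - p 1 * q 0 := by
  simp [linForm]

theorem pderiv_linForm (p : Fin 2 → ℝ) :
    pderiv 0 (linForm p) = -C (p 1) ∧ pderiv 1 (linForm p) = C (p 0) := by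
  constructor
  · simp [linForm, pderiv_X]
  · simp [linForm, pderiv_X]

/-- The zeros of a squarefree binary form are simple. -/
theorem MvPolynomial.IsHomogeneous.exists_simple_factor (h : φ.IsHomogeneous n)
    (hsq : Squarefree φ) {p : Fin 2 → ℝ} (hp : p 0 ^ 2 + p 1 ^ 2 = 1) (h0 : eval p φ = 0) :
    ∃ g, φ = linForm p * g ∧ eval p g ≠ 0 := by
  obtain ⟨g, hg⟩ := linForm_dvd_of_isHomogeneous h hp h0
  refine ⟨g, hg, fun hg0 => ?_⟩
  have hℓp : eval p (linForm p) = 0 := by rw [eval_linForm]; ring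
  have hCp : (C (p 0) ^ 2 + C (p 1) ^ 2 : MvPolynomial (Fin 2) ℝ) = 1 := by
    rw [← C_pow, ← C_pow, ← C_add, hp, C_1]
  -- If `g(p) = 0`, both partial derivatives of `φ` vanish at `p`. They are forms, so the linear
  -- form divides them, hence divides `p 1 * g` and `p 0 * g`, hence `g`; its square would then
  -- divide `φ`. This spares proving that `g` is homogeneous.
  have hd : ∀ i, linForm p ∣ pderiv i φ := fun i =>
    linForm_dvd_of_isHomogeneous (h.pderiv (i := i)) hp (by
      rw [hg, pderiv_mul, map_add, map_mul, map_mul, hg0, hℓp]; ring)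
  have hd0 := hd 0
  have hd1 := hd 1
  rw [hg, pderiv_mul, (pderiv_linForm p).1] at hd0
  rw [hg, pderiv_mul, (pderiv_linForm p).2] at hd1
  have e0 : linForm p ∣ C (p 1) * g := by
    have := (dvd_mul_right (linForm p) (pderiv 0 g)).sub hd0
    rwa [show linForm p * pderiv 0 g - (-C (p 1) * g + linForm p * pderiv 0 g) = C (p 1) * g by
      ring] at this
  have e1 : linForm p ∣ C (p 0) * g := by
    have := hd1.sub (dvd_mul_right (linForm p) (pderiv 1 g))
    rwa [add_sub_cancel_right] at this
  have hgd : linForm p ∣ g := by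
    have := (e1.mul_left (C (p 0))).add (e0.mul_left (C (p 1)))
    rwa [show C (p 0) * (C (p 0) * g) + C (p 1) * (C (p 1) * g) = g by
      linear_combination g * hCp] at this
  have hunit := hsq (linForm p) (by rw [hg]; exact mul_dvd_mul_left _ hgd)
  have := hunit.map (eval p)
  rw [hℓp] at this
  exact not_isUnit_zero this

end binary

/-! ### The extended form in the central chart -/

/-- The Hessian of the homogenization in the variables `u, v` at the point `P`, as a bilinear form
evaluated on `(a, b)` and `(c, d)`. -/
def secondForm (f : MvPolynomial (Fin 2) ℝ) (P : E3) (a b c d : ℝ) : ℝ :=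
  eval P.ofLp (pderiv 0 (pderiv 0 (homogenized f))) * (a * c) +
    eval P.ofLp (pderiv 0 (pderiv 1 (homogenized f))) * (a * d + b * c) +
    eval P.ofLp (pderiv 1 (pderiv 1 (homogenized f))) * (b * d)

/-- The arguments `ω a_i - q_i a_ω` are `ω²` times the differentials of `u / ω` and `v / ω`. They
vanish for `a` parallel to `q`, so the form only sees tangent vectors modulo the position vector. -/
theorem extendedForm_eq (f : MvPolynomial (Fin 2) ℝ) (q a b : E3) :
    extendedForm f q a b = secondForm f q (q 2 * a 0 - q 0 * a 2) (q 2 * a 1 - q 1 * a 2)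
      (q 2 * b 0 - q 0 * b 2) (q 2 * b 1 - q 1 * b 2) := by
  simp only [extendedForm, formMatrix, secondForm, dotProduct, Matrix.mulVec, Fin.sum_univ_three,
    Matrix.of_apply, Matrix.cons_val_zero, Matrix.cons_val_one, Matrix.cons_val]
  ring

theorem secondForm_smul (f : MvPolynomial (Fin 2) ℝ) (r : ℝ) (P : E3) (a b c d : ℝ) :
    secondForm f (r • P) a b c d = r ^ (f.totalDegree - 1 - 1) * secondForm f P a b c d := by
  have h : ∀ i j : Fin 3, eval (r • P).ofLp (pderiv i (pderiv j (homogenized f))) =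
      r ^ (f.totalDegree - 1 - 1) * eval P.ofLp (pderiv i (pderiv j (homogenized f))) :=
    fun i j => eval_mul_of_isHomogeneous ((homogenized_isHomogeneous f).pderiv.pderiv) P.ofLp r
  rw [secondForm, h, h, h, secondForm]
  ring

/-- The form depends on the tangent vectors only modulo the position vector, and is homogeneous. -/
theorem extendedForm_smul_add (f : MvPolynomial (Fin 2) ℝ) (r c d μ ν : ℝ) (P a b : E3) :
    extendedForm f (r • P) (c • a + μ • P) (d • b + ν • P) =
      r ^ (f.totalDegree - 1 - 1) * r ^ 2 * (c * d) * extendedForm f P a b := by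
  rw [extendedForm_eq, secondForm_smul, extendedForm_eq]
  simp only [secondForm, PiLp.add_apply, PiLp.smul_apply, smul_eq_mul]
  ring

theorem cross_coord (x y : E3) : cross x y =
    !₂[x 1 * y 2 - x 2 * y 1, x 2 * y 0 - x 0 * y 2, x 0 * y 1 - x 1 * y 0] := by
  rw [cross, cross_apply]

theorem ext3 {x y : E3} (h0 : x 0 = y 0) (h1 : x 1 = y 1) (h2 : x 2 = y 2) : x = y := by
  ext i
  fin_cases i
  · exact h0
  · exact h1
  · exact h2

theorem inner_coord (x y : E3) : inner ℝ x y = x 0 * y 0 + x 1 * y 1 + x 2 * y 2 := by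
  rw [EuclideanSpace.inner_eq_star_dotProduct]
  simp [dotProduct, Fin.sum_univ_three, mul_comm]

/-- The affine parametrization of the tangent plane `p + ⟨e₁, e₂⟩`. -/
def planePoint (p e₁ e₂ : E3) (x : E2) : E3 := p + x 0 • e₁ + x 1 • e₂

theorem hasFDerivAt_planePoint (p e₁ e₂ : E3) (x : E2) :
    HasFDerivAt (planePoint p e₁ e₂) ((EuclideanSpace.proj (𝕜 := ℝ) (0 : Fin 2)).smulRight e₁ +
      (EuclideanSpace.proj (𝕜 := ℝ) (1 : Fin 2)).smulRight e₂) x := by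
  have h0 := ((EuclideanSpace.proj (𝕜 := ℝ) (0 : Fin 2) : E2 →L[ℝ] ℝ).smulRight e₁).hasFDerivAt
    (x := x)
  have h1 := ((EuclideanSpace.proj (𝕜 := ℝ) (1 : Fin 2) : E2 →L[ℝ] ℝ).smulRight e₂).hasFDerivAt
    (x := x)
  exact (h0.const_add p).add h1

theorem contDiff_planePoint (p e₁ e₂ : E3) : ContDiff ℝ 1 (planePoint p e₁ e₂) := by
  have h : ∀ i : Fin 2, ContDiff ℝ 1 fun x : E2 => x i := fun i =>
    (EuclideanSpace.proj (𝕜 := ℝ) i : E2 →L[ℝ] ℝ).contDiff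
  exact (contDiff_const.add ((h 0).smul contDiff_const)).add ((h 1).smul contDiff_const)

theorem centralChart_eq (p e₁ e₂ : E3) :
    centralChart p e₁ e₂ = fun x => ‖planePoint p e₁ e₂ x‖⁻¹ • planePoint p e₁ e₂ x := rfl

theorem norm_centralChart {p e₁ e₂ : E3} {x : E2} (h : planePoint p e₁ e₂ x ≠ 0) :
    ‖centralChart p e₁ e₂ x‖ = 1 := by
  rw [centralChart_eq, norm_smul, norm_inv, norm_norm, inv_mul_cancel₀ (norm_ne_zero_iff.2 h)]

theorem contDiffAt_centralChart {p e₁ e₂ : E3} {x : E2} (h : planePoint p e₁ e₂ x ≠ 0) :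
    ContDiffAt ℝ 1 (centralChart p e₁ e₂) x := by
  have h1 := (contDiff_planePoint p e₁ e₂).contDiffAt (x := x)
  exact ((h1.norm ℝ h).inv (norm_ne_zero_iff.2 h)).smul h1

/-- The derivative of the central chart, modulo the position vector. -/
theorem exists_fderiv_centralChart {p e₁ e₂ : E3} {x : E2} (h : planePoint p e₁ e₂ x ≠ 0)
    (ξ : E2) : ∃ μ : ℝ, fderiv ℝ (centralChart p e₁ e₂) x ξ =
      ‖planePoint p e₁ e₂ x‖⁻¹ • (ξ 0 • e₁ + ξ 1 • e₂) + μ • planePoint p e₁ e₂ x := by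
  have h1 := hasFDerivAt_planePoint p e₁ e₂ x
  have h2 : DifferentiableAt ℝ (fun x => ‖planePoint p e₁ e₂ x‖⁻¹) x :=
    (h1.differentiableAt.norm ℝ h).inv (norm_ne_zero_iff.2 h)
  refine ⟨fderiv ℝ (fun x => ‖planePoint p e₁ e₂ x‖⁻¹) x ξ, ?_⟩
  have h3 : fderiv ℝ (centralChart p e₁ e₂) x = _ := (h2.hasFDerivAt.smul h1).fderiv
  rw [h3]
  rfl

theorem inner_fderiv_centralChart {p e₁ e₂ : E3} (h : ∀ x, planePoint p e₁ e₂ x ≠ 0) (x ξ : E2) :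
    inner ℝ (centralChart p e₁ e₂ x) (fderiv ℝ (centralChart p e₁ e₂) x ξ) = 0 := by
  have h1 := ((contDiffAt_centralChart (h x)).differentiableAt one_ne_zero).hasFDerivAt.norm_sq
  have h2 : (fun x => ‖centralChart p e₁ e₂ x‖ ^ 2) = fun _ => 1 := by
    funext y
    rw [norm_centralChart (h y), one_pow]
  rw [h2] at h1
  have h3 := congrArg (fun l : E2 →L[ℝ] ℝ => l ξ) (h1.unique (hasFDerivAt_const (1 : ℝ) x))
  simpa using h3

/-- The horizontal tangent vector at a point of the equator. -/
def equatorVec (p : E3) (s : ℝ) : E3 := !₂[-(s * p 1), s * p 0, 0]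

/-- The vertical tangent vector at a point of the equator. -/
def poleVec (s : ℝ) : E3 := !₂[0, 0, s]

section equator

variable {p : E3} {s : ℝ}

theorem planePoint_equator (hp2 : p 2 = 0) (x : E2) :
    planePoint p (equatorVec p s) (poleVec s) x =
      !₂[p 0 - s * x 0 * p 1, p 1 + s * x 0 * p 0, s * x 1] := by
  refine ext3 ?_ ?_ ?_
  · change p 0 + x 0 * (-(s * p 1)) + x 1 * 0 = p 0 - s * x 0 * p 1
    ring
  · change p 1 + x 0 * (s * p 0) + x 1 * 0 = p 1 + s * x 0 * p 0
    ring
  · change p 2 + x 0 * 0 + x 1 * s = s * x 1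
    rw [hp2]; ring

theorem planePoint_ne_zero (hp2 : p 2 = 0) (hp : p 0 ^ 2 + p 1 ^ 2 = 1) (x : E2) :
    planePoint p (equatorVec p s) (poleVec s) x ≠ 0 := by
  intro h
  rw [planePoint_equator hp2] at h
  have h0 : p 0 - s * x 0 * p 1 = 0 := congrArg (fun q : E3 => q 0) h
  have h1 : p 1 + s * x 0 * p 0 = 0 := congrArg (fun q : E3 => q 1) h
  have : p 0 ^ 2 + p 1 ^ 2 = 0 := by linear_combination p 0 * h0 + p 1 * h1
  linarith

/-- The coefficients of the form in the central chart. -/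
def coeffN (f : MvPolynomial (Fin 2) ℝ) (p : E3) (s : ℝ) (q : ℝ × ℝ) : ℝ :=
  secondForm f !₂[p 0 - s * q.1 * p 1, p 1 + s * q.1 * p 0, s * q.2] (-p 1) (p 0) (-p 1) (p 0)

/-- The coefficients of the form in the central chart. -/
def coeffB (f : MvPolynomial (Fin 2) ℝ) (p : E3) (s : ℝ) (q : ℝ × ℝ) : ℝ :=
  secondForm f !₂[p 0 - s * q.1 * p 1, p 1 + s * q.1 * p 0, s * q.2] (-p 1) (p 0)
    (s * p 0 - q.1 * p 1) (s * p 1 + q.1 * p 0)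

/-- The coefficients of the form in the central chart. -/
def coeffG (f : MvPolynomial (Fin 2) ℝ) (p : E3) (s : ℝ) (q : ℝ × ℝ) : ℝ :=
  secondForm f !₂[p 0 - s * q.1 * p 1, p 1 + s * q.1 * p 0, s * q.2]
    (s * p 0 - q.1 * p 1) (s * p 1 + q.1 * p 0) (s * p 0 - q.1 * p 1) (s * p 1 + q.1 * p 0)

/-- At the chart point, with horizontal part `P`, the vector `a e₁ + b e₂` yields the argument `z a
(-p 1, p 0) - b (s P)` of the Hessian. Expanding bilinearly gives the three coefficients; `s² = 1`
rewrites `s P` as it appears in them. -/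
theorem extendedForm_planePoint (f : MvPolynomial (Fin 2) ℝ) (hp2 : p 2 = 0) (hs : s ^ 2 = 1)
    (x : E2) (a b c d : ℝ) :
    extendedForm f (planePoint p (equatorVec p s) (poleVec s) x)
      (a • equatorVec p s + b • poleVec s) (c • equatorVec p s + d • poleVec s) =
      x 1 ^ 2 * coeffN f p s (x 0, x 1) * (a * c) -
        x 1 * coeffB f p s (x 0, x 1) * (a * d + b * c) + coeffG f p s (x 0, x 1) * (b * d) := by
  have key : ∀ Fuu Fuv Fvv p0 p1 y z : ℝ,
      Fuu * ((s * z * (a * -(s * p1) + b * 0) - (p0 - s * y * p1) * (a * 0 + b * s)) *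
        (s * z * (c * -(s * p1) + d * 0) - (p0 - s * y * p1) * (c * 0 + d * s))) +
      Fuv * ((s * z * (a * -(s * p1) + b * 0) - (p0 - s * y * p1) * (a * 0 + b * s)) *
        (s * z * (c * (s * p0) + d * 0) - (p1 + s * y * p0) * (c * 0 + d * s)) +
        (s * z * (a * (s * p0) + b * 0) - (p1 + s * y * p0) * (a * 0 + b * s)) *
        (s * z * (c * -(s * p1) + d * 0) - (p0 - s * y * p1) * (c * 0 + d * s))) +
      Fvv * ((s * z * (a * (s * p0) + b * 0) - (p1 + s * y * p0) * (a * 0 + b * s)) *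
        (s * z * (c * (s * p0) + d * 0) - (p1 + s * y * p0) * (c * 0 + d * s))) =
      z ^ 2 * (Fuu * (-p1 * -p1) + Fuv * (-p1 * p0 + p0 * -p1) + Fvv * (p0 * p0)) * (a * c) -
      z * (Fuu * (-p1 * (s * p0 - y * p1)) + Fuv * (-p1 * (s * p1 + y * p0) +
        p0 * (s * p0 - y * p1)) + Fvv * (p0 * (s * p1 + y * p0))) * (a * d + b * c) +
      (Fuu * ((s * p0 - y * p1) * (s * p0 - y * p1)) + Fuv * ((s * p0 - y * p1) * (s * p1 + y * p0) +
        (s * p1 + y * p0) * (s * p0 - y * p1)) + Fvv * ((s * p1 + y * p0) * (s * p1 + y * p0))) *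
        (b * d) := by
    intro Fuu Fuv Fvv p0 p1 y z
    have e1 : ∀ a b : ℝ, s * z * (a * -(s * p1) + b * 0) - (p0 - s * y * p1) * (a * 0 + b * s) =
        z * a * -p1 - b * (s * p0 - y * p1) := by
      intro a b; linear_combination (-(z * a * p1) + b * y * p1) * hs
    have e2 : ∀ a b : ℝ, s * z * (a * (s * p0) + b * 0) - (p1 + s * y * p0) * (a * 0 + b * s) =
        z * a * p0 - b * (s * p1 + y * p0) := by
      intro a b; linear_combination (z * a * p0 - b * y * p0) * hs
    rw [e1, e1, e2, e2]
    ring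
  rw [extendedForm_eq, planePoint_equator hp2]
  exact key _ _ _ (p 0) (p 1) (x 0) (x 1)

theorem cross_planePoint (hp2 : p 2 = 0) (hp : p 0 ^ 2 + p 1 ^ 2 = 1) (hs : s ^ 2 = 1) (x : E2)
    (a b : ℝ) :
    cross (planePoint p (equatorVec p s) (poleVec s) x) (a • equatorVec p s + b • poleVec s) =
      ((-b - (x 0 * b - x 1 * a) * x 0) • equatorVec p s +
        (a - (x 0 * b - x 1 * a) * x 1) • poleVec s) +
        (x 0 * b - x 1 * a) • planePoint p (equatorVec p s) (poleVec s) x := by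
  rw [planePoint_equator hp2, cross_coord]
  refine ext3 ?_ ?_ ?_
  · change (p 1 + s * x 0 * p 0) * (a * 0 + b * s) - s * x 1 * (a * (s * p 0) + b * 0) =
      ((-b - (x 0 * b - x 1 * a) * x 0) * -(s * p 1) + (a - (x 0 * b - x 1 * a) * x 1) * 0) +
        (x 0 * b - x 1 * a) * (p 0 - s * x 0 * p 1)
    linear_combination (x 0 * b - x 1 * a) * p 0 * hs
  · change s * x 1 * (a * -(s * p 1) + b * 0) - (p 0 - s * x 0 * p 1) * (a * 0 + b * s) =
      ((-b - (x 0 * b - x 1 * a) * x 0) * (s * p 0) + (a - (x 0 * b - x 1 * a) * x 1) * 0) +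
        (x 0 * b - x 1 * a) * (p 1 + s * x 0 * p 0)
    linear_combination (x 0 * b - x 1 * a) * p 1 * hs
  · change (p 0 - s * x 0 * p 1) * (a * (s * p 0) + b * 0) -
      (p 1 + s * x 0 * p 0) * (a * -(s * p 1) + b * 0) =
      ((-b - (x 0 * b - x 1 * a) * x 0) * 0 + (a - (x 0 * b - x 1 * a) * x 1) * s) +
        (x 0 * b - x 1 * a) * (s * x 1)
    linear_combination a * s * hp

theorem cross_smul_add_smul (r μ : ℝ) (P a : E3) :
    cross (r • P) (r • a + μ • P) = r ^ 2 • cross P a := by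
  rw [cross_coord, cross_coord]
  refine ext3 ?_ ?_ ?_
  · change r * P 1 * (r * a 2 + μ * P 2) - r * P 2 * (r * a 1 + μ * P 1) =
      r ^ 2 * (P 1 * a 2 - P 2 * a 1)
    ring
  · change r * P 2 * (r * a 0 + μ * P 0) - r * P 0 * (r * a 2 + μ * P 2) =
      r ^ 2 * (P 2 * a 0 - P 0 * a 2)
    ring
  · change r * P 0 * (r * a 1 + μ * P 1) - r * P 1 * (r * a 0 + μ * P 0) =
      r ^ 2 * (P 0 * a 1 - P 1 * a 0)
    ring

/-- Rescaling a binary quadratic form and turning the vector `(a, b)` within a tangent plane of the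
sphere at a point with central coordinates `(y, z)` do not change the selected null lines. -/
theorem null_conditions_iff {N B G m r ε : ℝ} (hm : 0 < m) (hr : 0 < r) (hε : ε ≠ 0)
    (a b y z : ℝ) :
    (m * (r * r) * (z ^ 2 * N * (a * a) - z * B * (a * b + b * a) + G * (b * b)) = 0 ∧
      0 ≤ ε * (m * (r * r ^ 2) * (z ^ 2 * N * (a * (-b - (y * b - z * a) * y)) -
        z * B * (a * (a - (y * b - z * a) * z) + b * (-b - (y * b - z * a) * y)) +
        G * (b * (a - (y * b - z * a) * z))))) ↔
    (z ^ 2 * (ε * N) * a ^ 2 - 2 * (z * (ε * B)) * (a * b) + ε * G * b ^ 2 = 0 ∧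
      0 ≤ -(z ^ 2 * (ε * N) * (a * b)) - z * (ε * B) * (a ^ 2 - b ^ 2) + ε * G * (a * b)) := by
  have hQ : m * (r * r) * (z ^ 2 * N * (a * a) - z * B * (a * b + b * a) + G * (b * b)) = 0 ↔
      z ^ 2 * (ε * N) * a ^ 2 - 2 * (z * (ε * B)) * (a * b) + ε * G * b ^ 2 = 0 := by
    rw [show z ^ 2 * (ε * N) * a ^ 2 - 2 * (z * (ε * B)) * (a * b) + ε * G * b ^ 2 =
      ε * (z ^ 2 * N * (a * a) - z * B * (a * b + b * a) + G * (b * b)) by ring]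
    rw [mul_eq_zero_iff_left (mul_pos hm (mul_pos hr hr)).ne', mul_eq_zero_iff_left hε]
  rw [hQ]
  refine and_congr_right fun h0 => ?_
  -- Turning `ξ` on the sphere and turning it in the chart give vectors that differ by a positive
  -- factor and a multiple of `ξ`. Since `ξ` is null, the multiple contributes nothing and the sign
  -- is the same.
  have hid : (a ^ 2 + b ^ 2) * (ε * (m * (r * r ^ 2) *
      (z ^ 2 * N * (a * (-b - (y * b - z * a) * y)) -
        z * B * (a * (a - (y * b - z * a) * z) + b * (-b - (y * b - z * a) * y)) +
        G * (b * (a - (y * b - z * a) * z))))) =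
      (m * (r * r ^ 2) * (a ^ 2 + b ^ 2 + (y * b - z * a) ^ 2)) *
        (-(z ^ 2 * (ε * N) * (a * b)) - z * (ε * B) * (a ^ 2 - b ^ 2) + ε * G * (a * b)) := by
    linear_combination (-(m * (r * r ^ 2)) * (y * b - z * a) * (y * a + z * b)) * h0
  have hmr : 0 < m * (r * r ^ 2) := by positivity
  by_cases hab : a ^ 2 + b ^ 2 = 0
  · obtain ⟨ha, hb⟩ := (add_eq_zero_iff_of_nonneg (sq_nonneg a) (sq_nonneg b)).1 hab
    rw [pow_eq_zero_iff two_ne_zero] at ha hb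
    rw [ha, hb]
    simp
  · have hab' : 0 < a ^ 2 + b ^ 2 := lt_of_le_of_ne (by positivity) (Ne.symm hab)
    rw [← mul_nonneg_iff_of_pos_left hab', hid,
      mul_nonneg_iff_of_pos_left (mul_pos hmr (add_pos_of_pos_of_nonneg hab' (sq_nonneg _)))]

/-- The field of asymptotic lines in the central chart. -/
theorem asymptoticField_centralChart (f : MvPolynomial (Fin 2) ℝ) (ε : ℝ) (ε' : ℤˣ)
    (hε : ε = ((ε' : ℤ) : ℝ)) (hp2 : p 2 = 0)
    (hp : p 0 ^ 2 + p 1 ^ 2 = 1) (hs : s ^ 2 = 1) (x : E2) :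
    {ξ | fderiv ℝ (centralChart p (equatorVec p s) (poleVec s)) x ξ ∈
      asymptoticField f ε' (centralChart p (equatorVec p s) (poleVec s) x)} =
    formLines (ε * coeffN f p s (x 0, x 1)) (ε * coeffB f p s (x 0, x 1))
      (ε * coeffG f p s (x 0, x 1)) (x 1) := by
  have hne := planePoint_ne_zero (s := s) hp2 hp
  have hε2 : ε ≠ 0 := by
    rw [hε]; exact_mod_cast ε'.ne_zero
  ext ξ
  obtain ⟨μ, hμ⟩ := exists_fderiv_centralChart (hne x) ξ
  have horth := inner_fderiv_centralChart hne x ξ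
  have hr : 0 < ‖planePoint p (equatorVec p s) (poleVec s) x‖⁻¹ :=
    inv_pos.2 (norm_pos_iff.2 (hne x))
  set r := ‖planePoint p (equatorVec p s) (poleVec s) x‖⁻¹ with hrdef
  have hcc : centralChart p (equatorVec p s) (poleVec s) x =
      r • planePoint p (equatorVec p s) (poleVec s) x := rfl
  have hcross := cross_smul_add_smul r μ (planePoint p (equatorVec p s) (poleVec s) x)
    (ξ 0 • equatorVec p s + ξ 1 • poleVec s)
  rw [cross_planePoint hp2 hp hs, smul_add (r ^ 2), smul_smul (r ^ 2)] at hcross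
  change (_ ∧ _ ∧ _) ↔ _
  rw [horth, hμ, hcc, hcross, extendedForm_smul_add, extendedForm_smul_add,
    extendedForm_planePoint f hp2 hs, extendedForm_planePoint f hp2 hs, ← hε]
  have hm : 0 < r ^ (f.totalDegree - 1 - 1) * r ^ 2 := by positivity
  have := null_conditions_iff (N := coeffN f p s (x 0, x 1)) (B := coeffB f p s (x 0, x 1))
    (G := coeffG f p s (x 0, x 1)) hm hr hε2 (ξ 0) (ξ 1) (x 0) (x 1)
  exact (and_iff_right rfl).trans this

end equator

/-! ### Transport of leaves through a chart -/

section transport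

variable {E F : Type*} [NormedAddCommGroup E] [NormedSpace ℝ E] [NormedAddCommGroup F]
  [NormedSpace ℝ F]

theorem derivWithin_comp_eq_fderiv {c : F → E} {γ : ℝ → F} {I : Set ℝ} {t : ℝ}
    (hc : DifferentiableAt ℝ c (γ t)) (hγ : DifferentiableWithinAt ℝ γ I t)
    (hI : UniqueDiffWithinAt ℝ I t) :
    derivWithin (c ∘ γ) I t = fderiv ℝ c (γ t) (derivWithin γ I t) :=
  (hc.hasFDerivAt.comp_hasDerivWithinAt t hγ.hasDerivWithinAt).derivWithin hI

/-- The leaves of a field of lines in a chart. -/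
theorem sameLeaf_iff_of_chart (L : E → Set E) {U : Set E} {V : Set F} {c : F → E} {ψ : E → F}
    (hc : ∀ x ∈ V, ContDiffAt ℝ 1 c x) (hψ : ∀ q ∈ U, ContDiffAt ℝ 1 ψ q) (hcU : MapsTo c V U)
    (hψV : MapsTo ψ U V) (hcψ : ∀ q ∈ U, c (ψ q) = q) {q q' : E} (hq : q ∈ U) (hq' : q' ∈ U) :
    SameLeaf L U q q' ↔
      SameLeaf (fun x => {ξ | fderiv ℝ c x ξ ∈ L (c x)}) V (ψ q) (ψ q') := by
  have hu : ∀ t ∈ Icc (0 : ℝ) 1, UniqueDiffWithinAt ℝ (Icc (0 : ℝ) 1) t :=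
    uniqueDiffOn_Icc one_pos
  constructor
  · rintro ⟨γ, hγ, rfl, rfl, hL⟩
    have hcomp : ContDiffOn ℝ 1 (ψ ∘ γ) (Icc 0 1) := fun t ht =>
      (hψ _ (hL t ht).1).comp_contDiffWithinAt t (hγ t ht)
    refine ⟨ψ ∘ γ, hcomp, rfl, rfl, fun t ht => ⟨hψV (hL t ht).1, ?_⟩⟩
    have hd := derivWithin_comp_eq_fderiv
      ((hc _ (hψV (hL t ht).1)).differentiableAt one_ne_zero)
      (hcomp.differentiableOn one_ne_zero t ht) (hu t ht)
    -- `c ∘ ψ` is the identity on `U` only, which need not be open in `E`; so derivatives are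
    -- compared along the curve.
    have hcongr : derivWithin (c ∘ ψ ∘ γ) (Icc 0 1) t = derivWithin γ (Icc 0 1) t :=
      derivWithin_congr (fun r hr => hcψ _ (hL r hr).1) (hcψ _ (hL t ht).1)
    change fderiv ℝ c (ψ (γ t)) (derivWithin (ψ ∘ γ) (Icc 0 1) t) ∈ L (c (ψ (γ t)))
    rw [hcψ _ (hL t ht).1]
    have h2 := (hL t ht).2
    rw [← hcongr, hd] at h2
    exact h2
  · rintro ⟨γ, hγ, h0, h1, hL⟩
    have hcomp : ContDiffOn ℝ 1 (c ∘ γ) (Icc 0 1) := fun t ht =>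
      (hc _ (hL t ht).1).comp_contDiffWithinAt t (hγ t ht)
    refine ⟨c ∘ γ, hcomp, ?_, ?_, fun t ht => ⟨hcU (hL t ht).1, ?_⟩⟩
    · rw [Function.comp_apply, h0, hcψ _ hq]
    · rw [Function.comp_apply, h1, hcψ _ hq']
    · rw [derivWithin_comp_eq_fderiv ((hc _ (hL t ht).1).differentiableAt one_ne_zero)
        (hγ.differentiableOn one_ne_zero t ht) (hu t ht)]
      exact (hL t ht).2

end transport

theorem contDiff_eval {σ E : Type*} [NormedAddCommGroup E] [NormedSpace ℝ E]
    (φ : MvPolynomial σ ℝ) {u : E → σ → ℝ} (hu : ∀ i, ContDiff ℝ 1 fun x => u x i) :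
    ContDiff ℝ 1 fun x => eval (u x) φ := by
  induction φ using MvPolynomial.induction_on with
  | C a => simpa using contDiff_const
  | add φ ψ hφ hψ => simpa using hφ.add hψ
  | mul_X φ i hφ => simpa using hφ.mul (hu i)

theorem contDiff_secondForm (f : MvPolynomial (Fin 2) ℝ) {E : Type*} [NormedAddCommGroup E]
    [NormedSpace ℝ E] {P : E → E3} {a b c d : E → ℝ} (hP : ∀ i, ContDiff ℝ 1 fun x => P x i)
    (ha : ContDiff ℝ 1 a) (hb : ContDiff ℝ 1 b) (hc : ContDiff ℝ 1 c) (hd : ContDiff ℝ 1 d) :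
    ContDiff ℝ 1 fun x => secondForm f (P x) (a x) (b x) (c x) (d x) :=
  (((contDiff_eval _ hP).mul (ha.mul hc)).add
    ((contDiff_eval _ hP).mul ((ha.mul hd).add (hb.mul hc)))).add
    ((contDiff_eval _ hP).mul (hb.mul hd))

/-! ### The coefficients on the equator and the singular points -/

section equator

variable {p : E3} {s : ℝ}

theorem contDiff_coeff (f : MvPolynomial (Fin 2) ℝ) (p : E3) (s : ℝ) :
    ContDiff ℝ 1 (coeffN f p s) ∧ ContDiff ℝ 1 (coeffB f p s) ∧ ContDiff ℝ 1 (coeffG f p s) := by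
  have hP : ∀ i, ContDiff ℝ 1 fun q : ℝ × ℝ =>
      (!₂[p 0 - s * q.1 * p 1, p 1 + s * q.1 * p 0, s * q.2] : E3) i := by
    intro i
    fin_cases i
    · change ContDiff ℝ 1 fun q : ℝ × ℝ => p 0 - s * q.1 * p 1
      fun_prop
    · change ContDiff ℝ 1 fun q : ℝ × ℝ => p 1 + s * q.1 * p 0
      fun_prop
    · change ContDiff ℝ 1 fun q : ℝ × ℝ => s * q.2
      fun_prop
  have h0 : ContDiff ℝ 1 fun q : ℝ × ℝ => s * p 0 - q.1 * p 1 := by fun_prop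
  have h1 : ContDiff ℝ 1 fun q : ℝ × ℝ => s * p 1 + q.1 * p 0 := by fun_prop
  exact ⟨contDiff_secondForm f hP contDiff_const contDiff_const contDiff_const contDiff_const,
    contDiff_secondForm f hP contDiff_const contDiff_const h0 h1,
    contDiff_secondForm f hP h0 h1 h0 h1⟩

/-- On the equator the Hessian is that of `f_n`, and Euler's identity for the partial derivatives of
`f_n`, of degree `n - 1`, contracts it with the position. -/
theorem secondForm_right (f : MvPolynomial (Fin 2) ℝ) {P : E3} (hP : P 2 = 0) (a b : ℝ) :
    secondForm f P a b (P 0) (P 1) = ((f.totalDegree - 1 : ℕ) : ℝ) *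
      (a * eval (P.ofLp ∘ Fin.castSucc) (pderiv 0 (homogeneousComponent f.totalDegree f)) +
        b * eval (P.ofLp ∘ Fin.castSucc) (pderiv 1 (homogeneousComponent f.totalDegree f))) := by
  have h := homogeneousComponent_isHomogeneous f.totalDegree f
  have h0 := (h.pderiv (i := 0)).euler (P.ofLp ∘ Fin.castSucc)
  have h1 := (h.pderiv (i := 1)).euler (P.ofLp ∘ Fin.castSucc)
  have e00 := eval_pderiv_homogenized f 0 0 hP
  have e01 := eval_pderiv_homogenized f 0 1 hP
  have e11 := eval_pderiv_homogenized f 1 1 hP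
  rw [pderiv_comm_eval] at h0
  change P 0 * _ + P 1 * _ = _ at h0 h1
  change eval P.ofLp (pderiv 0 (pderiv 0 (homogenized f))) = _ at e00
  change eval P.ofLp (pderiv 0 (pderiv 1 (homogenized f))) = _ at e01
  change eval P.ofLp (pderiv 1 (pderiv 1 (homogenized f))) = _ at e11
  rw [secondForm, e00, e01, e11]
  linear_combination a * h0 + b * h1

theorem secondForm_self (f : MvPolynomial (Fin 2) ℝ) {P : E3} (hP : P 2 = 0) :
    secondForm f P (P 0) (P 1) (P 0) (P 1) = ((f.totalDegree - 1 : ℕ) : ℝ) *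
      (f.totalDegree *
        eval (P.ofLp ∘ Fin.castSucc) (homogeneousComponent f.totalDegree f)) := by
  rw [secondForm_right f hP]
  congr 1
  exact (homogeneousComponent_isHomogeneous f.totalDegree f).euler (P.ofLp ∘ Fin.castSucc)

/-- At a singular point at infinity the leading form vanishes. -/
theorem eval_leading_eq_zero {f : MvPolynomial (Fin 2) ℝ} (hn : 2 ≤ f.totalDegree) {ε : ℤˣ}
    (hp2 : p 2 = 0) (hp : p 0 ^ 2 + p 1 ^ 2 = 1) {a b : E3} (ha : a ∈ asymptoticField f ε p)
    (hb : b ∈ asymptoticField f ε p) (hab : LinearIndependent ℝ ![a, b]) :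
    eval (p.ofLp ∘ Fin.castSucc) (homogeneousComponent f.totalDegree f) = 0 := by
  by_contra h0
  have hn0 : ((f.totalDegree - 1 : ℕ) : ℝ) ≠ 0 := by
    rw [Nat.cast_ne_zero]; omega
  have hn1 : (f.totalDegree : ℝ) ≠ 0 := by
    rw [Nat.cast_ne_zero]; omega
  -- On the equator the form is `n (n - 1) f_n(p)` times the square of the vertical component. If
  -- the factor is nonzero, all null vectors are tangent to the equator and two of them are
  -- dependent.
  have hvert : ∀ c ∈ asymptoticField f ε p, c 2 = 0 ∧ p 0 * c 0 + p 1 * c 1 = 0 := by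
    rintro c ⟨hc1, hc2, -⟩
    have h3 : c 2 ^ 2 * secondForm f p (p 0) (p 1) (p 0) (p 1) = 0 := by
      rw [← hc2, extendedForm_eq, hp2]
      simp only [secondForm]
      ring
    rw [secondForm_self f hp2] at h3
    have h4 : c 2 = 0 := by
      rcases mul_eq_zero.1 h3 with h5 | h5
      · exact pow_eq_zero_iff two_ne_zero |>.1 h5
      · exact absurd h5 (mul_ne_zero hn0 (mul_ne_zero hn1 h0))
    rw [inner_coord, h4] at hc1
    exact ⟨h4, by linarith⟩
  obtain ⟨ha2, ha'⟩ := hvert a ha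
  obtain ⟨hb2, hb'⟩ := hvert b hb
  have hform : ∀ c : E3, c 2 = 0 → p 0 * c 0 + p 1 * c 1 = 0 →
      c = (-p 1 * c 0 + p 0 * c 1) • (!₂[-p 1, p 0, 0] : E3) := by
    intro c hc2 hc
    refine ext3 ?_ ?_ ?_
    · change c 0 = (-p 1 * c 0 + p 0 * c 1) * -p 1
      linear_combination (-c 0) * hp + p 0 * hc
    · change c 1 = (-p 1 * c 0 + p 0 * c 1) * p 0
      linear_combination (-c 1) * hp + p 1 * hc
    · change c 2 = (-p 1 * c 0 + p 0 * c 1) * 0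
      rw [hc2, mul_zero]
  have h1 := hform a ha2 ha'
  have h2 := hform b hb2 hb'
  set α := -p 1 * a 0 + p 0 * a 1
  set β := -p 1 * b 0 + p 0 * b 1
  have h3 := LinearIndependent.pair_iff.1 hab β (-α) (by
    rw [h1, h2, smul_smul, smul_smul, ← add_smul]
    rw [show β * α + -α * β = 0 by ring, zero_smul])
  have hα : α = 0 := neg_eq_zero.1 h3.2
  have ha0 : a = 0 := by rw [h1, hα, zero_smul]
  exact hab.ne_zero 0 ha0

/-- The coefficient is `n (n - 1) f_n` at the chart point, and the linear form takes the value `s y`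
there. -/
theorem coeffG_equator (f : MvPolynomial (Fin 2) ℝ) {g : MvPolynomial (Fin 2) ℝ}
    (hg : homogeneousComponent f.totalDegree f = linForm (p.ofLp ∘ Fin.castSucc) * g)
    (hp : p 0 ^ 2 + p 1 ^ 2 = 1) (hs : s ^ 2 = 1) (y : ℝ) :
    coeffG f p s (y, 0) = y * (((f.totalDegree - 1 : ℕ) : ℝ) * (f.totalDegree * (s *
      eval ![p 0 - s * y * p 1, p 1 + s * y * p 0] g))) := by
  set P : E3 := !₂[p 0 - s * y * p 1, p 1 + s * y * p 0, s * 0] with hP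
  have hP2 : P 2 = 0 := mul_zero s
  have h1 : coeffG f p s (y, 0) = secondForm f P (P 0) (P 1) (P 0) (P 1) := by
    have e0 : s * p 0 - y * p 1 = s * P 0 := by
      change _ = s * (p 0 - s * y * p 1)
      linear_combination y * p 1 * hs
    have e1 : s * p 1 + y * p 0 = s * P 1 := by
      change _ = s * (p 1 + s * y * p 0)
      linear_combination -(y * p 0) * hs
    change secondForm f P (s * p 0 - y * p 1) (s * p 1 + y * p 0) (s * p 0 - y * p 1)
      (s * p 1 + y * p 0) = _
    rw [e0, e1]
    simp only [secondForm]
    linear_combination (eval P.ofLp (pderiv 0 (pderiv 0 (homogenized f))) * (P 0 * P 0) +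
      eval P.ofLp (pderiv 0 (pderiv 1 (homogenized f))) * (P 0 * P 1 + P 1 * P 0) +
      eval P.ofLp (pderiv 1 (pderiv 1 (homogenized f))) * (P 1 * P 1)) * hs
  have hP' : P.ofLp ∘ Fin.castSucc = ![p 0 - s * y * p 1, p 1 + s * y * p 0] := by
    funext i
    fin_cases i <;> rfl
  rw [h1, secondForm_self f hP2, hg, map_mul, eval_linForm, hP']
  change _ * (_ * ((p 0 * (p 1 + s * y * p 0) - p 1 * (p 0 - s * y * p 1)) * _)) = _
  linear_combination (((f.totalDegree - 1 : ℕ) : ℝ) * f.totalDegree *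
    eval ![p 0 - s * y * p 1, p 1 + s * y * p 0] g * s * y) * hp

/-- Up to `s (n - 1)` this is the derivative of `f_n` at `p` along the equator, where only the term
differentiating the linear factor survives. Simplicity of the zero makes it nonzero. -/
theorem coeffB_zero (f : MvPolynomial (Fin 2) ℝ) {g : MvPolynomial (Fin 2) ℝ}
    (hg : homogeneousComponent f.totalDegree f = linForm (p.ofLp ∘ Fin.castSucc) * g)
    (hp2 : p 2 = 0) (hp : p 0 ^ 2 + p 1 ^ 2 = 1) :
    coeffB f p s 0 =
      s * (((f.totalDegree - 1 : ℕ) : ℝ) * eval (p.ofLp ∘ Fin.castSucc) g) := by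
  have h1 : coeffB f p s 0 = s * secondForm f p (-p 1) (p 0) (p 0) (p 1) := by
    have hP : (!₂[p 0 - s * 0 * p 1, p 1 + s * 0 * p 0, s * 0] : E3) = p := by
      refine ext3 ?_ ?_ ?_
      · change p 0 - s * 0 * p 1 = p 0
        ring
      · change p 1 + s * 0 * p 0 = p 1
        ring
      · change s * 0 = p 2
        rw [hp2, mul_zero]
    change secondForm f !₂[p 0 - s * 0 * p 1, p 1 + s * 0 * p 0, s * 0] (-p 1) (p 0)
      (s * p 0 - 0 * p 1) (s * p 1 + 0 * p 0) = _
    rw [hP]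
    simp only [secondForm]
    ring
  have hℓ : eval (p.ofLp ∘ Fin.castSucc) (linForm (p.ofLp ∘ Fin.castSucc)) = 0 := by
    rw [eval_linForm]; ring
  obtain ⟨d0, d1⟩ := pderiv_linForm (p.ofLp ∘ Fin.castSucc)
  rw [h1, secondForm_right f hp2, hg, Derivation.leibniz, Derivation.leibniz, d0, d1]
  simp only [map_add, smul_eq_mul, map_mul, map_neg, eval_C, hℓ]
  change s * (_ * (-p 1 * (0 * _ + _ * -p 1) + p 0 * (0 * _ + _ * p 0))) = _
  linear_combination s * ((f.totalDegree - 1 : ℕ) : ℝ) * eval (p.ofLp ∘ Fin.castSucc) g * hp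

/-- At a simple zero of the leading form the field of asymptotic lines is a node above the equator
and regular below it, in a suitably oriented central chart. -/
theorem exists_nodeRegularField_centralChart {f g : MvPolynomial (Fin 2) ℝ}
    (hn : 2 ≤ f.totalDegree)
    (hg : homogeneousComponent f.totalDegree f = linForm (p.ofLp ∘ Fin.castSucc) * g)
    (hp2 : p 2 = 0) (hp : p 0 ^ 2 + p 1 ^ 2 = 1) (hs : s ^ 2 = 1) (ε : ℤˣ)
    (hpos : 0 < ((ε : ℤ) : ℝ) * s * eval (p.ofLp ∘ Fin.castSucc) g) :
    ∃ h g δ A K, NodeRegularField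
      (fun x => {ξ | fderiv ℝ (centralChart p (equatorVec p s) (poleVec s)) x ξ ∈
        asymptoticField f ε (centralChart p (equatorVec p s) (poleVec s) x)}) h g δ A K := by
  obtain ⟨hN, hB, hG⟩ := contDiff_coeff f p s
  have hn0 : (0 : ℝ) < ((f.totalDegree - 1 : ℕ) : ℝ) := by
    rw [Nat.cast_pos]; omega
  have hn1 : (0 : ℝ) < f.totalDegree := by
    rw [Nat.cast_pos]; omega
  set e : ℝ := ((ε : ℤ) : ℝ) with he
  set v := eval (p.ofLp ∘ Fin.castSucc) g with hv
  -- `κ` is the derivative at zero of `ε G(y, 0) = y * w y`, up to `ε`, so it is `ε` times the value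
  -- of the cofactor `w` at zero.
  refine exists_nodeRegularField (κ := e * (((f.totalDegree - 1 : ℕ) : ℝ) *
    (f.totalDegree * (s * v)))) (contDiff_const.mul hN) (contDiff_const.mul hB)
    (contDiff_const.mul hG) ?_ ?_ ?_ ?_
    (asymptoticField_centralChart f e ε he hp2 hp hs)
  · rw [coeffB_zero f hg hp2 hp]
    have := mul_pos hn0 hpos
    linarith
  · have h0 := coeffG_equator f hg hp hs 0
    rw [zero_mul] at h0
    exact mul_eq_zero_of_right _ h0
  · have := mul_pos hn1 (mul_pos hn0 hpos)
    linarith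
  · set w : ℝ → ℝ := fun y => ((f.totalDegree - 1 : ℕ) : ℝ) * (f.totalDegree * (s *
      eval ![p 0 - s * y * p 1, p 1 + s * y * p 0] g)) with hw
    have hwd : Differentiable ℝ w := by
      have h1 : ContDiff ℝ 1 fun y : ℝ => eval ![p 0 - s * y * p 1, p 1 + s * y * p 0] g := by
        refine contDiff_eval g fun i => ?_
        fin_cases i
        · change ContDiff ℝ 1 fun y : ℝ => p 0 - s * y * p 1
          fun_prop
        · change ContDiff ℝ 1 fun y : ℝ => p 1 + s * y * p 0
          fun_prop
      exact (((h1.differentiable one_ne_zero).const_mul s).const_mul _).const_mul _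
    have hw0 : w 0 = ((f.totalDegree - 1 : ℕ) : ℝ) * (f.totalDegree * (s * v)) := by
      have : ![p 0 - s * 0 * p 1, p 1 + s * 0 * p 0] = p.ofLp ∘ Fin.castSucc := by
        funext i
        fin_cases i
        · change p 0 - s * 0 * p 1 = p 0
          ring
        · change p 1 + s * 0 * p 0 = p 1
          ring
      rw [hw, hv, ← this]
    have hd := ((hasDerivAt_id (0 : ℝ)).mul (hwd 0).hasDerivAt).const_mul e
    have heq : (fun y => e * coeffG f p s (y, 0)) = fun y => e * (id y * w y) :=
      funext fun y => by rw [coeffG_equator f hg hp hs y]; rfl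
    rw [heq, ← hw0]
    simpa using hd

end equator

/-! ### From the plane to the sphere -/

theorem planeRotation_apply (c d : ℝ) (x : E2) :
    planeRotation c d x 0 = c * x 0 - d * x 1 ∧ planeRotation c d x 1 = d * x 0 + c * x 1 :=
  ⟨rfl, rfl⟩

theorem hasFDerivAt_planeRotation (c d : ℝ) (x : E2) :
    ∃ R : E2 →L[ℝ] E2, (∀ ξ, R ξ = planeRotation c d ξ) ∧ HasFDerivAt (planeRotation c d) R x := by
  let R : E2 →ₗ[ℝ] E2 :=
    { toFun := planeRotation c d
      map_add' := fun x y => by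
        ext i
        fin_cases i
        · change c * (x 0 + y 0) - d * (x 1 + y 1) = c * x 0 - d * x 1 + (c * y 0 - d * y 1)
          ring
        · change d * (x 0 + y 0) + c * (x 1 + y 1) = d * x 0 + c * x 1 + (d * y 0 + c * y 1)
          ring
      map_smul' := fun r x => by
        ext i
        fin_cases i
        · change c * (r * x 0) - d * (r * x 1) = r * (c * x 0 - d * x 1)
          ring
        · change d * (r * x 0) + c * (r * x 1) = r * (d * x 0 + c * x 1)
          ring }
  exact ⟨LinearMap.toContinuousLinearMap R, fun _ => rfl,
    (LinearMap.toContinuousLinearMap R).hasFDerivAt⟩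

section equator

variable {p : E3} {s : ℝ}

/-- Positively oriented orthonormal bases of the tangent plane at a point of the equator. -/
theorem exists_rotation_of_cross_eq (hp2 : p 2 = 0) (hp : p 0 ^ 2 + p 1 ^ 2 = 1) (hs : s ^ 2 = 1)
    {a b : E3} (hab : Orthonormal ℝ ![a, b]) (hcross : cross a b = p) :
    ∃ c d : ℝ, c ^ 2 + d ^ 2 = 1 ∧ a = c • equatorVec p s + d • poleVec s ∧
      b = (-d) • equatorVec p s + c • poleVec s := by
  have hna : a 0 * a 0 + a 1 * a 1 + a 2 * a 2 = 1 := by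
    rw [← inner_coord, real_inner_self_eq_norm_sq]
    have : ‖a‖ = 1 := hab.1 0
    rw [this, one_pow]
  have hnab : a 0 * b 0 + a 1 * b 1 + a 2 * b 2 = 0 := by
    rw [← inner_coord]
    exact hab.2 (show (0 : Fin 2) ≠ 1 by decide)
  rw [cross_coord] at hcross
  have c0 : a 1 * b 2 - a 2 * b 1 = p 0 := congrArg (fun q : E3 => q 0) hcross
  have c1 : a 2 * b 0 - a 0 * b 2 = p 1 := congrArg (fun q : E3 => q 1) hcross
  have c2 : a 0 * b 1 - a 1 * b 0 = 0 := (congrArg (fun q : E3 => q 2) hcross).trans hp2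
  have hap : p 0 * a 0 + p 1 * a 1 = 0 := by
    rw [← c0, ← c1]
    linear_combination -a 2 * c2
  have hbp : p 0 * b 0 + p 1 * b 1 = 0 := by
    rw [← c0, ← c1]
    linear_combination -b 2 * c2
  set k := -p 1 * a 0 + p 0 * a 1 with hk
  set l := -p 1 * b 0 + p 0 * b 1 with hl
  have a0 : a 0 = -(k * p 1) := by
    rw [hk]; linear_combination (-a 0) * hp + p 0 * hap
  have a1 : a 1 = k * p 0 := by
    rw [hk]; linear_combination (-a 1) * hp + p 1 * hap
  have b0 : b 0 = -(l * p 1) := by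
    rw [hl]; linear_combination (-b 0) * hp + p 0 * hbp
  have b1 : b 1 = l * p 0 := by
    rw [hl]; linear_combination (-b 1) * hp + p 1 * hbp
  clear_value k l
  rw [a0, a1] at hna
  rw [a0, a1, b0, b1] at hnab
  rw [a1, b1] at c0
  rw [a0, b0] at c1
  have hka : k ^ 2 + a 2 ^ 2 = 1 := by linear_combination hna - k ^ 2 * hp
  have hkl : k * l + a 2 * b 2 = 0 := by linear_combination hnab - k * l * hp
  have hdet : k * b 2 - a 2 * l = 1 := by
    linear_combination p 0 * c0 + p 1 * c1 - (k * b 2 - a 2 * l - 1) * hp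
  -- Orthonormality and determinant one make the coordinates of `a` and `b` the columns of a
  -- rotation matrix.
  have b2 : b 2 = k := by linear_combination (-b 2) * hka + k * hdet + a 2 * hkl
  have hl2 : l = -a 2 := by linear_combination (-l) * hka + k * hkl - a 2 * hdet
  refine ⟨s * k, s * a 2, by linear_combination hka + (k ^ 2 + a 2 ^ 2) * hs, ?_, ?_⟩
  · refine ext3 ?_ ?_ ?_
    · change a 0 = s * k * -(s * p 1) + s * a 2 * 0
      linear_combination a0 + k * p 1 * hs
    · change a 1 = s * k * (s * p 0) + s * a 2 * 0
      linear_combination a1 - k * p 0 * hs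
    · change a 2 = s * k * 0 + s * a 2 * s
      linear_combination -a 2 * hs
  · refine ext3 ?_ ?_ ?_
    · change b 0 = -(s * a 2) * -(s * p 1) + s * k * 0
      linear_combination b0 - p 1 * hl2 - a 2 * p 1 * hs
    · change b 1 = -(s * a 2) * (s * p 0) + s * k * 0
      linear_combination b1 + p 0 * hl2 + a 2 * p 0 * hs
    · change b 2 = -(s * a 2) * 0 + s * k * s
      linear_combination b2 - k * hs

/-- Positively oriented orthonormal frames of the tangent plane differ by rotations, under which the
planar index is invariant; so one frame suffices. -/
theorem hasPoincareIndex_of_hasPlanarIndex {L : E3 → Set E3} {p : PoincareSphere} {i : ℝ}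
    (hp2 : (p : E3) 2 = 0) (hp : (p : E3) 0 ^ 2 + (p : E3) 1 ^ 2 = 1) (hs : s ^ 2 = 1)
    (h : HasPlanarIndex (fun x => {ξ | fderiv ℝ (centralChart p (equatorVec p s) (poleVec s)) x ξ ∈
      L (centralChart p (equatorVec p s) (poleVec s) x)}) i) : HasPoincareIndex L p i := by
  intro a b hab hcross
  obtain ⟨c, d, hcd, ha, hb⟩ := exists_rotation_of_cross_eq hp2 hp hs hab hcross
  have hcc : centralChart p a b =
      centralChart p (equatorVec p s) (poleVec s) ∘ planeRotation c d := by
    funext x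
    have : planePoint p a b x =
        planePoint p (equatorVec p s) (poleVec s) (planeRotation c d x) := by
      rw [planePoint, planePoint, (planeRotation_apply c d x).1, (planeRotation_apply c d x).2,
        ha, hb]
      module
    rw [Function.comp_apply, centralChart_eq, centralChart_eq]
    beta_reduce
    rw [this]
  have hfd : ∀ x ξ, fderiv ℝ (centralChart p a b) x ξ =
      fderiv ℝ (centralChart p (equatorVec p s) (poleVec s)) (planeRotation c d x)
        (planeRotation c d ξ) := by
    intro x ξ
    obtain ⟨R, hR, hR'⟩ := hasFDerivAt_planeRotation c d x
    have h1 := (contDiffAt_centralChart (planePoint_ne_zero (s := s) hp2 hp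
      (planeRotation c d x))).differentiableAt one_ne_zero
    rw [hcc, (h1.hasFDerivAt.comp x hR').fderiv, ContinuousLinearMap.comp_apply, hR]
  have heq : (fun x => {ξ | fderiv ℝ (centralChart p a b) x ξ ∈ L (centralChart p a b x)}) =
      fun x => {ξ | planeRotation c d ξ ∈ {ξ |
        fderiv ℝ (centralChart p (equatorVec p s) (poleVec s)) (planeRotation c d x) ξ ∈
          L (centralChart p (equatorVec p s) (poleVec s) (planeRotation c d x))}} := by
    funext x
    ext ξ
    change fderiv ℝ (centralChart p a b) x ξ ∈ L (centralChart p a b x) ↔ _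
    rw [hfd, hcc]
    rfl
  rw [heq]
  exact h.rotate hcd

/-- The central projection of the half-sphere around a point of the equator. -/
def centralProj (p : E3) (s : ℝ) (q : E3) : E2 :=
  !₂[s * (p 0 * q 1 - p 1 * q 0) / (p 0 * q 0 + p 1 * q 1), s * q 2 / (p 0 * q 0 + p 1 * q 1)]

theorem contDiffAt_centralProj {q : E3} (hq : 0 < p 0 * q 0 + p 1 * q 1) :
    ContDiffAt ℝ 1 (centralProj p s) q := by
  have h : ∀ i : Fin 3, ContDiffAt ℝ 1 (fun q : E3 => q i) q := fun i =>
    (EuclideanSpace.proj (𝕜 := ℝ) i : E3 →L[ℝ] ℝ).contDiff.contDiffAt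
  have hm : ContDiffAt ℝ 1 (fun q : E3 => p 0 * q 0 + p 1 * q 1) q :=
    (contDiffAt_const.mul (h 0)).add (contDiffAt_const.mul (h 1))
  refine contDiffAt_euclidean.2 fun i => ?_
  fin_cases i
  · exact (contDiffAt_const.mul ((contDiffAt_const.mul (h 1)).sub
      (contDiffAt_const.mul (h 0)))).div hm hq.ne'
  · exact (contDiffAt_const.mul (h 2)).div hm hq.ne'

theorem centralChart_coord (hp2 : p 2 = 0) (hp : p 0 ^ 2 + p 1 ^ 2 = 1) (x : E2) :
    0 < p 0 * centralChart p (equatorVec p s) (poleVec s) x 0 +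
      p 1 * centralChart p (equatorVec p s) (poleVec s) x 1 := by
  have hr := inv_pos.2 (norm_pos_iff.2 (planePoint_ne_zero (s := s) hp2 hp x))
  rw [centralChart_eq]
  set r := ‖planePoint p (equatorVec p s) (poleVec s) x‖⁻¹ with hrdef
  change 0 < p 0 * (r * planePoint p (equatorVec p s) (poleVec s) x 0) +
    p 1 * (r * planePoint p (equatorVec p s) (poleVec s) x 1)
  rw [planePoint_equator hp2]
  change 0 < p 0 * (r * (p 0 - s * x 0 * p 1)) + p 1 * (r * (p 1 + s * x 0 * p 0))
  rw [show p 0 * (r * (p 0 - s * x 0 * p 1)) + p 1 * (r * (p 1 + s * x 0 * p 0)) = r by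
    linear_combination r * hp]
  exact hr

theorem centralProj_centralChart (hp2 : p 2 = 0) (hp : p 0 ^ 2 + p 1 ^ 2 = 1) (hs : s ^ 2 = 1)
    (x : E2) : centralProj p s (centralChart p (equatorVec p s) (poleVec s) x) = x := by
  have hr := inv_pos.2 (norm_pos_iff.2 (planePoint_ne_zero (s := s) hp2 hp x))
  rw [centralChart_eq]
  set r := ‖planePoint p (equatorVec p s) (poleVec s) x‖⁻¹ with hrdef
  have h0 : planePoint p (equatorVec p s) (poleVec s) x 0 = p 0 - s * x 0 * p 1 := by
    rw [planePoint_equator hp2]; rfl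
  have h1 : planePoint p (equatorVec p s) (poleVec s) x 1 = p 1 + s * x 0 * p 0 := by
    rw [planePoint_equator hp2]; rfl
  have h2 : planePoint p (equatorVec p s) (poleVec s) x 2 = s * x 1 := by
    rw [planePoint_equator hp2]; rfl
  set P := planePoint p (equatorVec p s) (poleVec s) x
  have hm : p 0 * (r * P 0) + p 1 * (r * P 1) = r := by
    rw [h0, h1]; linear_combination r * hp
  change !₂[s * (p 0 * (r * P 1) - p 1 * (r * P 0)) / (p 0 * (r * P 0) + p 1 * (r * P 1)),
    s * (r * P 2) / (p 0 * (r * P 0) + p 1 * (r * P 1))] = x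
  have e0 : s * (p 0 * (r * P 1) - p 1 * (r * P 0)) / r = x 0 := by
    rw [div_eq_iff hr.ne', h0, h1]
    linear_combination r * x 0 * s ^ 2 * hp + r * x 0 * hs
  have e1 : s * (r * P 2) / r = x 1 := by
    rw [div_eq_iff hr.ne', h2]
    linear_combination r * x 1 * hs
  rw [hm, e0, e1, eta_pair]

theorem centralChart_centralProj (hp2 : p 2 = 0) (hp : p 0 ^ 2 + p 1 ^ 2 = 1) (hs : s ^ 2 = 1)
    {q : E3} (hq : 0 < p 0 * q 0 + p 1 * q 1) (hq1 : ‖q‖ = 1) :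
    centralChart p (equatorVec p s) (poleVec s) (centralProj p s q) = q := by
  set m := p 0 * q 0 + p 1 * q 1 with hm
  have hP : planePoint p (equatorVec p s) (poleVec s) (centralProj p s q) = m⁻¹ • q := by
    rw [planePoint_equator hp2]
    refine ext3 ?_ ?_ ?_
    · change p 0 - s * (s * (p 0 * q 1 - p 1 * q 0) / m) * p 1 = m⁻¹ * q 0
      field_simp
      linear_combination (p 0) * hm + q 0 * hp - (p 0 * q 1 - p 1 * q 0) * p 1 * hs
    · change p 1 + s * (s * (p 0 * q 1 - p 1 * q 0) / m) * p 0 = m⁻¹ * q 1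
      field_simp
      linear_combination (p 1) * hm + q 1 * hp + (p 0 * q 1 - p 1 * q 0) * p 0 * hs
    · change s * (s * q 2 / m) = m⁻¹ * q 2
      field_simp
      linear_combination q 2 * hs
  rw [centralChart_eq]
  change ‖planePoint p (equatorVec p s) (poleVec s) (centralProj p s q)‖⁻¹ •
    planePoint p (equatorVec p s) (poleVec s) (centralProj p s q) = q
  rw [hP, norm_smul, hq1, mul_one, norm_inv, inv_inv, Real.norm_of_nonneg hq.le, smul_smul,
    mul_inv_cancel₀ hq.ne', one_smul]

/-- The central projection as a chart of the sphere. -/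
def centralProjChart (p : E3) (s : ℝ) (hp2 : p 2 = 0) (hp : p 0 ^ 2 + p 1 ^ 2 = 1)
    (hs : s ^ 2 = 1) : OpenPartialHomeomorph PoincareSphere E2 where
  toFun q := centralProj p s q
  invFun x := ⟨centralChart p (equatorVec p s) (poleVec s) x, by
    rw [mem_sphere_zero_iff_norm]
    exact norm_centralChart (planePoint_ne_zero hp2 hp x)⟩
  source := {q | 0 < p 0 * (q : E3) 0 + p 1 * (q : E3) 1}
  target := univ
  map_source' _ _ := mem_univ _
  map_target' x _ := centralChart_coord hp2 hp x
  left_inv' q hq := Subtype.ext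
    (centralChart_centralProj hp2 hp hs hq (mem_sphere_zero_iff_norm.1 q.2))
  right_inv' x _ := centralProj_centralChart hp2 hp hs x
  open_source := by
    have h : ∀ i : Fin 3, Continuous fun q : PoincareSphere => (q : E3) i := fun i =>
      (EuclideanSpace.proj (𝕜 := ℝ) i : E3 →L[ℝ] ℝ).continuous.comp continuous_subtype_val
    exact isOpen_lt continuous_const
      ((continuous_const.mul (h 0)).add (continuous_const.mul (h 1)))
  open_target := isOpen_univ
  continuousOn_toFun q hq :=
    ((contDiffAt_centralProj hq).continuousAt.comp
      continuous_subtype_val.continuousAt).continuousWithinAt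
  continuousOn_invFun := by
    refine Continuous.continuousOn (Continuous.subtype_mk ?_ _)
    exact continuous_iff_continuousAt.2 fun x =>
      (contDiffAt_centralChart (planePoint_ne_zero hp2 hp x)).continuousAt

/-- The homeomorphism is the central projection followed by the planar straightening. The
denominator of the projection is positive on the half-sphere around `p`, so the chart height has the
sign of `σ ω`. -/
theorem hasNodeRegularType_of_nodeRegularField {L : E3 → Set E3} {p : PoincareSphere} {σ : ℤˣ}
    {h g : ℝ × ℝ → ℝ} {δ A : ℝ} {K : NNReal}
    (hp2 : (p : E3) 2 = 0) (hp : (p : E3) 0 ^ 2 + (p : E3) 1 ^ 2 = 1)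
    (hs : s = ((σ : ℤ) : ℝ))
    (H : NodeRegularField
      (fun x => {ξ | fderiv ℝ (centralChart p (equatorVec p s) (poleVec s)) x ξ ∈
        L (centralChart p (equatorVec p s) (poleVec s) x)}) h g δ A K) :
    HasNodeRegularType L p σ := by
  have hs2 : s ^ 2 = 1 := by
    rw [hs]
    rcases Int.units_eq_one_or σ with rfl | rfl <;> simp
  obtain ⟨e, he0, he00, hsign, hleaf⟩ := H.exists_straightening
  set c := centralProjChart (p : E3) s hp2 hp hs2 with hc
  have hcapp : ∀ q : PoincareSphere, c q = centralProj p s q := fun _ => rfl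
  have hpsrc : p ∈ c.source := by
    change 0 < (p : E3) 0 * (p : E3) 0 + (p : E3) 1 * (p : E3) 1
    nlinarith
  have hcp : c p = 0 := by
    rw [hcapp, centralProj, hp2]
    rw [show (p : E3) 0 * (p : E3) 1 - (p : E3) 1 * (p : E3) 0 = 0 by ring, mul_zero, zero_div]
    exact pair_eq_zero_iff.2 ⟨rfl, rfl⟩
  have hsrc : ∀ q : PoincareSphere, q ∈ (c.trans e).source ↔ q ∈ c.source ∧ c q ∈ e.source := by
    intro q
    rw [OpenPartialHomeomorph.trans_source]
    rfl
  have htgt : (c.trans e).target = e.target := by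
    rw [OpenPartialHomeomorph.trans_target]
    exact inter_eq_left.2 fun _ _ => mem_univ _
  have hne : ∀ q ∈ c.source, q ≠ p → c q ≠ 0 := by
    intro q hq hqp h0
    exact hqp (c.injOn hq hpsrc (h0.trans hcp.symm))
  refine ⟨c.trans e, (hsrc p).2 ⟨hpsrc, by rwa [hcp]⟩, ?_, ?_, ?_⟩
  · change e (c p) = 0
    rw [hcp, he00]
  · intro q hq
    obtain ⟨hq1, hq2⟩ := (hsrc q).1 hq
    change SignType.sign (e (c q) 1) = _
    rw [hsign _ hq2]
    change SignType.sign (s * (q : E3) 2 / ((p : E3) 0 * (q : E3) 0 + (p : E3) 1 * (q : E3) 1)) = _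
    rw [div_eq_mul_inv, sign_mul, sign_pos (inv_pos.2 hq1), mul_one, hs]
  · intro q hq q' hq'
    obtain ⟨hq1, hq2⟩ := (hsrc q).1 hq.1
    obtain ⟨hq1', hq2'⟩ := (hsrc q').1 hq'.1
    have hV : c q ∈ e.source \ {0} := ⟨hq2, hne q hq1 hq.2⟩
    have hV' : c q' ∈ e.source \ {0} := ⟨hq2', hne q' hq1' hq'.2⟩
    rw [htgt]
    refine Iff.trans ?_ (hleaf _ hV _ hV')
    refine sameLeaf_iff_of_chart L (ψ := centralProj p s) ?_ ?_ ?_ ?_ ?_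
      (mem_image_of_mem _ hq) (mem_image_of_mem _ hq')
    · exact fun x _ => contDiffAt_centralChart (planePoint_ne_zero hp2 hp x)
    · rintro _ ⟨r, hr, rfl⟩
      exact contDiffAt_centralProj ((hsrc r).1 hr.1).1
    · intro x hx
      have hcx : c (c.symm x) = x := c.right_inv (mem_univ x)
      refine ⟨c.symm x, ⟨(hsrc _).2 ⟨c.map_target (mem_univ x), by rw [hcx]; exact hx.1⟩, ?_⟩, rfl⟩
      intro h0
      rw [mem_singleton_iff.1 h0, hcp] at hcx
      exact hx.2 hcx.symm
    · rintro _ ⟨r, hr, rfl⟩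
      obtain ⟨hr1, hr2⟩ := (hsrc r).1 hr.1
      exact ⟨hr2, hne r hr1 hr.2⟩
    · rintro _ ⟨r, hr, rfl⟩
      exact centralChart_centralProj hp2 hp hs2 ((hsrc r).1 hr.1).1
        (mem_sphere_zero_iff_norm.1 r.2)

end equator

end

/-! ### The theorem -/

theorem mainTheorem4 (f : MvPolynomial (Fin 2) ℝ) (n : ℕ) (hdeg : f.totalDegree = n) (hn : 3 ≤ n)
    (hf : Squarefree (MvPolynomial.homogeneousComponent n f))
    (p : PoincareSphere) (ε : ℤˣ) (hp : IsSingularPointAtInfinity (asymptoticField f ε) p) :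
    HasPoincareIndex (asymptoticField f ε) p (1 / 2) ∧
      ∃ σ : ℤˣ, HasNodeRegularType (asymptoticField f ε) p σ ∧
        HasNodeRegularType (asymptoticField f (-ε)) p (-σ) := by
  subst hdeg
  obtain ⟨hp2, a, ha, b, hb, hab⟩ := hp
  have hn2 : 2 ≤ f.totalDegree := by omega
  have hpn : (p : E3) 0 ^ 2 + (p : E3) 1 ^ 2 = 1 := by
    have h1 : inner ℝ (p : E3) (p : E3) = 1 := by
      rw [real_inner_self_eq_norm_sq, mem_sphere_zero_iff_norm.1 p.2, one_pow]
    rw [inner_coord, hp2] at h1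
    linarith
  have h0 := eval_leading_eq_zero hn2 hp2 hpn ha hb hab
  obtain ⟨g, hg, hg0⟩ := (homogeneousComponent_isHomogeneous f.totalDegree f).exists_simple_factor
    hf (p := (p : E3).ofLp ∘ Fin.castSucc) hpn h0
  set v := eval ((p : E3).ofLp ∘ Fin.castSucc) g with hv
  -- The node lies on the side `σ` with `ε σ g(p) > 0`, so `σ` is `ε` times the sign of `g(p)`.
  -- Replacing `(ε, σ)` by `(-ε, -σ)` keeps the product, which puts the node of the other field on
  -- the opposite side.
  obtain ⟨σ, hσ⟩ : ∃ σ : ℤˣ, 0 < ((ε : ℤ) : ℝ) * ((σ : ℤ) : ℝ) * v := by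
    have hεε : ((ε : ℤ) : ℝ) * ((ε : ℤ) : ℝ) = 1 := by
      rcases Int.units_eq_one_or ε with rfl | rfl <;> simp
    rcases lt_or_gt_of_ne hg0 with h | h
    · refine ⟨-ε, ?_⟩
      rw [Units.val_neg, Int.cast_neg, mul_neg, hεε]
      linarith
    · refine ⟨ε, ?_⟩
      rw [hεε]
      linarith
  have hs : ∀ τ : ℤˣ, ((τ : ℤ) : ℝ) ^ 2 = 1 := by
    intro τ
    rcases Int.units_eq_one_or τ with rfl | rfl <;> simp
  have hσ' : 0 < (((-ε : ℤˣ) : ℤ) : ℝ) * (((-σ : ℤˣ) : ℤ) : ℝ) * v := by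
    simpa using hσ
  obtain ⟨_, _, _, _, _, H⟩ :=
    exists_nodeRegularField_centralChart hn2 hg hp2 hpn (hs σ) ε hσ
  obtain ⟨_, _, _, _, _, H'⟩ :=
    exists_nodeRegularField_centralChart hn2 hg hp2 hpn (hs (-σ)) (-ε) hσ'
  exact ⟨hasPoincareIndex_of_hasPlanarIndex hp2 hpn (hs σ) H.hasPlanarIndex, σ,
    hasNodeRegularType_of_nodeRegularField hp2 hpn rfl H,
    hasNodeRegularType_of_nodeRegularField hp2 hpn rfl H'⟩
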